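/- Let $M^n$ be a Cartan-Hadamard manifold, i.e. a complete simply connected smooth Riemannian manifold of nonpositive sectional curvature, with curvature tensor $R(X,Y)Z=\nabla_X\nabla_YZ-\nabla_Y\nabla_XZ-\nabla_{[X,Y]}Z$. Suppose that its nullity index $\mu(M)=\inf_{p\in M}\dim\{Z\in T_pM : R(X,Y)Z=0 \text{ for all } X,Y\in T_pM\}$ satisfies $\mu(M)\ge n-3$. Let $C\subset M$ be a compact (geodesically) convex set with nonempty interior whose boundary $\Gamma=\partial C$ is a $C^\infty$ embedded hypersurface, let $\nu$ be the outward unit normal field of $\Gamma$, $A(X)=\nabla_X\nu$ its shape operator, and $GK=\det A$ its Gauss-Kronecker curvature. For a Riemannian manifold $N^k$ and an orthonormal basis $e_1,\dots,e_k$ of $T_pN$, let $\Omega_{ij}(X,Y)=\langle R(X,Y)e_j,e_i\rangle$ be the curvature $2$-forms (so that $\Omega_{ij}(e_i,e_j)$ is a sectional curvature) and, for $k$ even, let $$\mathrm{Pf}_N(p)=\frac1{k!}\sum_{\sigma\in S_k}\mathrm{sgn}(\sigma)\,\bigl(\Omega_{\sigma(1)\sigma(2)}\wedge\cdots\wedge\Omega_{\sigma(k-1)\sigma(k)}\bigr)(e_1,\dots,e_k),$$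 where the wedge product is normalised by $(\theta_1\wedge\cdots\wedge\theta_m)(v_1,\dots,v_m)=\det(\theta_i(v_j))$ for $1$-forms $\theta_i$ (so $\mathrm{Pf}_{\mathbf S^k}\equiv1$). For $n$ even and an orthonormal basis $e_1,\dots,e_{n-1}$ of $T_p\Gamma$, let $\alpha_i(X)=\langle A(X),e_i\rangle$, let $\Omega_{ij}$ be the curvature forms of $M$, and let $$\mathrm{TPf}_\Gamma(p)=\sum_{s=0}^{n/2-1}c_{n,s}\sum_{\sigma\in S_{n-1}}\mathrm{sgn}(\sigma)\bigl(\alpha_{\sigma(1)}\wedge\cdots\wedge\alpha_{\sigma(n-1-2s)}\wedge\Omega_{\sigma(n-2s)\sigma(n-2s+1)}\wedge\cdots\wedge\Omega_{\sigma(n-2)\sigma(n-1)}\bigr)(e_1,\dots,e_{n-1}),$$ $$c_{n,s}=\frac{|\mathbf S^{n-1}|}{(4\pi)^s\,|\mathbf S^{n-1-2s}|\,(n-1-2s)!}.$$ (i) If $n$ is odd, then $\mathrm{Pf}_\Gamma\le GK$ at every point of $\Gamma$, where $\Gamma$ carries the induced metric. (ii) If $n\ge4$ is even, then $\mathrm{Pf}_C=0$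 at every point of $C$, where $C$ carries the metric of $M$, and $\mathrm{TPf}_\Gamma\le GK$ at every point of $\Gamma$. Both hold for every choice of the orthonormal basis. -/

import Mathlib

open Bundle Set Filter
open scoped Manifold ContDiff Topology

noncomputable section

namespace Riem

section Coordinates

variable {E : Type*} [NormedAddCommGroup E] [NormedSpace ℝ E]

set_option maxSynthPendingDepth 3 in
/-- Christoffel symbols, as a bilinear map, of a metric `G` given on (an open subset of) a vector
space: `christoffel G y u v` is the vector `Γ` with
`G_y(Γ, w) = (1/2) (D_u G(v, w) + D_v G(u, w) - D_w G(u, v))` for all `w`. -/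
def christoffel (G : E → E →L[ℝ] E →L[ℝ] ℝ) (y : E) : E →L[ℝ] E →L[ℝ] E :=
  let D : E →L[ℝ] E →L[ℝ] E →L[ℝ] ℝ := fderiv ℝ G y
  let D₂ : E →L[ℝ] E →L[ℝ] E →L[ℝ] ℝ := ContinuousLinearMap.flip D
  let flip : (E →L[ℝ] E →L[ℝ] ℝ) →L[ℝ] E →L[ℝ] E →L[ℝ] ℝ :=
    (ContinuousLinearMap.flipₗᵢ ℝ E E ℝ).toContinuousLinearEquiv.toContinuousLinearMap
  let D₃ : E →L[ℝ] E →L[ℝ] E →L[ℝ] ℝ := ContinuousLinearMap.comp flip D₂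
  let K : E →L[ℝ] E →L[ℝ] E →L[ℝ] ℝ := (1 / 2 : ℝ) • (D + D₂ - D₃)
  (ContinuousLinearMap.compL ℝ E (E →L[ℝ] ℝ) E (G y).inverse).comp K

/-- The curvature tensor `R(u, v) w = ∇_u ∇_v w - ∇_v ∇_u w` (constant fields `u`, `v`, `w`) of a
metric `G` given on (an open subset of) a vector space, at the point `y`. -/
def coordCurvature (G : E → E →L[ℝ] E →L[ℝ] ℝ) (y u v w : E) : E :=
  fderiv ℝ (christoffel G) y u v w - fderiv ℝ (christoffel G) y v u w
    + christoffel G y u (christoffel G y v w) - christoffel G y v (christoffel G y u w)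

end Coordinates

section Curvature

variable {E : Type*} [NormedAddCommGroup E] [NormedSpace ℝ E]
  {M : Type*} [TopologicalSpace M] [ChartedSpace E M]

/-- The expression of a metric tensor `g` in the chart centred at `p`, i.e. its pull-back under the
inverse of that chart. -/
def metricInChart
    (g : ∀ x : M, TangentSpace 𝓘(ℝ, E) x →L[ℝ] TangentSpace 𝓘(ℝ, E) x →L[ℝ] ℝ)
    (p : M) (y : E) : E →L[ℝ] E →L[ℝ] ℝ :=
  let L : E →L[ℝ] E :=
    mfderiv 𝓘(ℝ, E) 𝓘(ℝ, E) (extChartAt 𝓘(ℝ, E) p).symm y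
  let B : E →L[ℝ] E →L[ℝ] ℝ := g ((extChartAt 𝓘(ℝ, E) p).symm y)
  ContinuousLinearMap.bilinearComp B L L

/-- The derivative at `x` of the chart centred at `p`, a map from `T_x M` to the model space. -/
def chartDeriv (p x : M) : TangentSpace 𝓘(ℝ, E) x →L[ℝ] E :=
  mfderiv 𝓘(ℝ, E) 𝓘(ℝ, E) (extChartAt 𝓘(ℝ, E) p) x

/-- The Riemann curvature tensor `R(X, Y) Z ∈ T_p M` of the Levi-Civita connection of the metric
tensor `g`, computed in the chart centred at `p`, with the sign convention
`R(X, Y) Z = ∇_X ∇_Y Z - ∇_Y ∇_X Z - ∇_[X, Y] Z`. -/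
def curvature
    (g : ∀ x : M, TangentSpace 𝓘(ℝ, E) x →L[ℝ] TangentSpace 𝓘(ℝ, E) x →L[ℝ] ℝ)
    (p : M) (X Y Z : TangentSpace 𝓘(ℝ, E) p) : TangentSpace 𝓘(ℝ, E) p :=
  (chartDeriv p p).inverse
    (coordCurvature (metricInChart g p) (extChartAt 𝓘(ℝ, E) p p)
      (chartDeriv p p X) (chartDeriv p p Y) (chartDeriv p p Z))

/-- The curvature `2`-forms `Ω_{ij}(X, Y) = ⟨R(X, Y) e_j, e_i⟩` in a frame `e` of `T_p M`, so that
`Ω_{ij}(e_i, e_j)` is the sectional curvature of the plane of `e_i, e_j` if `e` is orthonormal. -/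
def curvatureForm
    (g : ∀ x : M, TangentSpace 𝓘(ℝ, E) x →L[ℝ] TangentSpace 𝓘(ℝ, E) x →L[ℝ] ℝ)
    (p : M) {k : ℕ} (e : Fin k → TangentSpace 𝓘(ℝ, E) p) (i j : Fin k)
    (X Y : TangentSpace 𝓘(ℝ, E) p) : ℝ :=
  g p (curvature g p X Y (e j)) (e i)

/-- The sectional curvature of the plane spanned by `X` and `Y`. -/
def sectionalCurvature
    (g : ∀ x : M, TangentSpace 𝓘(ℝ, E) x →L[ℝ] TangentSpace 𝓘(ℝ, E) x →L[ℝ] ℝ)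
    (p : M) (X Y : TangentSpace 𝓘(ℝ, E) p) : ℝ :=
  g p (curvature g p X Y Y) X / (g p X X * g p Y Y - g p X Y ^ 2)

/-- The nullity space `{Z | R(X, Y) Z = 0 for all X, Y}` of the curvature tensor at `p`. -/
def nullitySpace
    (g : ∀ x : M, TangentSpace 𝓘(ℝ, E) x →L[ℝ] TangentSpace 𝓘(ℝ, E) x →L[ℝ] ℝ)
    (p : M) : Submodule ℝ (TangentSpace 𝓘(ℝ, E) p) where
  carrier := {Z | ∀ X Y : TangentSpace 𝓘(ℝ, E) p, curvature g p X Y Z = 0}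
  zero_mem' := by
    intro X Y
    simp [curvature, coordCurvature]
  add_mem' := by
    intro Z W hZ hW X Y
    have h : curvature g p X Y (Z + W) = curvature g p X Y Z + curvature g p X Y W := by
      simp only [curvature, coordCurvature, ← map_add]
      congr 1
      simp only [map_add]
      abel
    rw [h, hZ X Y, hW X Y, add_zero]
  smul_mem' := by
    intro c Z hZ X Y
    have h : curvature g p X Y (c • Z) = c • curvature g p X Y Z := by
      simp only [curvature, coordCurvature, ← map_smul]
      congr 1
      simp only [map_smul, smul_sub, smul_add]
    rw [h, hZ X Y, smul_zero]

/-- The nullity index `μ`: the infimum over all points of the dimension of the nullity space. -/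
def nullityIndex
    (g : ∀ x : M, TangentSpace 𝓘(ℝ, E) x →L[ℝ] TangentSpace 𝓘(ℝ, E) x →L[ℝ] ℝ) : ℕ :=
  ⨅ p : M, Module.finrank ℝ (nullitySpace g p)

/-- The family `e` in `T_p M` is orthonormal for the metric tensor `g`. (It is an orthonormal basis
when its length is the dimension of `M`.) -/
def IsOrthonormalFrame
    (g : ∀ x : M, TangentSpace 𝓘(ℝ, E) x →L[ℝ] TangentSpace 𝓘(ℝ, E) x →L[ℝ] ℝ)
    (p : M) {k : ℕ} (e : Fin k → TangentSpace 𝓘(ℝ, E) p) : Prop :=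
  ∀ i j, g p (e i) (e j) = if i = j then 1 else 0

/-- `γ` is a geodesic of the metric `g` along `s`: around each time in `s` it satisfies, in some
chart, the geodesic equation `c'' + Γ_c(c', c') = 0` (written here with `w = c'`). -/
def IsGeodesicOn
    (g : ∀ x : M, TangentSpace 𝓘(ℝ, E) x →L[ℝ] TangentSpace 𝓘(ℝ, E) x →L[ℝ] ℝ)
    (γ : ℝ → M) (s : Set ℝ) : Prop :=
  ∀ t ∈ s, ∃ (p : M) (w : ℝ → E), ∀ᶠ τ in 𝓝 t,
    γ τ ∈ (extChartAt 𝓘(ℝ, E) p).source ∧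
    HasDerivAt (fun r ↦ extChartAt 𝓘(ℝ, E) p (γ r)) (w τ) τ ∧
    HasDerivAt w
      (-christoffel (metricInChart g p) (extChartAt 𝓘(ℝ, E) p (γ τ)) (w τ) (w τ)) τ

/-- `C` is geodesically convex: it contains every geodesic segment whose end points are in `C`. -/
def IsGeodesicallyConvex
    (g : ∀ x : M, TangentSpace 𝓘(ℝ, E) x →L[ℝ] TangentSpace 𝓘(ℝ, E) x →L[ℝ] ℝ)
    (C : Set M) : Prop :=
  ∀ (γ : ℝ → M) (a b : ℝ), a ≤ b → IsGeodesicOn g γ (Icc a b) → γ a ∈ C → γ b ∈ C →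
    ∀ t ∈ Icc a b, γ t ∈ C

end Curvature

section Wedge

/-- The value on `v` of the wedge product `α_1 ∧ ⋯ ∧ α_r ∧ η_1 ∧ ⋯ ∧ η_s` of `1`-forms `α_a` and
(alternating) `2`-forms `η_b`, normalised so that `(θ_1 ∧ ⋯ ∧ θ_m)(v_1, …, v_m) = det (θ_i(v_j))`
for `1`-forms: `2^{-s} ∑_τ sgn(τ) ∏_a α_a(v_{τ(a)}) ∏_b η_b(v_{τ(r+2b-1)}, v_{τ(r+2b)})`. -/
def wedge {V : Type*} {r s m : ℕ} (h : r + 2 * s = m) (α : Fin r → V → ℝ)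
    (η : Fin s → V → V → ℝ) (v : Fin m → V) : ℝ :=
  (1 / 2 ^ s : ℝ) * ∑ τ : Equiv.Perm (Fin m), ((Equiv.Perm.sign τ : ℤ) : ℝ) *
    ((∏ a : Fin r, α a (v (τ ⟨a, by have := a.2; omega⟩))) *
      ∏ b : Fin s, η b (v (τ ⟨r + 2 * b, by have := b.2; omega⟩))
        (v (τ ⟨r + 2 * b + 1, by have := b.2; omega⟩)))

/-- The volume `|S^j|` of the unit sphere of `ℝ^{j+1}`. -/
def sphereVolume (j : ℕ) : ℝ :=
  ((MeasureTheory.volume : MeasureTheory.Measure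
    (EuclideanSpace ℝ (Fin (j + 1)))).toSphere).real Set.univ

end Wedge

section Pfaffian

variable {E : Type*} [NormedAddCommGroup E] [NormedSpace ℝ E]
  {M : Type*} [TopologicalSpace M] [ChartedSpace E M]

/-- The normalised Pfaffian
`(1/k!) ∑_σ sgn(σ) (Ω_{σ(1)σ(2)} ∧ ⋯ ∧ Ω_{σ(k-1)σ(k)})(e_1, …, e_k)` of the curvature forms of the
metric `g`, computed in the frame `e` of `T_p M`; here `k` is even. -/
def pfaffian
    (g : ∀ x : M, TangentSpace 𝓘(ℝ, E) x →L[ℝ] TangentSpace 𝓘(ℝ, E) x →L[ℝ] ℝ)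
    (p : M) {k : ℕ} (hk : Even k) (e : Fin k → TangentSpace 𝓘(ℝ, E) p) : ℝ :=
  (1 / (k.factorial : ℝ)) * ∑ σ : Equiv.Perm (Fin k), ((Equiv.Perm.sign σ : ℤ) : ℝ) *
    wedge (r := 0) (s := k / 2) (by have := Nat.two_mul_div_two_of_even hk; omega)
      (fun a ↦ a.elim0)
      (fun b ↦ curvatureForm g p e (σ ⟨2 * b, by have := b.2; omega⟩)
        (σ ⟨2 * b + 1, by have := b.2; omega⟩)) e

end Pfaffian

section Ambient

variable {E : Type*} [NormedAddCommGroup E] [NormedSpace ℝ E]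
  (M : Type*) [MetricSpace M] [ChartedSpace E M]
  [RiemannianBundle (fun x : M ↦ TangentSpace 𝓘(ℝ, E) x)]

/-- The Riemannian metric of `M` as a tensor. -/
def ambientMetric (x : M) :
    TangentSpace 𝓘(ℝ, E) x →L[ℝ] TangentSpace 𝓘(ℝ, E) x →L[ℝ] ℝ :=
  innerSL ℝ

/-- A Riemannian manifold `M` is Cartan-Hadamard if it is complete, simply connected, and of
nonpositive sectional curvature. -/
structure IsCartanHadamard : Prop where
  complete : CompleteSpace M
  simplyConnected : SimplyConnectedSpace M
  nonpos : ∀ (p : M) (X Y : TangentSpace 𝓘(ℝ, E) p), LinearIndependent ℝ ![X, Y] →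
    sectionalCurvature (ambientMetric M) p X Y ≤ 0

end Ambient

section Hypersurface

variable {E : Type*} [NormedAddCommGroup E] [NormedSpace ℝ E]
  {M : Type*} [MetricSpace M] [ChartedSpace E M] [IsManifold 𝓘(ℝ, E) 1 M]
  [RiemannianBundle (fun x : M ↦ TangentSpace 𝓘(ℝ, E) x)]
  {F : Type*} [NormedAddCommGroup F] [NormedSpace ℝ F]
  {N : Type*} [TopologicalSpace N] [ChartedSpace F N]

/-- The differential of a map `ι : N → M`. -/
def differential (ι : N → M) (q : N) :
    TangentSpace 𝓘(ℝ, F) q →L[ℝ] TangentSpace 𝓘(ℝ, E) (ι q) :=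
  mfderiv 𝓘(ℝ, F) 𝓘(ℝ, E) ι q

/-- The metric induced on `N` by a map `ι : N → M`. -/
def inducedMetric (ι : N → M) (q : N) :
    TangentSpace 𝓘(ℝ, F) q →L[ℝ] TangentSpace 𝓘(ℝ, F) q →L[ℝ] ℝ :=
  let L : F →L[ℝ] E := differential ι q
  let B : E →L[ℝ] E →L[ℝ] ℝ := ambientMetric M (ι q)
  let B' : F →L[ℝ] F →L[ℝ] ℝ := ContinuousLinearMap.bilinearComp B L L
  B'

/-- `C` is a compact geodesically convex set with nonempty interior, and `ι : N → M` is a smooth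
embedding onto its boundary: `Γ = ι(N)` is a smooth convex hypersurface bounding `C`. -/
structure IsSmoothConvexHypersurface (ι : N → M) (C : Set M) : Prop where
  isCompact : IsCompact C
  convex : IsGeodesicallyConvex (ambientMetric (E := E) M) C
  interior_nonempty : (interior C).Nonempty
  isSmoothEmbedding : Manifold.IsSmoothEmbedding 𝓘(ℝ, F) 𝓘(ℝ, E) ∞ ι
  range_eq : range ι = frontier C

/-- `ν` is the (smooth) outward unit normal field of the hypersurface `ι` bounding `C`. Outward
means that a curve through `ι q` with velocity `ν q` (a line in a chart) is in `C` just before and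
outside `C` just after its passage through `ι q`. -/
structure IsOutwardUnitNormal (ι : N → M) (C : Set M)
    (ν : ∀ q : N, TangentSpace 𝓘(ℝ, E) (ι q)) : Prop where
  contMDiff : ContMDiff 𝓘(ℝ, F) 𝓘(ℝ, E).tangent ∞
    (fun q ↦ (⟨ι q, ν q⟩ : TangentBundle 𝓘(ℝ, E) M))
  unit : ∀ q, ambientMetric M (ι q) (ν q) (ν q) = 1
  normal : ∀ (q : N) (X : TangentSpace 𝓘(ℝ, F) q),
    ambientMetric M (ι q) (ν q) (differential ι q X) = 0
  before : ∀ q, ∀ᶠ t in 𝓝[<] (0 : ℝ), (extChartAt 𝓘(ℝ, E) (ι q)).symm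
    (extChartAt 𝓘(ℝ, E) (ι q) (ι q) + t • chartDeriv (ι q) (ι q) (ν q)) ∈ C
  after : ∀ q, ∀ᶠ t in 𝓝[>] (0 : ℝ), (extChartAt 𝓘(ℝ, E) (ι q)).symm
    (extChartAt 𝓘(ℝ, E) (ι q) (ι q) + t • chartDeriv (ι q) (ι q) (ν q)) ∉ C

/-- The shape operator `A(X) = ∇_X ν ∈ T_{ι q} M`, where `X ∈ T_q N` and `∇` is the Levi-Civita
connection of `M`: in the chart of `M` centred at `ι q`, where `ν` becomes the vector-valued
function `ν̃`, it is `∂_X ν̃ + Γ(dι X, ν̃)`. -/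
def shapeOperator (ι : N → M) (ν : ∀ q : N, TangentSpace 𝓘(ℝ, E) (ι q)) (q : N)
    (X : TangentSpace 𝓘(ℝ, F) q) : TangentSpace 𝓘(ℝ, E) (ι q) :=
  let dν : TangentSpace 𝓘(ℝ, F) q →L[ℝ] E :=
    mfderiv 𝓘(ℝ, F) 𝓘(ℝ, E) (fun q' ↦ chartDeriv (ι q) (ι q') (ν q')) q
  (chartDeriv (ι q) (ι q)).inverse
    (dν X + christoffel (metricInChart (ambientMetric M) (ι q))
      (extChartAt 𝓘(ℝ, E) (ι q) (ι q))
      (chartDeriv (ι q) (ι q) (differential ι q X)) (chartDeriv (ι q) (ι q) (ν q)))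

/-- The `1`-forms `α_i(X) = ⟨A(X), e_i⟩` of a frame `e` of `T_q N`. -/
def shapeForm (ι : N → M) (ν : ∀ q : N, TangentSpace 𝓘(ℝ, E) (ι q)) (q : N) {k : ℕ}
    (e : Fin k → TangentSpace 𝓘(ℝ, F) q) (i : Fin k) (X : TangentSpace 𝓘(ℝ, F) q) : ℝ :=
  ambientMetric M (ι q) (shapeOperator ι ν q X) (differential ι q (e i))

/-- The Gauss-Kronecker curvature `GK = det A`: the determinant of the matrix of the shape operator
in an orthonormal basis `e` of `T_q N`. -/
def gaussKronecker (ι : N → M) (ν : ∀ q : N, TangentSpace 𝓘(ℝ, E) (ι q)) (q : N) {k : ℕ}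
    (e : Fin k → TangentSpace 𝓘(ℝ, F) q) : ℝ :=
  (Matrix.of fun i j : Fin k ↦ shapeForm ι ν q e i (e j)).det

/-- The constants `c_{k,s} = |S^{k-1}| / ((4π)^s |S^{k-1-2s}| (k-1-2s)!)`, for `2s < k`. -/
def transgressionConst (k s : ℕ) : ℝ :=
  sphereVolume (k - 1) /
    ((4 * Real.pi) ^ s * sphereVolume (k - 1 - 2 * s) * ((k - 1 - 2 * s).factorial : ℝ))

/-- Chern's boundary transgression integrand `∑_{s=0}^{k/2-1} c_{k,s} Φ_s(e_1, …, e_{k-1})` of the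
hypersurface `ι` in a manifold of even dimension `k`, in an orthonormal basis `e` of `T_q N`, where
`Φ_s = ∑_σ sgn(σ) α_{σ(1)} ∧ ⋯ ∧ α_{σ(k-1-2s)} ∧ Ω_{σ(k-2s)σ(k-2s+1)} ∧ ⋯ ∧ Ω_{σ(k-2)σ(k-1)}`,
and `Ω` are the curvature forms of the ambient manifold. -/
def transgression (ι : N → M) (ν : ∀ q : N, TangentSpace 𝓘(ℝ, E) (ι q)) (q : N) {k : ℕ}
    (e : Fin (k - 1) → TangentSpace 𝓘(ℝ, F) q) : ℝ :=
  ∑ s : Fin (k / 2), transgressionConst k s *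
    ∑ σ : Equiv.Perm (Fin (k - 1)), ((Equiv.Perm.sign σ : ℤ) : ℝ) *
      wedge (r := k - 1 - 2 * s) (s := s) (by have := s.2; omega)
        (fun a ↦ shapeForm ι ν q e (σ ⟨a, by have := a.2; omega⟩))
        (fun b X Y ↦ curvatureForm (ambientMetric (E := E) M) (ι q) (fun i ↦ differential ι q (e i))
          (σ ⟨k - 1 - 2 * s + 2 * b, by have := s.2; have := b.2; omega⟩)
          (σ ⟨k - 1 - 2 * s + 2 * b + 1, by have := s.2; have := b.2; omega⟩)
          (differential ι q X) (differential ι q Y)) e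

end Hypersurface

end Riem

end

/-! In a frame, all the quantities in question are double alternations `∑ sgn σ · sgn τ · F(σ, τ)`,
up to positive constants, where `F` is a product of entries of the shape matrix `A` and of curvature
components. By the Gauss equation the curvature of `Γ` is `R + A ∧ A`, with `R` the curvature of `M`
(`curvatureForm_inducedMetric`). Once the product is expanded, the term free of `R` is exactly `GK`.
The theorem thus says that the terms containing `R` add up to something nonpositive, and each of
them is nonpositive by itself.

Three facts give this. First, convexity of `C` makes `A` positive semidefinite
(`posSemidef_shapeForm`): if a normal curvature had the wrong sign, the geodesic tangent to `Γ` in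
that direction would enter `C` on both sides, and a slight outward shift of it would have both ends
in `C` but its midpoint outside. Secondly, `R` descends to the quotient of the tangent space by the
nullity space, of dimension at most three. There every bivector is decomposable, so nonpositive
sectional curvature makes the whole curvature operator nonpositive
(`IsCurvatureLike.isNonposOfRankThree`). Thirdly, a product with two factors `R` alternates four
covectors taken from a space of dimension three, and so vanishes (`doubleAlternation_eq_zero`).

Only terms with exactly one factor `R` remain. For these, `-F` is an entrywise product of positive
semidefinite kernels on the permutations, hence positive semidefinite by the Schur product theorem,
and the double alternation is its quadratic form at the vector of signs. This gives
`doubleAlternation_pfaffian_le` and `doubleAlternation_transgression_nonpos`. The Pfaffian of `M`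
itself has at least two factors `R` when `n ≥ 4`, so it is zero. -/

open Bundle Set Filter
open scoped Manifold ContDiff Topology

noncomputable section

namespace Riem

/-! ### Alternating sums over permutations -/

section Alternation

open Equiv Matrix

/-- The sum over pairs of permutations, weighted by both signs. -/
def doubleAlternation {k : ℕ} (F : Perm (Fin k) → Perm (Fin k) → ℝ) : ℝ :=
  ∑ σ : Perm (Fin k), ∑ τ : Perm (Fin k),
    ((Perm.sign σ : ℤ) : ℝ) * ((Perm.sign τ : ℤ) : ℝ) * F σ τ

lemma sum_mul_mul_nonneg {X : Type*} [Fintype X] {F : Matrix X X ℝ} (hF : F.PosSemidef)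
    (c : X → ℝ) : 0 ≤ ∑ x, ∑ y, c x * c y * F x y := by
  have h := hF.dotProduct_mulVec_nonneg c
  refine h.trans_eq ?_
  simp only [dotProduct, mulVec, Finset.mul_sum, star_trivial]
  exact Finset.sum_congr rfl fun x _ ↦ Finset.sum_congr rfl fun y _ ↦ by ring

lemma posSemidef_of_sum_nonneg {X : Type*} [Fintype X] {F : Matrix X X ℝ}
    (hs : ∀ x y, F x y = F y x) (h : ∀ c : X → ℝ, 0 ≤ ∑ x, ∑ y, c x * c y * F x y) :
    F.PosSemidef := by
  rw [posSemidef_iff_dotProduct_mulVec]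
  refine ⟨by ext x y; simp [hs x y], fun c ↦ (h c).trans_eq ?_⟩
  simp only [dotProduct, mulVec, Finset.mul_sum, star_trivial]
  exact Finset.sum_congr rfl fun x _ ↦ Finset.sum_congr rfl fun y _ ↦ by ring

/-- A double alternation is the quadratic form of its kernel at the vector of signs. -/
lemma doubleAlternation_nonneg {k : ℕ} {F : Matrix (Perm (Fin k)) (Perm (Fin k)) ℝ}
    (hF : F.PosSemidef) : 0 ≤ doubleAlternation F :=
  sum_mul_mul_nonneg hF _

/-- Schur product theorem, iterated; the empty product is the all-ones matrix, whose quadratic form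
is a square. -/
lemma posSemidef_prod {X ι : Type*} [Fintype X] (s : Finset ι) (f : ι → Matrix X X ℝ)
    (hf : ∀ i ∈ s, (f i).PosSemidef) :
    (Matrix.of fun x y ↦ ∏ i ∈ s, f i x y).PosSemidef := by
  classical
  induction s using Finset.induction_on with
  | empty =>
    refine posSemidef_of_sum_nonneg (by simp) fun c ↦ ?_
    simp only [Finset.prod_empty, of_apply, mul_one, ← Finset.mul_sum, ← Finset.sum_mul]
    exact mul_self_nonneg _
  | insert i s hi ih =>
    have h := (hf i (by simp)).hadamard (ih fun j hj ↦ hf j (by simp [hj]))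
    have he : (Matrix.of fun x y ↦ ∏ j ∈ insert i s, f j x y)
        = f i ⊙ Matrix.of fun x y ↦ ∏ j ∈ s, f j x y := by
      ext x y
      simp [Finset.prod_insert hi, hadamard]
    rw [he]
    exact h

lemma sum_sign_mul_eq_zero {k : ℕ} {f : Perm (Fin k) → ℝ} {i j : Fin k} (hij : i ≠ j)
    (hf : ∀ σ, f (σ * swap i j) = f σ) :
    ∑ σ : Perm (Fin k), ((Perm.sign σ : ℤ) : ℝ) * f σ = 0 := by
  have h : ∑ σ : Perm (Fin k), ((Perm.sign σ : ℤ) : ℝ) * f σ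
      = ∑ σ : Perm (Fin k), -(((Perm.sign σ : ℤ) : ℝ) * f σ) := by
    rw [← Equiv.sum_comp (Equiv.mulRight (swap i j))]
    refine Finset.sum_congr rfl fun σ _ ↦ ?_
    simp [Perm.sign_swap hij, hf]
  rw [Finset.sum_neg_distrib] at h
  linarith

lemma sum_sign_mul_swap {k : ℕ} (f : Perm (Fin k) → ℝ) {i j : Fin k} (hij : i ≠ j) :
    ∑ σ : Perm (Fin k), ((Perm.sign σ : ℤ) : ℝ) * f (σ * swap i j)
      = -∑ σ : Perm (Fin k), ((Perm.sign σ : ℤ) : ℝ) * f σ := by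
  rw [← Equiv.sum_comp (Equiv.mulRight (swap i j)) (fun σ ↦ ((Perm.sign σ : ℤ) : ℝ) * f σ),
    ← Finset.sum_neg_distrib]
  refine Finset.sum_congr rfl fun σ _ ↦ ?_
  simp [Perm.sign_swap hij]

/-- Permuting the rows by `σ` changes the determinant by `sgn σ`, which the outer sign cancels, so
each `σ` contributes `a.det`. -/
lemma doubleAlternation_prod {k : ℕ} (a : Matrix (Fin k) (Fin k) ℝ) :
    doubleAlternation (fun σ τ ↦ ∏ i, a (σ i) (τ i)) = (k.factorial : ℝ) * a.det := by
  have h : ∀ σ : Perm (Fin k), ∑ τ : Perm (Fin k),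
      ((Perm.sign σ : ℤ) : ℝ) * ((Perm.sign τ : ℤ) : ℝ) * ∏ i, a (σ i) (τ i) = a.det := by
    intro σ
    have h1 : (a.submatrix σ id).det = ∑ τ : Perm (Fin k),
        ((Perm.sign τ : ℤ) : ℝ) * ∏ i, a (σ i) (τ i) := by
      rw [← det_transpose, det_apply']
      simp
    simp only [mul_assoc]
    rw [← Finset.mul_sum, ← h1, det_permute, ← mul_assoc, ← Int.cast_mul]
    simp [← Units.val_mul]
  simp only [doubleAlternation, h]
  simp [Fintype.card_perm]

/-- A bilinear expression which factors through three linear forms. -/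
def FactorsThroughThree {X : Type*} (ξ : Fin 3 → X → ℝ) (T : X → X → ℝ) : Prop :=
  ∃ c : Fin 3 → Fin 3 → ℝ, ∀ x y, T x y = ∑ p, ∑ q, c p q * (ξ p x * ξ q y)

/-- This is the vanishing of a 4-form built from three covectors. After expansion each term carries
four of the forms `ξ`, two of which coincide; transposing their positions fixes the term and flips
the sign. -/
lemma sum_sign_mul_mul_eq_zero {k : ℕ} {ξ : Fin 3 → Fin k → ℝ} {T₁ T₂ : Fin k → Fin k → ℝ}
    (h₁ : FactorsThroughThree ξ T₁) (h₂ : FactorsThroughThree ξ T₂) {x₁ y₁ x₂ y₂ : Fin k}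
    (h12 : x₁ ≠ y₁) (h13 : x₁ ≠ x₂) (h14 : x₁ ≠ y₂) (h23 : y₁ ≠ x₂) (h24 : y₁ ≠ y₂)
    (h34 : x₂ ≠ y₂) {f : Perm (Fin k) → ℝ}
    (hf : ∀ σ σ' : Perm (Fin k),
      (∀ x, x ≠ x₁ → x ≠ y₁ → x ≠ x₂ → x ≠ y₂ → σ x = σ' x) → f σ = f σ') :
    ∑ σ : Perm (Fin k), ((Perm.sign σ : ℤ) : ℝ) *
      (T₁ (σ x₁) (σ y₁) * T₂ (σ x₂) (σ y₂) * f σ) = 0 := by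
  obtain ⟨c₁, h₁⟩ := h₁
  obtain ⟨c₂, h₂⟩ := h₂
  have key : ∀ p q r t : Fin 3, ∑ σ : Perm (Fin k), ((Perm.sign σ : ℤ) : ℝ) *
      (ξ p (σ x₁) * ξ q (σ y₁) * ξ r (σ x₂) * ξ t (σ y₂) * f σ) = 0 := by
    intro p q r t
    have hcase : p = q ∨ p = r ∨ p = t ∨ q = r ∨ q = t ∨ r = t := by
      revert p q r t; decide
    have hfs : ∀ {i j : Fin k}, (i = x₁ ∨ i = y₁ ∨ i = x₂ ∨ i = y₂) →
        (j = x₁ ∨ j = y₁ ∨ j = x₂ ∨ j = y₂) → ∀ σ, f (σ * swap i j) = f σ := by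
      intro i j hi hj σ
      refine hf _ _ fun x hx₁ hy₁ hx₂ hy₂ ↦ ?_
      have hxi : x ≠ i := by rcases hi with rfl | rfl | rfl | rfl <;> assumption
      have hxj : x ≠ j := by rcases hj with rfl | rfl | rfl | rfl <;> assumption
      simp [swap_apply_of_ne_of_ne hxi hxj]
    rcases hcase with rfl | rfl | rfl | rfl | rfl | rfl
    · refine sum_sign_mul_eq_zero h12 fun σ ↦ ?_
      rw [hfs (by simp) (by simp)]
      simp only [Perm.mul_apply, swap_apply_left, swap_apply_right,
        swap_apply_of_ne_of_ne h13.symm h23.symm, swap_apply_of_ne_of_ne h14.symm h24.symm]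
      ring
    · refine sum_sign_mul_eq_zero h13 fun σ ↦ ?_
      rw [hfs (by simp) (by simp)]
      simp only [Perm.mul_apply, swap_apply_left, swap_apply_right,
        swap_apply_of_ne_of_ne h12.symm h23, swap_apply_of_ne_of_ne h14.symm h34.symm]
      ring
    · refine sum_sign_mul_eq_zero h14 fun σ ↦ ?_
      rw [hfs (by simp) (by simp)]
      simp only [Perm.mul_apply, swap_apply_left, swap_apply_right,
        swap_apply_of_ne_of_ne h12.symm h24, swap_apply_of_ne_of_ne h13.symm h34]
      ring
    · refine sum_sign_mul_eq_zero h23 fun σ ↦ ?_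
      rw [hfs (by simp) (by simp)]
      simp only [Perm.mul_apply, swap_apply_left, swap_apply_right,
        swap_apply_of_ne_of_ne h12 h13, swap_apply_of_ne_of_ne h24.symm h34.symm]
      ring
    · refine sum_sign_mul_eq_zero h24 fun σ ↦ ?_
      rw [hfs (by simp) (by simp)]
      simp only [Perm.mul_apply, swap_apply_left, swap_apply_right,
        swap_apply_of_ne_of_ne h12 h14, swap_apply_of_ne_of_ne h23.symm h34]
      ring
    · refine sum_sign_mul_eq_zero h34 fun σ ↦ ?_
      rw [hfs (by simp) (by simp)]
      simp only [Perm.mul_apply, swap_apply_left, swap_apply_right,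
        swap_apply_of_ne_of_ne h13 h14, swap_apply_of_ne_of_ne h23 h24]
      ring
  have hexp : ∀ σ : Perm (Fin k), ((Perm.sign σ : ℤ) : ℝ) *
      (T₁ (σ x₁) (σ y₁) * T₂ (σ x₂) (σ y₂) * f σ)
      = ∑ r, ∑ t, ∑ p, ∑ q, c₁ p q * c₂ r t * (((Perm.sign σ : ℤ) : ℝ) *
        (ξ p (σ x₁) * ξ q (σ y₁) * ξ r (σ x₂) * ξ t (σ y₂) * f σ)) := by
    intro σ
    rw [h₁, h₂]
    simp only [Finset.sum_mul, Finset.mul_sum]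
    refine Finset.sum_congr rfl fun r _ ↦ ?_
    refine Finset.sum_congr rfl fun t _ ↦ ?_
    refine Finset.sum_congr rfl fun p _ ↦ ?_
    refine Finset.sum_congr rfl fun q _ ↦ ?_
    ring
  simp only [hexp]
  rw [Finset.sum_comm]
  refine Finset.sum_eq_zero fun r _ ↦ ?_
  rw [Finset.sum_comm]
  refine Finset.sum_eq_zero fun t _ ↦ ?_
  rw [Finset.sum_comm]
  refine Finset.sum_eq_zero fun p _ ↦ ?_
  rw [Finset.sum_comm]
  refine Finset.sum_eq_zero fun q _ ↦ ?_
  rw [← Finset.mul_sum, key, mul_zero]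

/-- The alternation over `τ` already antisymmetrises each pair of positions, so doing so by hand
costs a factor 2 per pair. -/
lemma sum_sign_mul_prod_sub {k : ℕ} {ι : Type*} [DecidableEq ι] (x y : ι → Fin k)
    (hx : Function.Injective x) (hy : Function.Injective y) (hxy : ∀ b b', x b ≠ y b')
    (θ : ι → Fin k → Fin k → ℝ) (S : Finset ι) :
    ∑ τ : Perm (Fin k), ((Perm.sign τ : ℤ) : ℝ) *
        ∏ b ∈ S, (θ b (τ (x b)) (τ (y b)) - θ b (τ (y b)) (τ (x b)))
      = 2 ^ S.card * ∑ τ : Perm (Fin k), ((Perm.sign τ : ℤ) : ℝ) *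
        ∏ b ∈ S, θ b (τ (x b)) (τ (y b)) := by
  -- The induction needs spectator factors: once a pair has been treated, its plain factor moves
  -- from `S` to `S'`.
  have key : ∀ (S' : Finset ι), Disjoint S S' → 
      ∑ τ : Perm (Fin k), ((Perm.sign τ : ℤ) : ℝ) *
        ((∏ b ∈ S, (θ b (τ (x b)) (τ (y b)) - θ b (τ (y b)) (τ (x b)))) *
          ∏ b ∈ S', θ b (τ (x b)) (τ (y b)))
      = 2 ^ S.card * ∑ τ : Perm (Fin k), ((Perm.sign τ : ℤ) : ℝ) *
        ((∏ b ∈ S, θ b (τ (x b)) (τ (y b))) * ∏ b ∈ S', θ b (τ (x b)) (τ (y b))) := by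
    induction S using Finset.induction_on with
    | empty => simp
    | insert b S hb ih =>
      intro S' hS'
      rw [Finset.disjoint_insert_left] at hS'
      have ih' := ih (insert b S') (by
        rw [Finset.disjoint_insert_right]; exact ⟨hb, hS'.2⟩)
      simp only [Finset.prod_insert hS'.1] at ih'
      simp only [Finset.prod_insert hb, Finset.card_insert_of_notMem hb]
      have hsw := sum_sign_mul_swap (fun τ : Perm (Fin k) ↦
        (∏ b ∈ S, (θ b (τ (x b)) (τ (y b)) - θ b (τ (y b)) (τ (x b)))) *
          (θ b (τ (x b)) (τ (y b)) * ∏ b ∈ S', θ b (τ (x b)) (τ (y b)))) (hxy b b)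
      have hprod : ∀ τ : Perm (Fin k), ∀ b', b' ≠ b → 
          (τ * swap (x b) (y b)) (x b') = τ (x b') ∧ (τ * swap (x b) (y b)) (y b') = τ (y b') := by
        intro τ b' hb'
        rw [Perm.mul_apply, Perm.mul_apply,
          swap_apply_of_ne_of_ne (fun h ↦ hb' (hx h)) (hxy _ _),
          swap_apply_of_ne_of_ne (hxy _ _).symm (fun h ↦ hb' (hy h))]
        exact ⟨rfl, rfl⟩
      have hS1 : ∀ τ : Perm (Fin k), ∏ b' ∈ S,
          (θ b' ((τ * swap (x b) (y b)) (x b')) ((τ * swap (x b) (y b)) (y b'))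
            - θ b' ((τ * swap (x b) (y b)) (y b')) ((τ * swap (x b) (y b)) (x b')))
          = ∏ b' ∈ S, (θ b' (τ (x b')) (τ (y b')) - θ b' (τ (y b')) (τ (x b'))) := fun τ ↦
        Finset.prod_congr rfl fun b' hb' ↦ by
          rw [(hprod τ b' (by rintro rfl; exact hb hb')).1,
            (hprod τ b' (by rintro rfl; exact hb hb')).2]
      have hS2 : ∀ τ : Perm (Fin k), ∏ b' ∈ S',
          θ b' ((τ * swap (x b) (y b)) (x b')) ((τ * swap (x b) (y b)) (y b'))
          = ∏ b' ∈ S', θ b' (τ (x b')) (τ (y b')) := fun τ ↦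
        Finset.prod_congr rfl fun b' hb' ↦ by
          rw [(hprod τ b' (by rintro rfl; exact hS'.1 hb')).1,
            (hprod τ b' (by rintro rfl; exact hS'.1 hb')).2]
      simp only [hS1, hS2] at hsw
      simp only [Perm.mul_apply, swap_apply_left, swap_apply_right] at hsw
      calc _ = ∑ τ : Perm (Fin k), ((Perm.sign τ : ℤ) : ℝ) *
            ((∏ b ∈ S, (θ b (τ (x b)) (τ (y b)) - θ b (τ (y b)) (τ (x b)))) *
              (θ b (τ (x b)) (τ (y b)) * ∏ b ∈ S', θ b (τ (x b)) (τ (y b))))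
          - ∑ τ : Perm (Fin k), ((Perm.sign τ : ℤ) : ℝ) *
            ((∏ b ∈ S, (θ b (τ (x b)) (τ (y b)) - θ b (τ (y b)) (τ (x b)))) *
              (θ b (τ (y b)) (τ (x b)) * ∏ b ∈ S', θ b (τ (x b)) (τ (y b)))) := by
            rw [← Finset.sum_sub_distrib]
            exact Finset.sum_congr rfl fun τ _ ↦ by ring
        _ = _ := by
            rw [hsw, ih', pow_succ, sub_neg_eq_add, ← two_mul]
            rw [mul_comm (2 ^ S.card) 2, mul_assoc]
            congr 2
            exact Finset.sum_congr rfl fun τ _ ↦ by ring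
  simpa using key ∅ (by simp)

end Alternation

/-! ### The algebraic inequalities for Pfaffians and transgression forms -/

section PfaffianAlgebra

open Equiv Matrix

variable {k : ℕ}

lemma prod_even_odd (hk : 2 * (k / 2) = k) (f : Fin k → ℝ) :
    ∏ b : Fin (k / 2), (f ⟨2 * b, by have := b.2; omega⟩ * f ⟨2 * b + 1, by have := b.2; omega⟩)
      = ∏ i, f i := by
  have h : ∀ (F : ℕ → ℝ) (m : ℕ), ∏ b ∈ Finset.range m, (F (2 * b) * F (2 * b + 1))
      = ∏ i ∈ Finset.range (2 * m), F i := by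
    intro F m
    induction m with
    | zero => simp
    | succ m ih =>
      rw [Finset.prod_range_succ, ih, show 2 * (m + 1) = 2 * m + 1 + 1 by ring,
        Finset.prod_range_succ, Finset.prod_range_succ, mul_assoc]
  have h' := h (fun i ↦ if hi : i < k then f ⟨i, hi⟩ else 1) (k / 2)
  rw [hk, Finset.prod_range, Finset.prod_range] at h'
  have h1 : ∀ b : Fin (k / 2), 2 * (b : ℕ) < k := fun b ↦ by have := b.2; omega
  have h2 : ∀ b : Fin (k / 2), 2 * (b : ℕ) + 1 < k := fun b ↦ by have := b.2; omega
  simpa [h1, h2] using h'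

/-- The curvature-like tensor `a ∧ a` of a symmetric matrix. -/
def wedgeSq (a : Matrix (Fin k) (Fin k) ℝ) (i j l m : Fin k) : ℝ :=
  a i l * a j m - a i m * a j l

/-- The quadratic form of `a ∧ a` at `c` is half that of `a ⊗ a` at the antisymmetrisation `c - c ∘
swap`. -/
lemma posSemidef_wedgeSq {a : Matrix (Fin k) (Fin k) ℝ} (ha : a.PosSemidef) :
    (Matrix.of fun p p' : Fin k × Fin k ↦ wedgeSq a p.1 p.2 p'.1 p'.2).PosSemidef := by
  have hsymm : ∀ i j, a i j = a j i := fun i j ↦ by simpa using (ha.1.apply i j).symm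
  refine posSemidef_of_sum_nonneg (fun p p' ↦ ?_) fun c ↦ ?_
  · simp only [of_apply, wedgeSq]
    rw [hsymm p.1 p'.1, hsymm p.2 p'.2, hsymm p.1 p'.2, hsymm p.2 p'.1]
    ring
  · have h := sum_mul_mul_nonneg (ha.kronecker ha) (fun p : Fin k × Fin k ↦ c p - c p.swap)
    have e : ∀ g : Fin k × Fin k → ℝ, ∑ p : Fin k × Fin k, g p.swap = ∑ p, g p := fun g ↦
      (Equiv.prodComm (Fin k) (Fin k)).sum_comp g
    set M : Fin k × Fin k → Fin k × Fin k → ℝ := fun p p' ↦ a p.1 p'.1 * a p.2 p'.2 with hM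
    set S₁ := ∑ p, ∑ p', c p * c p' * M p p' with hS₁
    set S₂ := ∑ p, ∑ p', c p * c p' * M p p'.swap with hS₂
    have e2 : ∑ p, ∑ p', c p * c p'.swap * M p p' = S₂ := by
      refine Finset.sum_congr rfl fun p _ ↦ ?_
      rw [← e]
      simp
    have e3 : ∑ p, ∑ p', c p.swap * c p' * M p p' = S₂ := by
      rw [← e]
      refine Finset.sum_congr rfl fun p _ ↦ Finset.sum_congr rfl fun p' _ ↦ ?_
      simp only [hM, Prod.swap_swap, Prod.fst_swap, Prod.snd_swap]
      ring
    have e4 : ∑ p, ∑ p', c p.swap * c p'.swap * M p p' = S₁ := by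
      rw [← e]
      refine Finset.sum_congr rfl fun p _ ↦ ?_
      rw [← e]
      refine Finset.sum_congr rfl fun p' _ ↦ ?_
      simp only [hM, Prod.swap_swap, Prod.fst_swap, Prod.snd_swap]
      ring
    have h1 : ∑ p, ∑ p', (c p - c p.swap) * (c p' - c p'.swap) * kroneckerMap (· * ·) a a p p'
        = 2 * (S₁ - S₂) := by
      calc _ = S₁ - ∑ p, ∑ p', c p * c p'.swap * M p p' - ∑ p, ∑ p', c p.swap * c p' * M p p'
            + ∑ p, ∑ p', c p.swap * c p'.swap * M p p' := by
            rw [hS₁]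
            simp only [← Finset.sum_sub_distrib, ← Finset.sum_add_distrib]
            refine Finset.sum_congr rfl fun p _ ↦ Finset.sum_congr rfl fun p' _ ↦ ?_
            simp only [kroneckerMap_apply, hM]
            ring
        _ = _ := by rw [e2, e3, e4]; ring
    have h2 : ∑ p, ∑ p', c p * c p' * wedgeSq a p.1 p.2 p'.1 p'.2 = S₁ - S₂ := by
      rw [hS₁, hS₂]
      simp only [← Finset.sum_sub_distrib]
      refine Finset.sum_congr rfl fun p _ ↦ Finset.sum_congr rfl fun p' _ ↦ ?_
      simp only [wedgeSq, hM, Prod.fst_swap, Prod.snd_swap]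
      ring
    rw [h1] at h
    simp only [of_apply]
    rw [h2]
    linarith

lemma doubleAlternation_sum {ι : Type*} (S : Finset ι) (F : ι → Perm (Fin k) → Perm (Fin k) → ℝ) :
    doubleAlternation (fun σ τ ↦ ∑ i ∈ S, F i σ τ) = ∑ i ∈ S, doubleAlternation (F i) := by
  simp only [doubleAlternation, Finset.mul_sum]
  rw [Finset.sum_comm]
  simp only [Finset.sum_comm (s := S)]
  rw [Finset.sum_comm]

lemma doubleAlternation_nonpos {F : Perm (Fin k) → Perm (Fin k) → ℝ}
    (hF : (Matrix.of fun σ τ ↦ -F σ τ).PosSemidef) : doubleAlternation F ≤ 0 := by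
  have h := doubleAlternation_nonneg hF
  simp only [doubleAlternation, of_apply, mul_neg, Finset.sum_neg_distrib] at h
  simpa [doubleAlternation] using h

lemma posSemidef_perm_kernel {T : Fin k → Fin k → Fin k → Fin k → ℝ}
    (hT : (Matrix.of fun p p' : Fin k × Fin k ↦ T p.1 p.2 p'.1 p'.2).PosSemidef) (x y : Fin k) :
    (Matrix.of fun σ τ : Perm (Fin k) ↦ T (σ x) (σ y) (τ x) (τ y)).PosSemidef :=
  hT.submatrix fun σ : Perm (Fin k) ↦ (σ x, σ y)

variable {R : Fin k → Fin k → Fin k → Fin k → ℝ} {a : Matrix (Fin k) (Fin k) ℝ}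

/-- A curvature-like tensor whose curvature operator is nonpositive, and which factors through
three linear forms. -/
structure IsNonposOfRankThree (R : Fin k → Fin k → Fin k → Fin k → ℝ) : Prop where
  nonpos : (Matrix.of fun p p' : Fin k × Fin k ↦ -R p.1 p.2 p'.1 p'.2).PosSemidef
  factors : ∃ ξ : Fin 3 → Fin k → ℝ, ∀ l m, FactorsThroughThree ξ fun i j ↦ R i j l m

/-- Two of the factors `R` suffice for vanishing. The rest of the product may depend on `τ` in any
way, but on `σ` only off the positions these two occupy. -/
lemma doubleAlternation_eq_zero (hR : IsNonposOfRankThree R) {ι : Type*} [DecidableEq ι]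
    {x y : ι → Fin k} (hx : Function.Injective x) (hy : Function.Injective y)
    (hxy : ∀ b b', x b ≠ y b') {S : Finset ι} (hS : 2 ≤ S.card)
    {g : Perm (Fin k) → Perm (Fin k) → ℝ}
    (hg : ∀ σ σ' τ, (∀ z, (∀ b ∈ S, z ≠ x b ∧ z ≠ y b) → σ z = σ' z) → g σ τ = g σ' τ) :
    doubleAlternation
      (fun σ τ ↦ (∏ b ∈ S, R (σ (x b)) (σ (y b)) (τ (x b)) (τ (y b))) * g σ τ) = 0 := by
  obtain ⟨b₁, hb₁, b₂, hb₂, hb⟩ := Finset.one_lt_card.1 hS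
  obtain ⟨ξ, hξ⟩ := hR.factors
  -- The alternation over `σ` vanishes already for each fixed `τ`.
  rw [doubleAlternation, Finset.sum_comm]
  refine Finset.sum_eq_zero fun τ _ ↦ ?_
  have hb₂' : b₂ ∈ S.erase b₁ := by simp [hb₂, hb.symm]
  have h := sum_sign_mul_mul_eq_zero (hξ (τ (x b₁)) (τ (y b₁))) (hξ (τ (x b₂)) (τ (y b₂)))
    (hxy b₁ b₁) (fun h ↦ hb (hx h)) (hxy b₁ b₂) (hxy b₂ b₁).symm (fun h ↦ hb (hy h)) (hxy b₂ b₂)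
    (f := fun σ ↦ (∏ b ∈ (S.erase b₁).erase b₂, R (σ (x b)) (σ (y b)) (τ (x b)) (τ (y b))) * g σ τ)
    (fun σ σ' hσ ↦ by
      congr 1
      · refine Finset.prod_congr rfl fun b hb' ↦ ?_
        simp only [Finset.mem_erase] at hb'
        rw [hσ (x b) (fun h ↦ hb'.2.1 (hx h)) (hxy _ _) (fun h ↦ hb'.1 (hx h)) (hxy _ _),
          hσ (y b) (hxy _ _).symm (fun h ↦ hb'.2.1 (hy h)) (hxy _ _).symm (fun h ↦ hb'.1 (hy h))]
      · exact hg _ _ _ fun z hz ↦ hσ z (hz _ hb₁).1 (hz _ hb₁).2 (hz _ hb₂).1 (hz _ hb₂).2)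
  calc _ = ((Perm.sign τ : ℤ) : ℝ) * (∑ σ : Perm (Fin k), ((Perm.sign σ : ℤ) : ℝ) *
        (R (σ (x b₁)) (σ (y b₁)) (τ (x b₁)) (τ (y b₁)) *
          R (σ (x b₂)) (σ (y b₂)) (τ (x b₂)) (τ (y b₂)) *
          ((∏ b ∈ (S.erase b₁).erase b₂, R (σ (x b)) (σ (y b)) (τ (x b)) (τ (y b))) * g σ τ))) := by
        rw [Finset.mul_sum]
        refine Finset.sum_congr rfl fun σ _ ↦ ?_
        rw [← Finset.mul_prod_erase S _ hb₁, ← Finset.mul_prod_erase _ _ hb₂']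
        ring
    _ = 0 := by rw [h, mul_zero]

/-- Each `wedgeSq` factor is an antisymmetrised product of two entries; `sum_sign_mul_prod_sub`
replaces it by the plain product and accounts for the power of 2. -/
lemma doubleAlternation_prod_wedgeSq (hk : Even k) (a : Matrix (Fin k) (Fin k) ℝ) :
    doubleAlternation (fun σ τ ↦ ∏ b : Fin (k / 2),
      wedgeSq a (σ ⟨2 * b, by have := b.2; omega⟩) (σ ⟨2 * b + 1, by have := b.2; omega⟩)
        (τ ⟨2 * b, by have := b.2; omega⟩) (τ ⟨2 * b + 1, by have := b.2; omega⟩))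
      = 2 ^ (k / 2) * ((k.factorial : ℝ) * a.det) := by
  have hk' := Nat.two_mul_div_two_of_even hk
  rw [← doubleAlternation_prod, doubleAlternation, doubleAlternation, Finset.mul_sum]
  refine Finset.sum_congr rfl fun σ _ ↦ ?_
  have h := sum_sign_mul_prod_sub (k := k) (ι := Fin (k / 2))
    (fun b ↦ ⟨2 * b, by have := b.2; omega⟩) (fun b ↦ ⟨2 * b + 1, by have := b.2; omega⟩)
    (fun b b' h ↦ by simp only [Fin.mk.injEq] at h; omega)
    (fun b b' h ↦ by simp only [Fin.mk.injEq] at h; omega)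
    (fun b b' h ↦ by simp only [Fin.mk.injEq] at h; omega)
    (fun b u v ↦ a (σ ⟨2 * b, by have := b.2; omega⟩) u
      * a (σ ⟨2 * b + 1, by have := b.2; omega⟩) v) Finset.univ
  simp only [mul_assoc, ← Finset.mul_sum]
  rw [mul_left_comm]
  congr 1
  refine h.trans ?_
  simp only [Finset.card_univ, Fintype.card_fin]
  congr 1
  refine Finset.sum_congr rfl fun τ _ ↦ ?_
  congr 1
  exact prod_even_odd hk' fun i ↦ a (σ i) (τ i)

/-- Expand over the set `S` of factors from which `R` is taken. The empty set gives the right-hand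
side, singletons are nonpositive by the Schur product theorem, and larger sets contribute zero. -/
lemma doubleAlternation_pfaffian_le (hk : Even k) (hR : IsNonposOfRankThree R)
    (ha : a.PosSemidef) :
    doubleAlternation (fun σ τ ↦ ∏ b : Fin (k / 2),
      (R (σ ⟨2 * b, by have := b.2; omega⟩) (σ ⟨2 * b + 1, by have := b.2; omega⟩)
        (τ ⟨2 * b, by have := b.2; omega⟩) (τ ⟨2 * b + 1, by have := b.2; omega⟩) +
      wedgeSq a (σ ⟨2 * b, by have := b.2; omega⟩) (σ ⟨2 * b + 1, by have := b.2; omega⟩)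
        (τ ⟨2 * b, by have := b.2; omega⟩) (τ ⟨2 * b + 1, by have := b.2; omega⟩)))
      ≤ 2 ^ (k / 2) * ((k.factorial : ℝ) * a.det) := by
  simp only [Finset.prod_add]
  rw [doubleAlternation_sum, ← doubleAlternation_prod_wedgeSq hk a,
    ← Finset.add_sum_erase _ _ (Finset.empty_mem_powerset _)]
  simp only [Finset.prod_empty, one_mul, Finset.sdiff_empty]
  refine add_le_of_nonpos_right (Finset.sum_nonpos fun S hS ↦ ?_)
  have hS0 : S ≠ ∅ := (Finset.mem_erase.1 hS).1
  rcases Nat.lt_or_ge S.card 2 with h | h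
  · have h1 : S.card = 1 := by
      have := Finset.card_pos.2 (Finset.nonempty_iff_ne_empty.2 hS0)
      omega
    obtain ⟨b₀, rfl⟩ := Finset.card_eq_one.1 h1
    refine doubleAlternation_nonpos ?_
    have hP := (posSemidef_perm_kernel (T := fun i j l m ↦ -R i j l m) hR.nonpos
      ⟨2 * b₀, by have := b₀.2; omega⟩
      ⟨2 * b₀ + 1, by have := b₀.2; omega⟩).hadamard
      (posSemidef_prod (Finset.univ \ {b₀}) _ fun b : Fin (k / 2) ↦ fun _ ↦
        posSemidef_perm_kernel (posSemidef_wedgeSq ha) ⟨2 * b, by have := b.2; omega⟩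
          ⟨2 * b + 1, by have := b.2; omega⟩)
    have he : ∀ {A B : Matrix (Perm (Fin k)) (Perm (Fin k)) ℝ}, A.PosSemidef → A = B →
        B.PosSemidef := fun h h' ↦ h' ▸ h
    refine he hP ?_
    ext σ τ
    simp [hadamard]
  · refine (doubleAlternation_eq_zero hR (ι := Fin (k / 2))
      (x := fun b ↦ ⟨2 * b, by have := b.2; omega⟩)
      (y := fun b ↦ ⟨2 * b + 1, by have := b.2; omega⟩)
      (fun b b' h ↦ by simp only [Fin.mk.injEq] at h; omega)
      (fun b b' h ↦ by simp only [Fin.mk.injEq] at h; omega)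
      (fun b b' h ↦ by simp only [Fin.mk.injEq] at h; omega) h ?_).le
    intro σ σ' τ hσ
    refine Finset.prod_congr rfl fun b hb ↦ ?_
    have hbS : ∀ b' ∈ S, b ≠ b' := by
      rintro b' hb' rfl
      simp [hb'] at hb
    rw [hσ ⟨2 * b, by have := b.2; omega⟩ fun b' hb' ↦ ?_,
      hσ ⟨2 * b + 1, by have := b.2; omega⟩ fun b' hb' ↦ ?_]
    · have := hbS b' hb'
      simp only [ne_eq, Fin.mk.injEq]
      omega
    · have := hbS b' hb'
      simp only [ne_eq, Fin.mk.injEq]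
      omega

/-- The same dichotomy: the sign of a Schur product for `s = 1`, vanishing for `s ≥ 2`. -/
lemma doubleAlternation_transgression_nonpos (hR : IsNonposOfRankThree R) (ha : a.PosSemidef)
    {r s : ℕ} (h : r + 2 * s = k) (hs : 1 ≤ s) :
    doubleAlternation (fun σ τ ↦
      (∏ i : Fin r, a (σ ⟨i, by have := i.2; omega⟩) (τ ⟨i, by have := i.2; omega⟩)) *
      ∏ b : Fin s, R (σ ⟨r + 2 * b, by have := b.2; omega⟩)
        (σ ⟨r + 2 * b + 1, by have := b.2; omega⟩) (τ ⟨r + 2 * b, by have := b.2; omega⟩)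
        (τ ⟨r + 2 * b + 1, by have := b.2; omega⟩)) ≤ 0 := by
  rcases hs.eq_or_lt with rfl | hs
  · refine doubleAlternation_nonpos ?_
    have hP := (posSemidef_prod (Finset.univ : Finset (Fin r)) _ fun i _ ↦
      ha.submatrix fun σ : Perm (Fin k) ↦ σ ⟨i, by have := i.2; omega⟩).hadamard
      (posSemidef_perm_kernel (T := fun i j l m ↦ -R i j l m) hR.nonpos ⟨r, by omega⟩
        ⟨r + 1, by omega⟩)
    have he : ∀ {A B : Matrix (Perm (Fin k)) (Perm (Fin k)) ℝ}, A.PosSemidef → A = B →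
        B.PosSemidef := fun h h' ↦ h' ▸ h
    refine he hP ?_
    ext σ τ
    simp [hadamard]
  · simp only [mul_comm (∏ i : Fin r, _)]
    refine (doubleAlternation_eq_zero hR (ι := Fin s) (S := Finset.univ)
      (x := fun b ↦ ⟨r + 2 * b, by have := b.2; omega⟩)
      (y := fun b ↦ ⟨r + 2 * b + 1, by have := b.2; omega⟩)
      (fun b b' h ↦ by simp only [Fin.mk.injEq] at h; omega)
      (fun b b' h ↦ by simp only [Fin.mk.injEq] at h; omega)
      (fun b b' h ↦ by simp only [Fin.mk.injEq] at h; omega)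
      (by simpa using Nat.succ_le_of_lt hs) ?_).le
    intro σ σ' τ hσ
    refine Finset.prod_congr rfl fun i _ ↦ ?_
    rw [hσ ⟨i, by have := i.2; omega⟩ fun b _ ↦ ?_]
    have := i.2
    simp only [ne_eq, Fin.mk.injEq]
    omega

lemma doubleAlternation_pfaffian_eq_zero (hk4 : 4 ≤ k)
    (hR : IsNonposOfRankThree R) :
    doubleAlternation (fun σ τ ↦ ∏ b : Fin (k / 2),
      R (σ ⟨2 * b, by have := b.2; omega⟩) (σ ⟨2 * b + 1, by have := b.2; omega⟩)
        (τ ⟨2 * b, by have := b.2; omega⟩) (τ ⟨2 * b + 1, by have := b.2; omega⟩)) = 0 := by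
  have h := doubleAlternation_eq_zero hR (ι := Fin (k / 2)) (S := Finset.univ)
      (x := fun b ↦ ⟨2 * b, by have := b.2; omega⟩)
      (y := fun b ↦ ⟨2 * b + 1, by have := b.2; omega⟩)
      (fun b b' h ↦ by simp only [Fin.mk.injEq] at h; omega)
      (fun b b' h ↦ by simp only [Fin.mk.injEq] at h; omega)
      (fun b b' h ↦ by simp only [Fin.mk.injEq] at h; omega) (by simp; omega)
      (g := fun _ _ ↦ 1) (fun _ _ _ _ ↦ rfl)
  simpa using h

end PfaffianAlgebra

/-! ### Curvature-like tensors with nullity of codimension at most three -/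

section AlgebraicCurvature

open Matrix

variable {V : Type*} [AddCommGroup V] [Module ℝ V]

/-- The symmetries of the covariant curvature tensor `(X, Y, Z, W) ↦ ⟨R(X, Y) Z, W⟩` (those
which are used below). -/
structure IsCurvatureLike (Rm : V → V → V → V → ℝ) : Prop where
  linear : ∀ Y Z W, IsLinearMap ℝ fun X ↦ Rm X Y Z W
  anti_left : ∀ X Y Z W, Rm X Y Z W = -Rm Y X Z W
  anti_right : ∀ X Y Z W, Rm X Y Z W = -Rm X Y W Z
  pair : ∀ X Y Z W, Rm X Y Z W = Rm Z W X Y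

namespace IsCurvatureLike

variable {Rm : V → V → V → V → ℝ} (h : IsCurvatureLike Rm)
include h

lemma sum₁ {ι : Type*} (S : Finset ι) (c : ι → ℝ) (v : ι → V) (Y Z W : V) :
    Rm (∑ i ∈ S, c i • v i) Y Z W = ∑ i ∈ S, c i * Rm (v i) Y Z W := by
  have := map_sum (IsLinearMap.mk' _ (h.linear Y Z W)) (fun i ↦ c i • v i) S
  simpa only [IsLinearMap.mk'_apply, map_smul, smul_eq_mul] using this

lemma sum₂ {ι : Type*} (S : Finset ι) (c : ι → ℝ) (v : ι → V) (X Z W : V) :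
    Rm X (∑ i ∈ S, c i • v i) Z W = ∑ i ∈ S, c i * Rm X (v i) Z W := by
  rw [h.anti_left, h.sum₁, ← Finset.sum_neg_distrib]
  exact Finset.sum_congr rfl fun i _ ↦ by rw [h.anti_left X]; ring

lemma sum₃ {ι : Type*} (S : Finset ι) (c : ι → ℝ) (v : ι → V) (X Y W : V) :
    Rm X Y (∑ i ∈ S, c i • v i) W = ∑ i ∈ S, c i * Rm X Y (v i) W := by
  rw [h.pair, h.sum₁]
  exact Finset.sum_congr rfl fun i _ ↦ by rw [h.pair X]

lemma sum₄ {ι : Type*} (S : Finset ι) (c : ι → ℝ) (v : ι → V) (X Y Z : V) :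
    Rm X Y Z (∑ i ∈ S, c i • v i) = ∑ i ∈ S, c i * Rm X Y Z (v i) := by
  rw [h.pair, h.sum₂]
  exact Finset.sum_congr rfl fun i _ ↦ by rw [h.pair X]

lemma congr_left {X X' Y Z W : V} (hX : ∀ U T S, Rm (X - X') U T S = 0) :
    Rm X Y Z W = Rm X' Y Z W := by
  have h1 := (IsLinearMap.mk' _ (h.linear Y Z W)).map_sub X X'
  simp only [IsLinearMap.mk'_apply, hX] at h1
  linarith

end IsCurvatureLike

/-- Every vector of `ℝ³` is a cross product, that is, every bivector of `ℝ³` is decomposable. -/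
lemma exists_cross_eq (x y z : ℝ) : ∃ u v : Fin 3 → ℝ,
    u 1 * v 2 - u 2 * v 1 = x ∧ u 2 * v 0 - u 0 * v 2 = y ∧ u 0 * v 1 - u 1 * v 0 = z := by
  by_cases hz : z = 0
  · exact ⟨![0, 0, 1], ![y, -x, 0], by simp, by simp, by simp [hz]⟩
  · refine ⟨![1, 0, -x / z], ![0, z, -y], ?_, ?_, ?_⟩ <;> simp
    field_simp

/-- An antisymmetric pairing sees only the antisymmetric part of `C`, which `u ⊗ v` shares. -/
lemma sum_mul_eq_of_antisymm {g C : Fin 3 → Fin 3 → ℝ} (hg : ∀ p q, g p q = -g q p)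
    {u v : Fin 3 → ℝ} (h0 : u 1 * v 2 - u 2 * v 1 = C 1 2 - C 2 1)
    (h1 : u 2 * v 0 - u 0 * v 2 = C 2 0 - C 0 2) (h2 : u 0 * v 1 - u 1 * v 0 = C 0 1 - C 1 0) :
    ∑ p, ∑ q, C p q * g p q = ∑ p, ∑ q, u p * v q * g p q := by
  have e0 : g 0 0 = 0 := by linarith [hg 0 0]
  have e1 : g 1 1 = 0 := by linarith [hg 1 1]
  have e2 : g 2 2 = 0 := by linarith [hg 2 2]
  simp only [Fin.sum_univ_three, e0, e1, e2, hg 1 0, hg 2 1, hg 0 2]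
  linear_combination (-g 1 2) * h0 - g 2 0 * h1 - g 0 1 * h2

/-- A curvature-like tensor with nullity of codimension at most three, and nonpositive sectional
curvature, has a nonpositive curvature operator of rank at most three. -/
lemma IsCurvatureLike.isNonposOfRankThree [FiniteDimensional ℝ V] {Rm : V → V → V → V → ℝ}
    (h : IsCurvatureLike Rm) (hneg : ∀ X Y, Rm X Y Y X ≤ 0) (𝒩 : Submodule ℝ V)
    (h𝒩 : ∀ Z ∈ 𝒩, ∀ X Y W, Rm X Y Z W = 0)
    (hdim : Module.finrank ℝ V ≤ Module.finrank ℝ 𝒩 + 3) {k : ℕ} (e : Fin k → V) :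
    IsNonposOfRankThree fun i j l m ↦ Rm (e l) (e m) (e j) (e i) := by
  have h1 : Module.finrank ℝ (V ⧸ 𝒩) ≤ Module.finrank ℝ (Fin 3 → ℝ) := by
    have := 𝒩.finrank_quotient_add_finrank
    simp only [Module.finrank_fin_fun]
    omega
  obtain ⟨J, hJ⟩ : ∃ J : (V ⧸ 𝒩) →ₗ[ℝ] (Fin 3 → ℝ), Function.Injective J :=
    finrank_le_iff_exists_linearMap.1 h1
  obtain ⟨L, hL⟩ := J.exists_leftInverse_of_injective (LinearMap.ker_eq_bot.2 hJ)
  obtain ⟨S, hS⟩ := 𝒩.mkQ.exists_rightInverse_of_surjective (by simp)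
  -- `ξ` gives coordinates modulo `𝒩` in `ℝ³`, and the `w p` are lifts, so that `X - ∑ ξ X p • w p`
  -- lies in `𝒩`.
  set ξ : V → Fin 3 → ℝ := fun X ↦ J (𝒩.mkQ X) with hξ
  set w : Fin 3 → V := fun p ↦ S (L (Pi.single p 1)) with hw
  have hsum : ∀ c : Fin 3 → ℝ, ∑ p, c p • w p = S (L c) := by
    intro c
    have hc : c = ∑ p, c p • (Pi.single p 1 : Fin 3 → ℝ) := by
      ext i; simp [Finset.sum_apply, Pi.single_apply]
    conv_rhs => rw [hc]
    simp only [map_sum, map_smul, hw]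
  -- The nullity is given for the third argument; pair symmetry carries it to the first.
  have hnull : ∀ X Y Z W, Rm (X - ∑ p, ξ X p • w p) Y Z W = 0 := by
    intro X Y Z W
    rw [h.pair]
    refine (h.pair _ _ _ _).trans ?_
    rw [h.pair]
    refine h𝒩 _ ?_ _ _ _
    rw [hsum, ← Submodule.Quotient.mk_eq_zero, Submodule.Quotient.mk_sub, sub_eq_zero]
    have := LinearMap.congr_fun hS (L (ξ X))
    simp only [LinearMap.comp_apply, LinearMap.id_apply, Submodule.mkQ_apply] at this
    rw [this]
    have := LinearMap.congr_fun hL (𝒩.mkQ X)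
    simpa [hξ] using this.symm
  have hr1 : ∀ X Y Z W, Rm X Y Z W = ∑ p, ξ X p * Rm (w p) Y Z W := fun X Y Z W ↦ by
    rw [h.congr_left (hnull X), h.sum₁]
  have hr2 : ∀ X Y Z W, Rm X Y Z W = ∑ p, ξ Y p * Rm X (w p) Z W := fun X Y Z W ↦ by
    rw [h.anti_left, hr1, ← Finset.sum_neg_distrib]
    exact Finset.sum_congr rfl fun p _ ↦ by rw [h.anti_left X]; ring
  have hr3 : ∀ X Y Z W, Rm X Y Z W = ∑ p, ξ Z p * Rm X Y (w p) W := fun X Y Z W ↦ by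
    rw [h.pair, hr1]
    exact Finset.sum_congr rfl fun p _ ↦ by rw [h.pair X]
  have hr4 : ∀ X Y Z W, Rm X Y Z W = ∑ p, ξ W p * Rm X Y Z (w p) := fun X Y Z W ↦ by
    rw [h.pair, hr2]
    exact Finset.sum_congr rfl fun p _ ↦ by rw [h.pair X]
  have hr34 : ∀ X Y Z W, Rm X Y Z W = ∑ p, ∑ q, ξ W p * ξ Z q * Rm X Y (w q) (w p) := by
    intro X Y Z W
    rw [hr4]
    refine Finset.sum_congr rfl fun p _ ↦ ?_
    rw [hr3, Finset.mul_sum]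
    exact Finset.sum_congr rfl fun q _ ↦ by ring
  refine ⟨posSemidef_of_sum_nonneg (fun p p' ↦ ?_) fun c ↦ ?_,
    fun p i ↦ ξ (e i) p, fun l m ↦ ⟨fun p q ↦ Rm (e l) (e m) (w q) (w p), fun i j ↦ ?_⟩⟩
  · simp only [of_apply]
    rw [h.pair, h.anti_left, h.anti_right, neg_neg]
  -- The quadratic form at `c` depends only on the bivector `∑ c i • (e i.1 ∧ e i.2)` modulo the
  -- nullity. Writing that bivector as `U ∧ T` turns the form into `-Rm U T T U`, which `hneg`
  -- controls.
  · set C : Fin 3 → Fin 3 → ℝ := fun p q ↦ ∑ i : Fin k × Fin k, c i * (ξ (e i.1) p * ξ (e i.2) q)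
      with hC
    have hCsum : ∀ g : Fin 3 → Fin 3 → ℝ, ∑ i : Fin k × Fin k, c i *
        (∑ p, ∑ q, ξ (e i.1) p * ξ (e i.2) q * g p q) = ∑ p, ∑ q, C p q * g p q := by
      intro g
      simp only [hC, Finset.mul_sum, Finset.sum_mul]
      rw [Finset.sum_comm]
      refine Finset.sum_congr rfl fun p _ ↦ ?_
      rw [Finset.sum_comm]
      exact Finset.sum_congr rfl fun q _ ↦ Finset.sum_congr rfl fun i _ ↦ by ring
    obtain ⟨u, v, h0, h1, h2⟩ := exists_cross_eq (C 1 2 - C 2 1) (C 2 0 - C 0 2) (C 0 1 - C 1 0)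
    set U := ∑ p, u p • w p with hU
    set T := ∑ p, v p • w p with hT
    have hinner : ∀ X Y, ∑ i : Fin k × Fin k, c i * Rm X Y (e i.2) (e i.1) = Rm X Y T U := by
      intro X Y
      calc _ = ∑ p, ∑ q, C p q * Rm X Y (w q) (w p) := by
            rw [← hCsum]
            exact Finset.sum_congr rfl fun i _ ↦ by rw [hr34 X Y]
        _ = ∑ p, ∑ q, u p * v q * Rm X Y (w q) (w p) :=
            sum_mul_eq_of_antisymm (fun p q ↦ h.anti_right _ _ _ _) h0 h1 h2
        _ = _ := by
            rw [hU, hT, h.sum₄]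
            refine Finset.sum_congr rfl fun p _ ↦ ?_
            rw [h.sum₃, Finset.mul_sum]
            exact Finset.sum_congr rfl fun q _ ↦ by ring
    have houter : ∑ i : Fin k × Fin k, c i * Rm (e i.1) (e i.2) T U = Rm U T T U := by
      have := hinner T U
      calc _ = ∑ i : Fin k × Fin k, -(c i * Rm T U (e i.2) (e i.1)) := by
            refine Finset.sum_congr rfl fun i _ ↦ ?_
            rw [h.pair, h.anti_right]; ring
        _ = _ := by rw [Finset.sum_neg_distrib, this, h.anti_left]; simp
    have : ∑ x : Fin k × Fin k, ∑ y : Fin k × Fin k, c x * c y *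
        (of fun p p' : Fin k × Fin k ↦ -Rm (e p'.1) (e p'.2) (e p.2) (e p.1)) x y
        = -Rm U T T U := by
      rw [← houter, Finset.sum_comm, ← Finset.sum_neg_distrib]
      refine Finset.sum_congr rfl fun y _ ↦ ?_
      rw [← hinner, ← mul_neg, ← Finset.sum_neg_distrib, Finset.mul_sum]
      exact Finset.sum_congr rfl fun x _ ↦ by simp only [of_apply]; ring
    rw [this]
    linarith [hneg U T]
  · refine (hr34 _ _ _ _).trans ?_
    exact Finset.sum_congr rfl fun p _ ↦ Finset.sum_congr rfl fun q _ ↦ by ring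

end AlgebraicCurvature

/-! ### Levi-Civita calculus in coordinates, and the symmetries of the curvature -/

section MetricCalculus

set_option maxSynthPendingDepth 3

variable {E : Type*} [NormedAddCommGroup E] [NormedSpace ℝ E]

lemma minSmoothness_two_le_infty : minSmoothness ℝ 2 ≤ ∞ := by
  rw [minSmoothness_of_isRCLikeNormedField]
  exact ENat.LEInfty.out

/-- `G` is a smooth (pseudo-)Riemannian metric on the open set `U`. -/
structure IsMetricOn (G : E → E →L[ℝ] E →L[ℝ] ℝ) (U : Set E) : Prop where
  isOpen : IsOpen U
  contDiffOn : ContDiffOn ℝ ∞ G U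
  symm : ∀ y ∈ U, ∀ u v, G y u v = G y v u
  invertible : ∀ y ∈ U, (G y).IsInvertible

namespace IsMetricOn

variable {G : E → E →L[ℝ] E →L[ℝ] ℝ} {U : Set E} (h : IsMetricOn G U)
include h

lemma contDiffAt {y : E} (hy : y ∈ U) : ContDiffAt ℝ ∞ G y :=
  h.contDiffOn.contDiffAt (h.isOpen.mem_nhds hy)

lemma contDiffAt_fderiv {y : E} (hy : y ∈ U) : ContDiffAt ℝ ∞ (fderiv ℝ G) y :=
  (h.contDiffAt hy).fderiv_right (by simp)

lemma hasFDerivAt {y : E} (hy : y ∈ U) : HasFDerivAt G (fderiv ℝ G y) y :=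
  ((h.contDiffAt hy).differentiableAt (by simp)).hasFDerivAt

lemma hasFDerivAt_fderiv {y : E} (hy : y ∈ U) :
    HasFDerivAt (fderiv ℝ G) (fderiv ℝ (fderiv ℝ G) y) y :=
  ((h.contDiffAt_fderiv hy).differentiableAt (by simp)).hasFDerivAt

lemma apply_inverse {y : E} (hy : y ∈ U) (α : E →L[ℝ] ℝ) : G y ((G y).inverse α) = α := by
  obtain ⟨e, he⟩ := h.invertible y hy
  rw [← he]
  simp

lemma eq_of_forall {y : E} (hy : y ∈ U) {a b : E} (hab : ∀ w, G y a w = G y b w) : a = b := by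
  obtain ⟨e, he⟩ := h.invertible y hy
  apply e.injective
  ext w
  have := hab w
  rw [← he] at this
  exact this

/-- Pairing with `G` cancels the inverse metric inside `christoffel` and leaves the Koszul formula
for constant fields. -/
lemma apply_christoffel {y : E} (hy : y ∈ U) (u v w : E) :
    G y (christoffel G y u v) w
      = (1 / 2) * (fderiv ℝ G y u v w + fderiv ℝ G y v u w - fderiv ℝ G y w u v) := by
  have h1 : christoffel G y u v = (G y).inverse
      ((1 / 2 : ℝ) • (fderiv ℝ G y u v + fderiv ℝ G y v u - ((fderiv ℝ G y).flip u).flip v)) :=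
    rfl
  rw [h1, h.apply_inverse hy]
  rfl

lemma fderiv_symm {y : E} (hy : y ∈ U) (z u v : E) :
    fderiv ℝ G y z u v = fderiv ℝ G y z v u := by
  have h1 := ((h.hasFDerivAt hy).clm_apply (hasFDerivAt_const u y)).clm_apply
    (hasFDerivAt_const v y)
  have h2 := ((h.hasFDerivAt hy).clm_apply (hasFDerivAt_const v y)).clm_apply
    (hasFDerivAt_const u y)
  have h3 := h1.congr_of_eventuallyEq (f₁ := fun y ↦ G y v u)
    (by filter_upwards [h.isOpen.mem_nhds hy] with x hx using h.symm x hx v u)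
  have := congrArg (fun L : E →L[ℝ] ℝ ↦ L z) (h3.unique h2)
  simpa using this

lemma christoffel_symm {y : E} (hy : y ∈ U) (u v : E) :
    christoffel G y u v = christoffel G y v u := by
  refine h.eq_of_forall hy fun w ↦ ?_
  rw [h.apply_christoffel hy, h.apply_christoffel hy, h.fderiv_symm hy w u v]
  ring

/-- Compatibility of the connection with the metric, `∇G = 0`. -/
lemma fderiv_apply {y : E} (hy : y ∈ U) (u v w : E) :
    fderiv ℝ G y u v w = G y (christoffel G y u v) w + G y v (christoffel G y u w) := by
  rw [h.symm y hy v, h.apply_christoffel hy, h.apply_christoffel hy, h.fderiv_symm hy u w v,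
    h.fderiv_symm hy w u v, h.fderiv_symm hy v u w]
  ring

lemma contDiffAt_christoffel [CompleteSpace E] {y : E} (hy : y ∈ U) :
    ContDiffAt ℝ ∞ (christoffel G) y := by
  obtain ⟨e, he⟩ := h.invertible y hy
  have hinv : ContDiffAt ℝ ∞ (fun y ↦ (G y).inverse) y := by
    have h1 := contDiffAt_map_inverse (𝕜 := ℝ) (n := ∞) e
    rw [he] at h1
    exact h1.comp y (h.contDiffAt hy)
  let L₁ : (E →L[ℝ] E →L[ℝ] E →L[ℝ] ℝ) →L[ℝ] E →L[ℝ] E →L[ℝ] E →L[ℝ] ℝ :=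
    (ContinuousLinearMap.flipₗᵢ ℝ E E (E →L[ℝ] ℝ)).toContinuousLinearEquiv.toContinuousLinearMap
  let L₂ : (E →L[ℝ] E →L[ℝ] E →L[ℝ] ℝ) →L[ℝ] E →L[ℝ] E →L[ℝ] E →L[ℝ] ℝ :=
    ContinuousLinearMap.compL ℝ E (E →L[ℝ] E →L[ℝ] ℝ) (E →L[ℝ] E →L[ℝ] ℝ)
      (ContinuousLinearMap.flipₗᵢ ℝ E E ℝ).toContinuousLinearEquiv.toContinuousLinearMap
  have hD := h.contDiffAt_fderiv hy
  have hK : ContDiffAt ℝ ∞ (fun y ↦ (1 / 2 : ℝ) •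
      (fderiv ℝ G y + L₁ (fderiv ℝ G y) - L₂ (L₁ (fderiv ℝ G y)))) y :=
    contDiffAt_const (c := (1 / 2 : ℝ)) |>.smul ((hD.add (L₁.contDiff.contDiffAt.comp y hD)).sub
      (L₂.contDiff.contDiffAt.comp y (L₁.contDiff.contDiffAt.comp y hD)))
  have hC : ContDiffAt ℝ ∞ (fun y ↦
      ContinuousLinearMap.compL ℝ E (E →L[ℝ] ℝ) E (G y).inverse) y :=
    (ContinuousLinearMap.compL ℝ E (E →L[ℝ] ℝ) E).contDiff.contDiffAt.comp y hinv
  exact hC.clm_comp hK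

lemma hasFDerivAt_christoffel [CompleteSpace E] {y : E} (hy : y ∈ U) :
    HasFDerivAt (christoffel G) (fderiv ℝ (christoffel G) y) y :=
  ((h.contDiffAt_christoffel hy).differentiableAt (by simp)).hasFDerivAt

lemma hasFDerivAt_apply_christoffel [CompleteSpace E] {y : E} (hy : y ∈ U) (v z w t : E) :
    fderiv ℝ (fun y ↦ G y (christoffel G y v z) w) y t
      = G y (fderiv ℝ (christoffel G) y t v z) w + fderiv ℝ G y t (christoffel G y v z) w := by
  have h1 := ((h.hasFDerivAt hy).clm_apply (((h.hasFDerivAt_christoffel hy).clm_apply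
    (hasFDerivAt_const v y)).clm_apply (hasFDerivAt_const z y))).clm_apply (hasFDerivAt_const w y)
  rw [h1.fderiv]
  simp

/-- Metric compatibility trades derivatives of `christoffel G` for derivatives of the lowered
symbols, which no longer involve the inverse metric. -/
lemma apply_coordCurvature [CompleteSpace E] {y : E} (hy : y ∈ U) (u v z w : E) :
    G y (coordCurvature G y u v z) w
      = fderiv ℝ (fun y ↦ G y (christoffel G y v z) w) y u
        - fderiv ℝ (fun y ↦ G y (christoffel G y u z) w) y v
        - G y (christoffel G y u w) (christoffel G y v z)
        + G y (christoffel G y v w) (christoffel G y u z) := by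
  rw [h.hasFDerivAt_apply_christoffel hy, h.hasFDerivAt_apply_christoffel hy,
    h.fderiv_apply hy u (christoffel G y v z), h.fderiv_apply hy v (christoffel G y u z),
    h.symm y hy (christoffel G y u w), h.symm y hy (christoffel G y v w)]
  simp only [coordCurvature, map_add, map_sub, add_apply,
    sub_apply]
  ring

lemma fderiv_apply_christoffel {y : E} (hy : y ∈ U) (v z w t : E) :
    fderiv ℝ (fun y ↦ G y (christoffel G y v z) w) y t
      = (1 / 2) * (fderiv ℝ (fderiv ℝ G) y t v z w + fderiv ℝ (fderiv ℝ G) y t z v w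
        - fderiv ℝ (fderiv ℝ G) y t w v z) := by
  have hd : ∀ a b c : E, HasFDerivAt (fun y ↦ fderiv ℝ G y a b c) _ y := fun a b c ↦
    (((h.hasFDerivAt_fderiv hy).clm_apply (hasFDerivAt_const a y)).clm_apply
      (hasFDerivAt_const b y)).clm_apply (hasFDerivAt_const c y)
  have h1 := ((((hd v z w).add (hd z v w)).sub (hd w v z)).const_mul (1 / 2)).congr_of_eventuallyEq
    (f₁ := fun y ↦ G y (christoffel G y v z) w) (by
      filter_upwards [h.isOpen.mem_nhds hy] with x hx using h.apply_christoffel hx v z w)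
  rw [h1.fderiv]
  simp

lemma second_fderiv_comm {y : E} (hy : y ∈ U) (a b c d : E) :
    fderiv ℝ (fderiv ℝ G) y a b c d = fderiv ℝ (fderiv ℝ G) y b a c d := by
  have := (h.contDiffAt hy).isSymmSndFDerivAt minSmoothness_two_le_infty
  rw [this a b]

lemma second_fderiv_symm {y : E} (hy : y ∈ U) (a b c d : E) :
    fderiv ℝ (fderiv ℝ G) y a b c d = fderiv ℝ (fderiv ℝ G) y a b d c := by
  have hd : ∀ a b c : E, HasFDerivAt (fun y ↦ fderiv ℝ G y a b c) _ y := fun a b c ↦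
    (((h.hasFDerivAt_fderiv hy).clm_apply (hasFDerivAt_const a y)).clm_apply
      (hasFDerivAt_const b y)).clm_apply (hasFDerivAt_const c y)
  have h3 := (hd b c d).congr_of_eventuallyEq (f₁ := fun y ↦ fderiv ℝ G y b d c)
    (by filter_upwards [h.isOpen.mem_nhds hy] with x hx using h.fderiv_symm hx b d c)
  have := congrArg (fun L : E →L[ℝ] ℝ ↦ L a) (h3.unique (hd b d c))
  simpa using this

lemma apply_coordCurvature_eq [CompleteSpace E] {y : E} (hy : y ∈ U) (u v z w : E) :
    G y (coordCurvature G y u v z) w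
      = (1 / 2) * (fderiv ℝ (fderiv ℝ G) y u z v w - fderiv ℝ (fderiv ℝ G) y u w v z
          - fderiv ℝ (fderiv ℝ G) y v z u w + fderiv ℝ (fderiv ℝ G) y v w u z)
        - G y (christoffel G y u w) (christoffel G y v z)
        + G y (christoffel G y v w) (christoffel G y u z) := by
  rw [h.apply_coordCurvature hy, h.fderiv_apply_christoffel hy, h.fderiv_apply_christoffel hy,
    h.second_fderiv_comm hy u v]
  ring

/-- The formula `apply_coordCurvature_eq` in second derivatives of `G` shows the pair symmetry
directly, with no appeal to the Bianchi identity. -/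
lemma isCurvatureLike [CompleteSpace E] {y : E} (hy : y ∈ U) :
    IsCurvatureLike fun X Y Z W ↦ G y (coordCurvature G y X Y Z) W where
  linear Y Z W := by
    constructor <;> intros <;>
    simp only [coordCurvature, map_add, map_sub, map_smul, add_apply,
      sub_apply, smul_apply, smul_eq_mul] <;> ring
  anti_left X Y Z W := by
    simp only [coordCurvature, map_add, map_sub, add_apply,
      sub_apply]
    ring
  anti_right X Y Z W := by
    rw [h.apply_coordCurvature_eq hy, h.apply_coordCurvature_eq hy,
      h.symm y hy (christoffel G y X W), h.symm y hy (christoffel G y Y W)]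
    ring
  pair X Y Z W := by
    rw [h.apply_coordCurvature_eq hy, h.apply_coordCurvature_eq hy,
      h.second_fderiv_comm hy Z X, h.second_fderiv_comm hy Z Y, h.second_fderiv_comm hy W X,
      h.second_fderiv_comm hy W Y, h.christoffel_symm hy Z Y, h.christoffel_symm hy W X,
      h.christoffel_symm hy W Y, h.christoffel_symm hy Z X,
      h.second_fderiv_symm hy X Z W Y, h.second_fderiv_symm hy Y Z W X,
      h.second_fderiv_symm hy X W Z Y, h.second_fderiv_symm hy Y W Z X,
      h.symm y hy (christoffel G y Y Z)]
    ring

end IsMetricOn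

/-! ### The Gauss equation for a map between coordinate domains -/

section Gauss

variable {F : Type*} [NormedAddCommGroup F] [NormedSpace ℝ F]

/-- The covariant derivative `∇_u V` of a vector field `V` along `f`. -/
def covDeriv (G : E → E →L[ℝ] E →L[ℝ] ℝ) (f V : F → E) (y u : F) : E :=
  fderiv ℝ V y u + christoffel G (f y) (fderiv ℝ f y u) (V y)

/-- The second derivative `∇_u (Df v)` of `f`. -/
def covHessian (G : E → E →L[ℝ] E →L[ℝ] ℝ) (f : F → E) (y u v : F) : E :=
  fderiv ℝ (fderiv ℝ f) y u v + christoffel G (f y) (fderiv ℝ f y u) (fderiv ℝ f y v)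

variable {G : E → E →L[ℝ] E →L[ℝ] ℝ} {U : Set E} {f : F → E} {W : Set F} (hW : IsOpen W)
  (hf : ContDiffOn ℝ ∞ f W)
include hW hf

lemma covDeriv_fderiv {y : F} (hy : y ∈ W) (u v : F) :
    covDeriv G f (fun y ↦ fderiv ℝ f y v) y u = covHessian G f y u v := by
  have hf' : DifferentiableAt ℝ (fderiv ℝ f) y :=
    ((hf.contDiffAt (hW.mem_nhds hy)).fderiv_right (m := ∞) (by simp)).differentiableAt (by simp)
  have h := hf'.hasFDerivAt.clm_apply (hasFDerivAt_const v y)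
  rw [covDeriv, covHessian, h.fderiv]
  simp

lemma differentiableAt_fderiv_apply {y : F} (hy : y ∈ W) (v : F) :
    DifferentiableAt ℝ (fun y ↦ fderiv ℝ f y v) y :=
  (((hf.contDiffAt (hW.mem_nhds hy)).fderiv_right (m := ∞) (by simp)).differentiableAt
    (by simp)).clm_apply (differentiableAt_const v)

variable (hG : IsMetricOn G U) (hfU : MapsTo f W U)
include hG hfU

lemma hasFDerivAt_inner {y : F} (hy : y ∈ W) {V₁ V₂ : F → E} (h₁ : DifferentiableAt ℝ V₁ y)
    (h₂ : DifferentiableAt ℝ V₂ y) (u : F) :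
    fderiv ℝ (fun y ↦ G (f y) (V₁ y) (V₂ y)) y u
      = G (f y) (covDeriv G f V₁ y u) (V₂ y) + G (f y) (V₁ y) (covDeriv G f V₂ y u) := by
  have hf' : HasFDerivAt f (fderiv ℝ f y) y :=
    ((hf.contDiffAt (hW.mem_nhds hy)).differentiableAt (by simp)).hasFDerivAt
  have h := ((HasFDerivAt.comp y (hG.hasFDerivAt (hfU hy)) hf').clm_apply
    h₁.hasFDerivAt).clm_apply h₂.hasFDerivAt
  have h' := h.fderiv
  simp only [Function.comp_apply] at h'
  change fderiv ℝ (fun y ↦ G (f y) (V₁ y) (V₂ y)) y = _ at h'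
  rw [h']
  simp [covDeriv, hG.fderiv_apply (hfU hy)]
  ring

lemma covHessian_symm {y : F} (hy : y ∈ W) (u v : F) :
    covHessian G f y u v = covHessian G f y v u := by
  have := (hf.contDiffAt (hW.mem_nhds hy)).isSymmSndFDerivAt minSmoothness_two_le_infty
  rw [covHessian, covHessian, this u v, hG.christoffel_symm (hfU hy)]

/-- Third derivatives of `f`, and the terms pairing `D²f` with Christoffel symbols, are symmetric in
`u`, `v` and cancel in the commutator. -/
lemma covDeriv_covHessian_sub [CompleteSpace E] {y : F} (hy : y ∈ W) (u v z : F) :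
    covDeriv G f (fun y ↦ covHessian G f y v z) y u
        - covDeriv G f (fun y ↦ covHessian G f y u z) y v
      = coordCurvature G (f y) (fderiv ℝ f y u) (fderiv ℝ f y v) (fderiv ℝ f y z) := by
  have hfy := hf.contDiffAt (hW.mem_nhds hy)
  have hf' : HasFDerivAt f (fderiv ℝ f y) y := (hfy.differentiableAt (by simp)).hasFDerivAt
  have hc1 : ContDiffAt ℝ ∞ (fderiv ℝ f) y := hfy.fderiv_right (by simp)
  have hf1 : HasFDerivAt (fderiv ℝ f) (fderiv ℝ (fderiv ℝ f) y) y :=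
    (hc1.differentiableAt (by simp)).hasFDerivAt
  have hc2 : ContDiffAt ℝ ∞ (fderiv ℝ (fderiv ℝ f)) y := hc1.fderiv_right (by simp)
  have hf2 : HasFDerivAt (fderiv ℝ (fderiv ℝ f)) (fderiv ℝ (fderiv ℝ (fderiv ℝ f)) y) y :=
    (hc2.differentiableAt (by simp)).hasFDerivAt
  have hΓ := HasFDerivAt.comp y (hG.hasFDerivAt_christoffel (hfU hy)) hf'
  have hder : ∀ u v z : F, fderiv ℝ (fun y ↦ covHessian G f y v z) y u
      = fderiv ℝ (fderiv ℝ (fderiv ℝ f)) y u v z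
        + (fderiv ℝ (christoffel G) (f y) (fderiv ℝ f y u) (fderiv ℝ f y v) (fderiv ℝ f y z)
        + christoffel G (f y) (fderiv ℝ (fderiv ℝ f) y u v) (fderiv ℝ f y z)
        + christoffel G (f y) (fderiv ℝ f y v) (fderiv ℝ (fderiv ℝ f) y u z)) := by
    intro u v z
    have h1 := (hf2.clm_apply (hasFDerivAt_const v y)).clm_apply (hasFDerivAt_const z y)
    have h2 := (hΓ.clm_apply (hf1.clm_apply (hasFDerivAt_const v y))).clm_apply
      (hf1.clm_apply (hasFDerivAt_const z y))
    have h := (h1.add h2).fderiv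
    change fderiv ℝ (fun y ↦ covHessian G f y v z) y = _ at h
    rw [h]
    simp
    abel
  have hs2 := hfy.isSymmSndFDerivAt minSmoothness_two_le_infty
  have hs3 := hc1.isSymmSndFDerivAt minSmoothness_two_le_infty
  rw [covDeriv, covDeriv, hder, hder]
  simp only [coordCurvature, covHessian, map_add]
  rw [hs2 u v, hs3 u v]
  abel

variable {H : F → F →L[ℝ] F →L[ℝ] ℝ} (hH : IsMetricOn H W)
  (hHG : ∀ y ∈ W, ∀ u v, H y u v = G (f y) (fderiv ℝ f y u) (fderiv ℝ f y v))
include hH hHG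

lemma fderiv_pullback {y : F} (hy : y ∈ W) (u v w : F) :
    fderiv ℝ H y u v w = G (f y) (covHessian G f y u v) (fderiv ℝ f y w)
      + G (f y) (fderiv ℝ f y v) (covHessian G f y u w) := by
  have h1 := ((hH.hasFDerivAt hy).clm_apply (hasFDerivAt_const v y)).clm_apply
    (hasFDerivAt_const w y)
  have h2 : (fun y ↦ H y v w) =ᶠ[𝓝 y] fun y ↦ G (f y) (fderiv ℝ f y v) (fderiv ℝ f y w) := by
    filter_upwards [hW.mem_nhds hy] with x hx using hHG x hx v w
  have h3 := h2.fderiv_eq (𝕜 := ℝ)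
  rw [h1.fderiv] at h3
  have h4 := DFunLike.congr_fun h3 u
  rw [hasFDerivAt_inner hW hf hG hfU hy (differentiableAt_fderiv_apply hW hf hy v)
    (differentiableAt_fderiv_apply hW hf hy w), covDeriv_fderiv hW hf hy,
    covDeriv_fderiv hW hf hy] at h4
  rw [← h4]
  simp

/-- The induced connection is the tangential part of the ambient one: in the Koszul formula the
symmetric Hessians cancel except for one pair. -/
lemma apply_christoffel_pullback {y : F} (hy : y ∈ W) (u v w : F) :
    H y (christoffel H y u v) w = G (f y) (covHessian G f y u v) (fderiv ℝ f y w) := by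
  rw [hH.apply_christoffel hy, fderiv_pullback hW hf hG hfU hH hHG hy,
    fderiv_pullback hW hf hG hfU hH hHG hy, fderiv_pullback hW hf hG hfU hH hHG hy,
    covHessian_symm hW hf hG hfU hy v u, covHessian_symm hW hf hG hfU hy w u,
    covHessian_symm hW hf hG hfU hy w v, hG.symm (f y) (hfU hy) (fderiv ℝ f y v),
    hG.symm (f y) (hfU hy) (fderiv ℝ f y u)]
  ring

/-- The Gauss equation before tangential and normal parts are separated; no normal field enters, so
the codimension is arbitrary. -/
lemma apply_coordCurvature_pullback [CompleteSpace E] [CompleteSpace F] {y : F} (hy : y ∈ W)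
    (u v z w : F) :
    H y (coordCurvature H y u v z) w
      = G (f y) (coordCurvature G (f y) (fderiv ℝ f y u) (fderiv ℝ f y v) (fderiv ℝ f y z))
          (fderiv ℝ f y w)
        + G (f y) (covHessian G f y v z) (covHessian G f y u w)
        - G (f y) (covHessian G f y u z) (covHessian G f y v w)
        - H y (christoffel H y u w) (christoffel H y v z)
        + H y (christoffel H y v w) (christoffel H y u z) := by
  have hfy := hf.contDiffAt (hW.mem_nhds hy)
  have hf' : HasFDerivAt f (fderiv ℝ f y) y := (hfy.differentiableAt (by simp)).hasFDerivAt
  have hc1 : ContDiffAt ℝ ∞ (fderiv ℝ f) y := hfy.fderiv_right (by simp)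
  have hc2 : ContDiffAt ℝ ∞ (fderiv ℝ (fderiv ℝ f)) y := hc1.fderiv_right (by simp)
  have hBd : ∀ v z, DifferentiableAt ℝ (fun y ↦ covHessian G f y v z) y := by
    intro v z
    have hΓ : DifferentiableAt ℝ (fun y ↦ christoffel G (f y)) y :=
      (HasFDerivAt.comp y (hG.hasFDerivAt_christoffel (hfU hy)) hf').differentiableAt
    have hd1 : DifferentiableAt ℝ (fderiv ℝ f) y := hc1.differentiableAt (by simp)
    have hd2 : DifferentiableAt ℝ (fderiv ℝ (fderiv ℝ f)) y := hc2.differentiableAt (by simp)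
    exact ((hd2.clm_apply (differentiableAt_const v)).clm_apply (differentiableAt_const z)).add
      ((hΓ.clm_apply (hd1.clm_apply (differentiableAt_const v))).clm_apply
        (hd1.clm_apply (differentiableAt_const z)))
  have hK : ∀ u v z w : F, fderiv ℝ (fun y ↦ H y (christoffel H y v z) w) y u
      = G (f y) (covDeriv G f (fun y ↦ covHessian G f y v z) y u) (fderiv ℝ f y w)
        + G (f y) (covHessian G f y v z) (covHessian G f y u w) := by
    intro u v z w
    have h2 : (fun y ↦ H y (christoffel H y v z) w)
        =ᶠ[𝓝 y] fun y ↦ G (f y) (covHessian G f y v z) (fderiv ℝ f y w) := by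
      filter_upwards [hW.mem_nhds hy] with x hx using
        apply_christoffel_pullback hW hf hG hfU hH hHG hx v z w
    rw [h2.fderiv_eq, hasFDerivAt_inner hW hf hG hfU hy (hBd v z)
      (differentiableAt_fderiv_apply hW hf hy w), covDeriv_fderiv hW hf hy]
  rw [hH.apply_coordCurvature hy, hK, hK, ← covDeriv_covHessian_sub hW hf hG hfU hy]
  simp only [map_sub, sub_apply]
  ring

variable {n : F → E} {y : F} (hy : y ∈ W)
  (hspan : ∀ x : E, ∃ (u : F) (c : ℝ), x = fderiv ℝ f y u + c • n y)
  (hn1 : G (f y) (n y) (n y) = 1) (hnf : ∀ u, G (f y) (n y) (fderiv ℝ f y u) = 0)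
include hy hspan hn1 hnf

/-- The two sides have the same inner products with tangent vectors and with `n`, and these span. -/
lemma covHessian_eq (u v : F) :
    covHessian G f y u v = fderiv ℝ f y (christoffel H y u v)
      + G (f y) (n y) (covHessian G f y u v) • n y := by
  refine hG.eq_of_forall (hfU hy) fun x ↦ ?_
  obtain ⟨w, c, rfl⟩ := hspan x
  simp only [map_add, map_smul, add_apply, smul_apply,
    smul_eq_mul, hnf, hn1, ← hHG y hy, apply_christoffel_pullback hW hf hG hfU hH hHG hy,
    hG.symm (f y) (hfU hy) _ (n y)]
  ring

/-- The Gauss equation. -/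
lemma gauss_equation [CompleteSpace E] [CompleteSpace F] (u v z w : F) :
    H y (coordCurvature H y u v z) w
      = G (f y) (coordCurvature G (f y) (fderiv ℝ f y u) (fderiv ℝ f y v) (fderiv ℝ f y z))
          (fderiv ℝ f y w)
        + G (f y) (n y) (covHessian G f y v z) * G (f y) (n y) (covHessian G f y u w)
        - G (f y) (n y) (covHessian G f y u z) * G (f y) (n y) (covHessian G f y v w) := by
  -- Orthogonal splitting of the Hessians; the tangential products then cancel the Christoffel
  -- terms.
  have hB : ∀ u v z w : F, G (f y) (covHessian G f y u v) (covHessian G f y z w)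
      = H y (christoffel H y u v) (christoffel H y z w)
        + G (f y) (n y) (covHessian G f y u v) * G (f y) (n y) (covHessian G f y z w) := by
    intro u v z w
    conv_lhs => rw [covHessian_eq hW hf hG hfU hH hHG hy hspan hn1 hnf u v,
      covHessian_eq hW hf hG hfU hH hHG hy hspan hn1 hnf z w]
    simp only [map_add, map_smul, add_apply, smul_apply,
      smul_eq_mul, hnf, hn1, ← hHG y hy, hG.symm (f y) (hfU hy) (fderiv ℝ f y _) (n y)]
    ring
  rw [apply_coordCurvature_pullback hW hf hG hfU hH hHG hy, hB, hB,
    hH.symm y hy (christoffel H y u w), hH.symm y hy (christoffel H y v w)]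
  ring

end Gauss

/-! ### The Weingarten equation -/

section Weingarten

variable {F : Type*} [NormedAddCommGroup F] [NormedSpace ℝ F]
  {G : E → E →L[ℝ] E →L[ℝ] ℝ} {U : Set E} {f : F → E} {W : Set F} (hW : IsOpen W)
  (hf : ContDiffOn ℝ ∞ f W) (hG : IsMetricOn G U) (hfU : MapsTo f W U)
include hW hf hG hfU

/-- Differentiate the identity `⟨n, df v⟩ = 0` in the direction `u`. -/
lemma weingarten_equation {n : F → E} {y : F} (hy : y ∈ W) (hn : DifferentiableAt ℝ n y)
    (hnf : ∀ x ∈ W, ∀ u, G (f x) (n x) (fderiv ℝ f x u) = 0) (u v : F) :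
    G (f y) (covDeriv G f n y u) (fderiv ℝ f y v) = -G (f y) (n y) (covHessian G f y u v) := by
  have h := hasFDerivAt_inner hW hf hG hfU hy hn
    (differentiableAt_fderiv_apply hW hf hy v) u
  rw [covDeriv_fderiv hW hf hy] at h
  have h0 : (fun y ↦ G (f y) (n y) (fderiv ℝ f y v)) =ᶠ[𝓝 y] fun _ ↦ 0 := by
    filter_upwards [hW.mem_nhds hy] with x hx using hnf x hx v
  rw [h0.fderiv_eq] at h
  simp at h
  linarith

end Weingarten

end MetricCalculus

/-! ### Convexity and the sign of the second fundamental form -/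

section Convexity

set_option maxSynthPendingDepth 3

/-- Applied to `g` alone, the second derivative test gives only a weak maximum. Subtracting `m / 4 *
t ^ 2` leaves the second derivative `m / 2 < 0`, and the weak maximum becomes `g t ≤ m / 4 * t ^ 2`.
-/
lemma eventually_neg_of_second_deriv_neg {g g' : ℝ → ℝ} {m : ℝ}
    (hg : ∀ᶠ t in 𝓝 0, HasDerivAt g (g' t) t) (hg' : HasDerivAt g' m 0) (hm : m < 0)
    (h0 : g 0 = 0) (h1 : g' 0 = 0) : ∀ᶠ t in 𝓝[≠] (0 : ℝ), g t < 0 := by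
  have hd : ∀ᶠ t in 𝓝 0, HasDerivAt (fun t ↦ g t - m / 4 * t ^ 2) (g' t - m / 2 * t) t := by
    filter_upwards [hg] with t ht
    convert! ht.sub ((hasDerivAt_pow 2 t).const_mul (m / 4)) using 1
    norm_num; ring
  have hdd : deriv (fun t ↦ g t - m / 4 * t ^ 2) =ᶠ[𝓝 0] fun t ↦ g' t - m / 2 * t := by
    filter_upwards [hd] with t ht using ht.deriv
  have hdd' : HasDerivAt (fun t ↦ g' t - m / 2 * t) (m - m / 2 * 1) 0 :=
    hg'.sub ((hasDerivAt_id (0 : ℝ)).const_mul (m / 2))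
  have hmax : IsLocalMax (fun t ↦ g t - m / 4 * t ^ 2) 0 := by
    refine isLocalMax_of_deriv_deriv_neg ?_ ?_ hd.self_of_nhds.continuousAt
    · rw [hdd.deriv_eq, hdd'.deriv]; linarith
    · rw [hdd.self_of_nhds]; simp [h1]
  filter_upwards [eventually_nhdsWithin_of_eventually_nhds hmax, self_mem_nhdsWithin] with t ht ht0
  simp only [h0] at ht
  have : 0 < t ^ 2 := by have : t ≠ 0 := ht0; positivity
  nlinarith

lemma IsPreconnected.subset_of_disjoint_frontier {X : Type*} [TopologicalSpace X] {B S : Set X}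
    (hB : IsPreconnected B) (hd : Disjoint B (frontier S)) (hBS : (B ∩ S).Nonempty) : B ⊆ S := by
  have hcov : B ⊆ interior S ∪ (closure S)ᶜ := by
    intro x hx
    by_contra hcon
    simp only [mem_union, mem_compl_iff, not_or, not_not] at hcon
    exact disjoint_left.1 hd hx ⟨hcon.2, hcon.1⟩
  refine (hB.subset_left_of_subset_union isOpen_interior isClosed_closure.isOpen_compl ?_ hcov
    ?_).trans interior_subset
  · exact disjoint_compl_right.mono_left (interior_subset.trans subset_closure)
  · obtain ⟨x, hx, hxS⟩ := hBS
    rcases hcov hx with h | h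
    · exact ⟨x, hx, h⟩
    · exact absurd (subset_closure hxS) h

variable {E : Type*} [NormedAddCommGroup E] [NormedSpace ℝ E]
  {F : Type*} [NormedAddCommGroup F] [NormedSpace ℝ F]

/-- A hypersurface transverse to `n₀` has a local defining function, whose sign tells the two sides
of the hypersurface apart. -/
lemma exists_defining_function [FiniteDimensional ℝ F] {f : F → E} {y₀ : F}
    (hf : ContDiffAt ℝ ∞ f y₀) {n₀ : E}
    (hspan : ∀ x : E, ∃ (u : F) (c : ℝ), x = fderiv ℝ f y₀ u + c • n₀)
    (hinj : ∀ (u : F) (c : ℝ), fderiv ℝ f y₀ u + c • n₀ = 0 → u = 0 ∧ c = 0)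
    {Γ S T : Set E} (hT : T ∈ 𝓝 (f y₀))
    (hconn : ∀ B ⊆ T, IsPreconnected B → Disjoint B Γ → (B ∩ S).Nonempty → B ⊆ S)
    (hΓ : ∀ V ∈ 𝓝 y₀, ∃ U ∈ 𝓝 (f y₀), U ∩ Γ ⊆ f '' V)
    (hbefore : ∀ᶠ t in 𝓝[<] (0 : ℝ), f y₀ + t • n₀ ∈ S)
    (hafter : ∀ᶠ t in 𝓝[>] (0 : ℝ), f y₀ + t • n₀ ∉ S) :
    ∃ ρ : E → ℝ, ContDiffAt ℝ ∞ ρ (f y₀) ∧ (∀ᶠ y in 𝓝 y₀, ρ (f y) = 0) ∧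
      (∀ᶠ s in 𝓝 (0 : ℝ), ρ (f y₀ + s • n₀) = s) ∧
      ∀ᶠ x in 𝓝 (f y₀), (ρ x < 0 → x ∈ S) ∧ (0 < ρ x → x ∉ S) := by
  -- Coordinates along the direction `n₀`: `Φ` is a local diffeomorphism, and `ρ` is the height
  -- component of its inverse.
  set Φ : F × ℝ → E := fun z ↦ f z.1 + z.2 • n₀ with hΦ
  have hΦ0 : Φ (y₀, 0) = f y₀ := by simp [hΦ]
  have hΦs : ContDiffAt ℝ ∞ Φ (y₀, 0) :=
    (ContDiffAt.comp (y₀, (0 : ℝ)) (g := f) hf contDiffAt_fst).add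
      (contDiffAt_snd.smul contDiffAt_const)
  let A : F × ℝ →L[ℝ] E := (fderiv ℝ f y₀).comp (ContinuousLinearMap.fst ℝ F ℝ) +
    (ContinuousLinearMap.snd ℝ F ℝ).smulRight n₀
  have hA : ∀ z, A z = fderiv ℝ f y₀ z.1 + z.2 • n₀ := fun z ↦ rfl
  have hΦd : HasFDerivAt Φ A (y₀, 0) :=
    (HasFDerivAt.comp (y₀, (0 : ℝ)) (g := f) (hf.differentiableAt (by simp)).hasFDerivAt
      hasFDerivAt_fst).add (hasFDerivAt_snd.smul_const n₀)
  have hAbij : Function.Bijective A := by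
    constructor
    · refine (injective_iff_map_eq_zero A).2 fun z hz ↦ ?_
      obtain ⟨h1, h2⟩ := hinj z.1 z.2 hz
      exact Prod.ext h1 h2
    · intro x
      obtain ⟨u, c, rfl⟩ := hspan x
      exact ⟨(u, c), rfl⟩
  let e : (F × ℝ) ≃L[ℝ] E := (LinearEquiv.ofBijective A.toLinearMap hAbij).toContinuousLinearEquiv
  have he : (e : F × ℝ →L[ℝ] E) = A := by ext <;> rfl
  have hΦd' : HasFDerivAt Φ (e : F × ℝ →L[ℝ] E) (y₀, 0) := he ▸ hΦd
  set P := hΦs.toOpenPartialHomeomorph Φ hΦd' (by simp) with hP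
  have hPc : (P : F × ℝ → E) = Φ := rfl
  have hsrc : (y₀, (0 : ℝ)) ∈ P.source := hΦs.mem_toOpenPartialHomeomorph_source hΦd' (by simp)
  have htgt : f y₀ ∈ P.target := by
    have := hΦs.image_mem_toOpenPartialHomeomorph_target hΦd' (by simp)
    rwa [hΦ0] at this
  have hinv0 : P.symm (f y₀) = (y₀, 0) := by
    have := P.left_inv hsrc
    rwa [hPc, hΦ0] at this
  have hsymm : ContDiffAt ℝ ∞ P.symm (f y₀) :=
    P.contDiffAt_symm htgt (by rw [hinv0]; exact hΦd') (by rw [hinv0]; exact hΦs)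
  refine ⟨fun x ↦ (P.symm x).2, contDiffAt_snd.comp _ hsymm, ?_, ?_, ?_⟩
  · have hc : Tendsto (fun y : F ↦ (y, (0 : ℝ))) (𝓝 y₀) (𝓝 (y₀, 0)) :=
      (continuous_id.prodMk continuous_const).continuousAt
    filter_upwards [hc (P.open_source.mem_nhds hsrc)] with y hy
    have := P.left_inv (show (y, (0 : ℝ)) ∈ P.source from hy)
    simp only [hPc, hΦ, zero_smul, add_zero] at this
    rw [this]
  · have hc : Tendsto (fun s : ℝ ↦ (y₀, s)) (𝓝 0) (𝓝 (y₀, 0)) :=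
      (continuous_const.prodMk continuous_id).continuousAt
    filter_upwards [hc (P.open_source.mem_nhds hsrc)] with s hs
    have := P.left_inv (show (y₀, s) ∈ P.source from hs)
    simp only [hPc, hΦ] at this
    rw [this]
  · have hV : {y : F | (y, (0 : ℝ)) ∈ P.source} ∈ 𝓝 y₀ :=
      (continuous_id.prodMk continuous_const).continuousAt (P.open_source.mem_nhds hsrc)
    obtain ⟨U, hU, hUΓ⟩ := hΓ _ hV
    have hbox : P.source ∩ Φ ⁻¹' (T ∩ U) ∈ 𝓝 (y₀, (0 : ℝ)) := by
      refine inter_mem (P.open_source.mem_nhds hsrc) (hΦs.continuousAt ?_)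
      rw [hΦ0]
      exact inter_mem hT hU
    obtain ⟨r, hr, hrbox⟩ := Metric.mem_nhds_iff.1 hbox
    -- Near `f y₀` the set `Γ` lies in the sheet of height zero, so injectivity of `Φ` keeps points
    -- of nonzero height off `Γ`.
    have hdisj : ∀ z ∈ Metric.ball (y₀, (0 : ℝ)) r, z.2 ≠ 0 → Φ z ∉ Γ := by
      intro z hz hz2 hzΓ
      obtain ⟨y, hy, hyz⟩ := hUΓ ⟨(hrbox hz).2.2, hzΓ⟩
      have : (y, (0 : ℝ)) = z := P.injOn hy (hrbox hz).1 (by simp [hPc, hΦ, hyz])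
      exact hz2 (by rw [← this])
    have hball : Metric.ball (y₀, (0 : ℝ)) r = Metric.ball y₀ r ×ˢ Metric.ball 0 r :=
      (ball_prod_same y₀ (0 : ℝ) r).symm
    have hcont : ContinuousOn Φ (Metric.ball (y₀, (0 : ℝ)) r) := fun z hz ↦
      (P.continuousAt (hrbox hz).1).continuousWithinAt
    -- The image of a half-box is connected and misses `Γ`, so one point of the ray through `n₀`
    -- decides its side.
    have hside : ∀ I : Set ℝ, Convex ℝ I → I ⊆ Metric.ball 0 r → (∀ s ∈ I, s ≠ 0) →
        (∃ s ∈ I, f y₀ + s • n₀ ∈ S) → Φ '' (Metric.ball y₀ r ×ˢ I) ⊆ S := by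
      intro I hI hIr hI0 hIS
      have hsub : Metric.ball y₀ r ×ˢ I ⊆ Metric.ball (y₀, (0 : ℝ)) r := by
        rw [hball]; exact prod_mono_right hIr
      refine hconn _ ?_ ?_ ?_ ?_
      · rintro _ ⟨z, hz, rfl⟩
        exact (hrbox (hsub hz)).2.1
      · exact (((convex_ball y₀ r).prod hI).isPreconnected).image _ (hcont.mono hsub)
      · rw [disjoint_left]
        rintro _ ⟨z, hz, rfl⟩
        exact hdisj z (hsub hz) (hI0 _ hz.2)
      · obtain ⟨s, hs, hsS⟩ := hIS
        exact ⟨Φ (y₀, s), ⟨(y₀, s), ⟨Metric.mem_ball_self hr, hs⟩, rfl⟩, hsS⟩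
    have hneg : Φ '' (Metric.ball y₀ r ×ˢ Ioo (-r) 0) ⊆ S := by
      refine hside _ (convex_Ioo _ _) (fun s hs ↦ ?_) (fun s hs ↦ hs.2.ne) ?_
      · rw [Metric.mem_ball, dist_zero_right, Real.norm_eq_abs, abs_lt]
        exact ⟨hs.1, hs.2.trans hr⟩
      · obtain ⟨s, hs, hs'⟩ := (hbefore.and (Ioo_mem_nhdsLT (neg_lt_zero.2 hr))).exists
        exact ⟨s, hs', hs⟩
    have hpos : ∀ z ∈ Metric.ball y₀ r ×ˢ Ioo (0 : ℝ) r, Φ z ∉ S := by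
      intro z hz hzS
      have hsub : Metric.ball y₀ r ×ˢ Ioo (0 : ℝ) r ⊆ Metric.ball (y₀, (0 : ℝ)) r := by
        rw [hball]
        refine prod_mono_right fun s hs ↦ ?_
        rw [Metric.mem_ball, dist_zero_right, Real.norm_eq_abs, abs_lt]
        exact ⟨by linarith [hs.1], hs.2⟩
      have hB : Φ '' (Metric.ball y₀ r ×ˢ Ioo (0 : ℝ) r) ⊆ S := by
        refine hconn _ ?_ ?_ ?_ ⟨Φ z, ⟨z, hz, rfl⟩, hzS⟩
        · rintro _ ⟨z, hz, rfl⟩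
          exact (hrbox (hsub hz)).2.1
        · exact (((convex_ball y₀ r).prod (convex_Ioo _ _)).isPreconnected).image _
            (hcont.mono hsub)
        · rw [disjoint_left]
          rintro _ ⟨z, hz, rfl⟩
          exact hdisj z (hsub hz) hz.2.1.ne'
      obtain ⟨s, hs, hs'⟩ := (hafter.and (Ioo_mem_nhdsGT hr)).exists
      exact hs (hB ⟨(y₀, s), ⟨Metric.mem_ball_self hr, hs'⟩, rfl⟩)
    have hev : ∀ᶠ x in 𝓝 (f y₀), P.symm x ∈ Metric.ball (y₀, (0 : ℝ)) r :=
      hsymm.continuousAt (by rw [hinv0]; exact Metric.ball_mem_nhds _ hr)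
    filter_upwards [hev, P.open_target.mem_nhds htgt] with x hx hxt
    have hx' : Φ (P.symm x) = x := P.right_inv hxt
    rw [hball] at hx
    have hx2 : |(P.symm x).2| < r := by simpa using hx.2
    rw [abs_lt] at hx2
    exact ⟨fun h ↦ hx' ▸ hneg ⟨_, ⟨hx.1, hx2.1, h⟩, rfl⟩,
      fun h ↦ hx' ▸ hpos _ ⟨hx.1, h, hx2.2⟩⟩

/-- The second fundamental form of a hypersurface bounding a geodesically convex set is
semi-definite. -/
lemma inner_covHessian_nonpos [FiniteDimensional ℝ E] {G : E → E →L[ℝ] E →L[ℝ] ℝ} {U : Set E}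
    (hG : IsMetricOn G U)
    {f : F → E} {y₀ : F} (hf : ContDiffAt ℝ ∞ f y₀) (hU : f y₀ ∈ U) {n₀ : E}
    (hspan : ∀ x : E, ∃ (u : F) (c : ℝ), x = fderiv ℝ f y₀ u + c • n₀)
    (hn1 : G (f y₀) n₀ n₀ = 1) (hnf : ∀ u, G (f y₀) n₀ (fderiv ℝ f y₀ u) = 0)
    {S T : Set E} (hT : T ∈ 𝓝 (f y₀))
    (hconv : ∀ (c w : ℝ → E) (δ : ℝ), 0 < δ → (∀ t ∈ Icc (-δ) δ, ∀ᶠ τ in 𝓝 t, c τ ∈ T ∧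
      HasDerivAt c (w τ) τ ∧ HasDerivAt w (-christoffel G (c τ) (w τ) (w τ)) τ) →
      c (-δ) ∈ S → c δ ∈ S → c 0 ∈ S)
    {ρ : E → ℝ} (hρ : ContDiffAt ℝ ∞ ρ (f y₀)) (hρf : ∀ᶠ y in 𝓝 y₀, ρ (f y) = 0)
    (hρn : ∀ᶠ s in 𝓝 (0 : ℝ), ρ (f y₀ + s • n₀) = s)
    (hρS : ∀ᶠ x in 𝓝 (f y₀), (ρ x < 0 → x ∈ S) ∧ (0 < ρ x → x ∉ S)) (u : F) :
    G (f y₀) n₀ (covHessian G f y₀ u u) ≤ 0 := by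
  by_contra! hκ
  set x₀ := f y₀ with hx₀
  set w₀ := fderiv ℝ f y₀ u with hw₀
  have hfd : ∀ᶠ y in 𝓝 y₀, HasFDerivAt f (fderiv ℝ f y) y := by
    filter_upwards [(hf.of_le (m := 1) (by simp)).eventually (by simp)] with y hy using
      (hy.differentiableAt (by simp)).hasFDerivAt
  have hρd : ∀ᶠ x in 𝓝 x₀, HasFDerivAt ρ (fderiv ℝ ρ x) x := by
    filter_upwards [(hρ.of_le (m := 1) (by simp)).eventually (by simp)] with y hy using
      (hy.differentiableAt (by simp)).hasFDerivAt
  have hρ2 : HasFDerivAt (fderiv ℝ ρ) (fderiv ℝ (fderiv ℝ ρ) x₀) x₀ :=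
    ((hρ.fderiv_right (m := ∞) (by simp)).differentiableAt (by simp)).hasFDerivAt
  have hf2 : HasFDerivAt (fderiv ℝ f) (fderiv ℝ (fderiv ℝ f) y₀) y₀ :=
    ((hf.fderiv_right (m := ∞) (by simp)).differentiableAt (by simp)).hasFDerivAt
  have hfy := hfd.self_of_nhds
  have hz1 : ∀ᶠ y in 𝓝 y₀, ∀ v, fderiv ℝ ρ (f y) (fderiv ℝ f y v) = 0 := by
    filter_upwards [hfy.continuousAt.eventually hρd, hfd, hρf.eventually_nhds] with y h1 h2 h3 v
    have h4 := HasFDerivAt.comp y h1 h2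
    have h5 : (ρ ∘ f) =ᶠ[𝓝 y] fun _ ↦ (0 : ℝ) := h3
    have h6 := h5.fderiv_eq (𝕜 := ℝ)
    rw [h4.fderiv] at h6
    simpa using DFunLike.congr_fun h6 v
  have hz2 : fderiv ℝ (fderiv ℝ ρ) x₀ w₀ w₀ + fderiv ℝ ρ x₀ (fderiv ℝ (fderiv ℝ f) y₀ u u) = 0 := by
    have h1 := (HasFDerivAt.comp y₀ hρ2 hfy).clm_apply
      (hf2.clm_apply (hasFDerivAt_const u y₀))
    have h2 : (fun y ↦ fderiv ℝ ρ (f y) (fderiv ℝ f y u)) =ᶠ[𝓝 y₀] fun _ ↦ (0 : ℝ) := by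
      filter_upwards [hz1] with y hy using hy u
    have h3 := h2.fderiv_eq (𝕜 := ℝ)
    have h4 := h1.fderiv
    simp only [Function.comp_apply] at h4
    change fderiv ℝ (fun y ↦ fderiv ℝ ρ (f y) (fderiv ℝ f y u)) y₀ = _ at h4
    rw [h3] at h4
    have h5 := DFunLike.congr_fun h4 u
    simp at h5
    linarith
  have hρn1 : fderiv ℝ ρ x₀ n₀ = 1 := by
    have h1 : HasDerivAt (fun s : ℝ ↦ x₀ + s • n₀) n₀ 0 := by
      simpa using ((hasDerivAt_id (0 : ℝ)).smul_const n₀).const_add x₀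
    have h2 : HasFDerivAt ρ (fderiv ℝ ρ x₀) (x₀ + (0 : ℝ) • n₀) := by
      simpa using hρd.self_of_nhds
    have h3 := h2.comp_hasDerivAt (0 : ℝ) h1
    exact h3.unique ((hasDerivAt_id (0 : ℝ)).congr_of_eventuallyEq hρn)
  -- `n₀` is the gradient of `ρ` at `x₀`: both forms vanish on tangent vectors and equal 1 on `n₀`.
  have hgrad : ∀ x, fderiv ℝ ρ x₀ x = G x₀ n₀ x := by
    intro x
    obtain ⟨v, c, rfl⟩ := hspan x
    have hv : fderiv ℝ ρ x₀ (fderiv ℝ f y₀ v) = 0 := hz1.self_of_nhds v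
    simp [hv, hρn1, hnf, hn1]
  -- This is the second derivative of `ρ` along the geodesic with velocity `w₀`; by `hz2` it is
  -- minus the quantity assumed positive.
  have hm : fderiv ℝ (fderiv ℝ ρ) x₀ w₀ w₀ + fderiv ℝ ρ x₀ (-christoffel G x₀ w₀ w₀) < 0 := by
    rw [map_neg, hgrad]
    rw [covHessian, map_add, ← hgrad] at hκ
    linarith
  -- The geodesic equation as a first-order system; Picard-Lindelöf gives a flow `α` jointly
  -- continuous in time and initial data.
  have hY : ContDiffAt ℝ 1 (fun z : E × E ↦ (z.2, -christoffel G z.1 z.2 z.2)) (x₀, w₀) := by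
    have hΓ : ContDiffAt ℝ 1 (fun z : E × E ↦ christoffel G z.1) (x₀, w₀) :=
      ContDiffAt.comp (x₀, w₀) ((hG.contDiffAt_christoffel hU).of_le (by simp)) contDiffAt_fst
    exact contDiffAt_snd.prodMk
      ((hΓ.clm_apply contDiffAt_snd).clm_apply contDiffAt_snd).neg
  obtain ⟨ε, hε, a, r, L, K, hr, hpl⟩ := IsPicardLindelof.of_contDiffAt_one hY
  obtain ⟨α, hα, hαc⟩ := (hpl 0).exists_forall_mem_closedBall_eq_hasDerivWithinAt_continuousOn
  simp only [zero_sub, zero_add] at hα hαc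
  have hder : ∀ z ∈ Metric.closedBall (x₀, w₀) r, ∀ t ∈ Ioo (-ε) ε,
      HasDerivAt (fun t ↦ (α (z, t)).1) (α (z, t)).2 t ∧
      HasDerivAt (fun t ↦ (α (z, t)).2)
        (-christoffel G (α (z, t)).1 (α (z, t)).2 (α (z, t)).2) t := by
    intro z hz t ht
    have h1 := ((hα z hz).2 t (Ioo_subset_Icc_self ht)).hasDerivAt (Icc_mem_nhds ht.1 ht.2)
    exact ⟨(ContinuousLinearMap.fst ℝ E E).hasFDerivAt.comp_hasDerivAt t h1,
      (ContinuousLinearMap.snd ℝ E E).hasFDerivAt.comp_hasDerivAt t h1⟩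
  have hz₀ : (x₀, w₀) ∈ Metric.closedBall (x₀, w₀) (r : ℝ) := Metric.mem_closedBall_self r.2
  have hcat : ContinuousAt α ((x₀, w₀), 0) :=
    hαc.continuousAt (prod_mem_nhds (Metric.closedBall_mem_nhds _ hr)
      (Icc_mem_nhds (neg_lt_zero.2 hε) hε))
  have hα0 : α ((x₀, w₀), 0) = (x₀, w₀) := (hα _ hz₀).1
  have hneg : ∀ᶠ t in 𝓝[≠] (0 : ℝ), ρ (α ((x₀, w₀), t)).1 < 0 := by
    have h0 := hder _ hz₀ 0 ⟨neg_lt_zero.2 hε, hε⟩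
    have hct : Tendsto (fun t ↦ (α ((x₀, w₀), t)).1) (𝓝 0) (𝓝 x₀) := by
      have := h0.1.continuousAt
      rwa [ContinuousAt, hα0] at this
    refine eventually_neg_of_second_deriv_neg
      (g' := fun t ↦ fderiv ℝ ρ (α ((x₀, w₀), t)).1 (α ((x₀, w₀), t)).2) ?_ ?_ hm ?_ ?_
    · filter_upwards [hct.eventually hρd, Ioo_mem_nhds (neg_lt_zero.2 hε) hε] with t h1 h2
      exact h1.comp_hasDerivAt t (hder _ hz₀ t h2).1
    · rw [hα0] at h0
      have h1 : HasDerivAt (fun t ↦ fderiv ℝ ρ (α ((x₀, w₀), t)).1)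
          (fderiv ℝ (fderiv ℝ ρ) x₀ w₀) 0 := by
        refine HasFDerivAt.comp_hasDerivAt (0 : ℝ) (f := fun t ↦ (α ((x₀, w₀), t)).1) ?_ h0.1
        rw [hα0]
        exact hρ2
      have h2 := h1.clm_apply h0.2
      rwa [hα0] at h2
    · rw [hα0]; exact hρf.self_of_nhds
    · rw [hα0]; exact hz1.self_of_nhds u
  have hgood : ∀ᶠ x in 𝓝 x₀, x ∈ T ∧ ContinuousAt ρ x ∧
      ((ρ x < 0 → x ∈ S) ∧ (0 < ρ x → x ∉ S)) := by
    filter_upwards [hT, hρd, hρS] with x h1 h2 h3 using ⟨h1, h2.continuousAt, h3⟩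
  have hgood' : ∀ᶠ z in 𝓝 ((x₀, w₀), (0 : ℝ)), (α z).1 ∈ T ∧ ContinuousAt ρ (α z).1 ∧
      ((ρ (α z).1 < 0 → (α z).1 ∈ S) ∧ (0 < ρ (α z).1 → (α z).1 ∉ S)) := by
    have h1 : Tendsto (fun z ↦ (α z).1) (𝓝 ((x₀, w₀), (0 : ℝ))) (𝓝 x₀) := by
      have h2 := continuousAt_fst.comp hcat
      rw [ContinuousAt, Function.comp_apply, hα0] at h2
      exact h2
    exact h1.eventually hgood
  rw [nhds_prod_eq, eventually_prod_iff] at hgood'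
  obtain ⟨p, hp, q, hq, hpq⟩ := hgood'
  obtain ⟨δ₀, hδ₀, hδ₀'⟩ := Metric.eventually_nhds_iff.1 hq
  obtain ⟨δ₁, hδ₁, hδ₁'⟩ := Metric.eventually_nhds_iff.1 (eventually_nhdsWithin_iff.1 hneg)
  obtain ⟨δ, hδ, hδlt⟩ := exists_between (lt_min (lt_min hδ₀ hδ₁) hε)
  have hδε : δ < ε := hδlt.trans_le (min_le_right _ _)
  have hδ₀l : δ < δ₀ := hδlt.trans_le ((min_le_left _ _).trans (min_le_left _ _))
  have hδ₁l : δ < δ₁ := hδlt.trans_le ((min_le_left _ _).trans (min_le_right _ _))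
  have hqt : ∀ t ∈ Icc (-δ) δ, q t := fun t ht ↦
    hδ₀' (by rw [dist_zero_right, Real.norm_eq_abs]; exact (abs_le.2 ht).trans_lt hδ₀l)
  have hend : ∀ t, t ≠ 0 → t ∈ Icc (-δ) δ → ∀ᶠ z in 𝓝 (x₀, w₀), ρ (α (z, t)).1 < 0 := by
    intro t ht0 ht
    have h1 : ρ (α ((x₀, w₀), t)).1 < 0 :=
      hδ₁' (by rw [dist_zero_right, Real.norm_eq_abs]; exact (abs_le.2 ht).trans_lt hδ₁l) ht0
    have h2 : ContinuousAt ρ (α ((x₀, w₀), t)).1 := (hpq hp.self_of_nhds (hqt t ht)).2.1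
    have h3 : ContinuousAt α ((x₀, w₀), t) :=
      hαc.continuousAt (prod_mem_nhds (Metric.closedBall_mem_nhds _ hr)
        (Icc_mem_nhds (by linarith [ht.1]) (by linarith [ht.2])))
    have h4 : ContinuousAt (fun z ↦ (z, t) : E × E → (E × E) × ℝ) (x₀, w₀) :=
      (continuous_id.prodMk continuous_const).continuousAt
    have h5 : ContinuousAt (fun z : E × E ↦ α (z, t)) (x₀, w₀) :=
      ContinuousAt.comp (f := fun z : E × E ↦ (z, t)) h3 h4
    have h6 : ContinuousAt (fun z : E × E ↦ ρ (α (z, t)).1) (x₀, w₀) :=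
      ContinuousAt.comp (f := fun z : E × E ↦ (α (z, t)).1) h2 h5.fst
    exact h6.eventually (gt_mem_nhds h1)
  -- Shift the initial point outward, keeping the velocity. For small `s > 0` both ends still have
  -- `ρ < 0`, while the midpoint has `ρ = s > 0`, against convexity.
  have hline : Tendsto (fun s : ℝ ↦ (x₀ + s • n₀, w₀)) (𝓝[>] 0) (𝓝 (x₀, w₀)) := by
    have h1 : Continuous fun s : ℝ ↦ (x₀ + s • n₀, w₀) := by fun_prop
    have h2 := h1.tendsto 0
    simp only [zero_smul, add_zero] at h2
    exact h2.mono_left nhdsWithin_le_nhds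
  have hmem : δ ∈ Icc (-δ) δ := ⟨by linarith, le_rfl⟩
  have hmem' : -δ ∈ Icc (-δ) δ := ⟨le_rfl, by linarith⟩
  have hmem0 : (0 : ℝ) ∈ Icc (-δ) δ := ⟨by linarith, hδ.le⟩
  obtain ⟨s, ⟨⟨⟨⟨hs1, hs2⟩, hs3⟩, hs4⟩, hs5⟩, hs6⟩ :=
    (((((hline.eventually hp).and (hline.eventually (hend δ hδ.ne' hmem))).and
      (hline.eventually (hend (-δ) (neg_ne_zero.2 hδ.ne') hmem'))).and
      (hline.eventually (Metric.closedBall_mem_nhds _ hr))).and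
      (eventually_nhdsWithin_of_eventually_nhds hρn)).and self_mem_nhdsWithin |>.exists
  set z : E × E := (x₀ + s • n₀, w₀) with hz
  have hαz : α (z, 0) = z := (hα z hs4).1
  have hin := hconv (fun t ↦ (α (z, t)).1) (fun t ↦ (α (z, t)).2) δ hδ (by
      intro t ht
      -- The geodesic equation is required in a neighbourhood of the end times too, hence the room
      -- beyond `[-δ, δ]`.
      have ht' : t ∈ Ioo (-(min δ₀ ε)) (min δ₀ ε) := by
        have : δ < min δ₀ ε := lt_min hδ₀l hδε
        exact ⟨by linarith [ht.1], by linarith [ht.2]⟩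
      filter_upwards [Ioo_mem_nhds ht'.1 ht'.2] with τ hτ
      have hτ1 : |τ| < min δ₀ ε := abs_lt.2 hτ
      refine ⟨(hpq hs1 (hδ₀' ?_)).1, hder z hs4 τ ?_⟩
      · rw [dist_zero_right, Real.norm_eq_abs]
        exact hτ1.trans_le (min_le_left _ _)
      · exact abs_lt.1 (hτ1.trans_le (min_le_right _ _)))
    ((hpq hs1 (hqt _ hmem')).2.2.1 hs3) ((hpq hs1 (hqt _ hmem)).2.2.1 hs2)
  have hout := (hpq hs1 (hqt _ hmem0)).2.2.2
  simp only [hαz] at hin hout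
  refine hout ?_ hin
  rw [hz]
  simp only [hs5]
  exact hs6

end Convexity

/-! ### Tensors in charts -/

section Charts

variable {E : Type*} [NormedAddCommGroup E] [NormedSpace ℝ E]
  {M : Type*} [TopologicalSpace M] [ChartedSpace E M]

/-- The derivative at `y` of the inverse of the chart centred at `p`. -/
def chartSymmDeriv (p : M) (y : E) : E →L[ℝ] E :=
  mfderiv 𝓘(ℝ, E) 𝓘(ℝ, E) (extChartAt 𝓘(ℝ, E) p).symm y

lemma metricInChart_apply
    (g : ∀ x : M, TangentSpace 𝓘(ℝ, E) x →L[ℝ] TangentSpace 𝓘(ℝ, E) x →L[ℝ] ℝ)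
    (p : M) (y v w : E) :
    metricInChart g p y v w = g ((extChartAt 𝓘(ℝ, E) p).symm y) (chartSymmDeriv p y v)
      (chartSymmDeriv p y w) :=
  rfl

variable [IsManifold 𝓘(ℝ, E) ∞ M]

/-- The tangent space at `p` is the model space as seen in the chart centred at `p`, so there the
chart has identity derivative. -/
lemma chartDeriv_self (p : M) : chartDeriv (E := E) p p = ContinuousLinearMap.id ℝ E :=
  mfderiv_extChartAt_self

lemma chartDeriv_self_apply (p : M) (v : TangentSpace 𝓘(ℝ, E) p) : chartDeriv p p v = v := by
  rw [chartDeriv_self]; rfl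

lemma chartDeriv_self_inverse_apply (p : M) (v : E) : (chartDeriv p p).inverse v = v := by
  have h : (chartDeriv (E := E) p p).inverse = ContinuousLinearMap.id ℝ E := by
    rw [chartDeriv_self]; exact ContinuousLinearMap.inverse_id
  rw [h]; rfl

lemma chartSymmDeriv_chartDeriv {p x : M} (hx : x ∈ (extChartAt 𝓘(ℝ, E) p).source)
    (v : TangentSpace 𝓘(ℝ, E) x) :
    chartSymmDeriv p (extChartAt 𝓘(ℝ, E) p x) (chartDeriv p x v) = v := by
  have h := mfderivWithin_extChartAt_symm_comp_mfderiv_extChartAt' (I := 𝓘(ℝ, E)) hx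
  rw [ModelWithCorners.range_eq_univ, mfderivWithin_univ] at h
  exact DFunLike.congr_fun h v

lemma chartDeriv_chartSymmDeriv {p : M} {y : E} (hy : y ∈ (extChartAt 𝓘(ℝ, E) p).target) (v : E) :
    chartDeriv p ((extChartAt 𝓘(ℝ, E) p).symm y)
      (chartSymmDeriv p y v) = v := by
  have h := mfderiv_extChartAt_comp_mfderivWithin_extChartAt_symm (I := 𝓘(ℝ, E)) hy
  rw [ModelWithCorners.range_eq_univ, mfderivWithin_univ] at h
  exact DFunLike.congr_fun h v

variable (g : ∀ x : M, TangentSpace 𝓘(ℝ, E) x →L[ℝ] TangentSpace 𝓘(ℝ, E) x →L[ℝ] ℝ)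

lemma metricInChart_chartDeriv {p x : M} (hx : x ∈ (extChartAt 𝓘(ℝ, E) p).source)
    (v w : TangentSpace 𝓘(ℝ, E) x) :
    metricInChart g p (extChartAt 𝓘(ℝ, E) p x) (chartDeriv p x v) (chartDeriv p x w)
      = g x v w := by
  -- Forgetting the dependence of the type on the base point allows the base point to be rewritten.
  let g' : M → E →L[ℝ] E →L[ℝ] ℝ := g
  change g' ((extChartAt 𝓘(ℝ, E) p).symm (extChartAt 𝓘(ℝ, E) p x))
    (chartSymmDeriv p (extChartAt 𝓘(ℝ, E) p x) (chartDeriv p x v))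
    (chartSymmDeriv p (extChartAt 𝓘(ℝ, E) p x) (chartDeriv p x w)) = g' x v w
  rw [chartSymmDeriv_chartDeriv hx, chartSymmDeriv_chartDeriv hx,
    (extChartAt 𝓘(ℝ, E) p).left_inv hx]

lemma metricInChart_self (p : M) (v w : TangentSpace 𝓘(ℝ, E) p) :
    metricInChart g p (extChartAt 𝓘(ℝ, E) p p) v w = g p v w := by
  have h := metricInChart_chartDeriv g (mem_extChartAt_source (I := 𝓘(ℝ, E)) p) v w
  rwa [chartDeriv_self_apply, chartDeriv_self_apply] at h

lemma curvature_eq (p : M) (X Y Z : TangentSpace 𝓘(ℝ, E) p) :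
    curvature g p X Y Z
      = coordCurvature (metricInChart g p) (extChartAt 𝓘(ℝ, E) p p) X Y Z := by
  rw [curvature, chartDeriv_self_inverse_apply, chartDeriv_self_apply, chartDeriv_self_apply,
    chartDeriv_self_apply]

lemma isInvertible_of_pos [FiniteDimensional ℝ E] {B : E →L[ℝ] E →L[ℝ] ℝ}
    (hB : ∀ v, v ≠ 0 → 0 < B v v) : B.IsInvertible := by
  have hinj : Function.Injective ((LinearMap.toContinuousLinearMap (𝕜 := ℝ) (E := E)
      (F' := ℝ)).symm.toLinearMap ∘ₗ B.toLinearMap) := by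
    rw [← LinearMap.ker_eq_bot, LinearMap.ker_eq_bot']
    intro v hv
    by_contra hv0
    have h1 := DFunLike.congr_fun hv v
    have h2 : B v v = 0 := h1
    exact (hB v hv0).ne' h2
  let e := LinearEquiv.ofInjectiveOfFinrankEq _ hinj
    (Subspace.dual_finrank_eq (K := ℝ) (V := E)).symm
  let e' : E ≃L[ℝ] (E →L[ℝ] ℝ) := (e.trans LinearMap.toContinuousLinearMap).toContinuousLinearEquiv
  refine ⟨e', ?_⟩
  ext v w
  rfl

end Charts

section AmbientCharts

variable {E : Type*} [NormedAddCommGroup E] [NormedSpace ℝ E]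
  (M : Type*) [MetricSpace M] [ChartedSpace E M]
  [RiemannianBundle (fun x : M ↦ TangentSpace 𝓘(ℝ, E) x)]

lemma ambientMetric_symm (x : M) (v w : TangentSpace 𝓘(ℝ, E) x) :
    ambientMetric M x v w = ambientMetric M x w v :=
  real_inner_comm (F := TangentSpace 𝓘(ℝ, E) x) w v

lemma ambientMetric_pos (x : M) (v : TangentSpace 𝓘(ℝ, E) x) (hv : v ≠ 0) :
    0 < ambientMetric M x v v :=
  real_inner_self_pos (F := TangentSpace 𝓘(ℝ, E) x).2 hv

variable [FiniteDimensional ℝ E] [IsManifold 𝓘(ℝ, E) ∞ M]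
  [IsContMDiffRiemannianBundle 𝓘(ℝ, E) ∞ E (fun x : M ↦ TangentSpace 𝓘(ℝ, E) x)]

/-- The coordinate fields `y ↦ chartSymmDeriv p y u` are smooth sections, and the bundle metric
pairs smooth sections smoothly. -/
lemma contDiffOn_metricInChart (p : M) :
    ContDiffOn ℝ ∞ (metricInChart (ambientMetric (E := E) M) p) (extChartAt 𝓘(ℝ, E) p).target := by
  have ho : IsOpen (extChartAt 𝓘(ℝ, E) p).target := isOpen_extChartAt_target p
  have hv : ∀ u : E, ContMDiffOn 𝓘(ℝ, E) 𝓘(ℝ, E).tangent ∞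
      (fun y : E ↦ (⟨(extChartAt 𝓘(ℝ, E) p).symm y,
        chartSymmDeriv p y u⟩ : TangentBundle 𝓘(ℝ, E) M))
      (extChartAt 𝓘(ℝ, E) p).target := by
    intro u
    have h1 := (contMDiffOn_extChartAt_symm (I := 𝓘(ℝ, E)) (n := ∞) p).contMDiffOn_tangentMapWithin
      (m := ∞) (by simp) ho.uniqueMDiffOn
    have h2 : ContMDiff 𝓘(ℝ, E) 𝓘(ℝ, E).tangent ∞
        (fun y : E ↦ (⟨y, u⟩ : TangentBundle 𝓘(ℝ, E) E)) := by
      exact contMDiff_vectorSpace_iff_contDiff.2 contDiff_const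
    refine (h1.comp h2.contMDiffOn (fun y hy ↦ hy)).congr fun y hy ↦ ?_
    simp only [Function.comp_apply, tangentMapWithin]
    rw [mfderivWithin_of_isOpen ho hy]
    rfl
  refine contDiffOn_clm_apply.2 fun u ↦ contDiffOn_clm_apply.2 fun w ↦ ?_
  have h := ContMDiffOn.inner_bundle (E := fun x : M ↦ TangentSpace 𝓘(ℝ, E) x) (hv u) (hv w)
  exact contMDiffOn_iff_contDiffOn.1 h

lemma isMetricOn_metricInChart (p : M) :
    IsMetricOn (metricInChart (ambientMetric (E := E) M) p) (extChartAt 𝓘(ℝ, E) p).target where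
  isOpen := isOpen_extChartAt_target p
  contDiffOn := contDiffOn_metricInChart M p
  symm y hy u v := by
    exact ambientMetric_symm M ((extChartAt 𝓘(ℝ, E) p).symm y) (chartSymmDeriv p y u)
      (chartSymmDeriv p y v)
  invertible y hy := by
    refine isInvertible_of_pos fun v hv ↦ ?_
    rw [metricInChart_apply]
    refine ambientMetric_pos M _ _ fun h ↦ hv ?_
    have h1 := chartDeriv_chartSymmDeriv hy v
    rw [h, map_zero] at h1
    exact h1.symm

end AmbientCharts

/-! ### The curvature of a Cartan-Hadamard manifold with large nullity -/

section AmbientCurvature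

variable {E : Type*} [NormedAddCommGroup E] [NormedSpace ℝ E] [FiniteDimensional ℝ E]
  {M : Type*} [MetricSpace M] [ChartedSpace E M] [IsManifold 𝓘(ℝ, E) ∞ M]
  [RiemannianBundle (fun x : M ↦ TangentSpace 𝓘(ℝ, E) x)]
  [IsContMDiffRiemannianBundle 𝓘(ℝ, E) ∞ E (fun x : M ↦ TangentSpace 𝓘(ℝ, E) x)]

lemma isCurvatureLike_curvature (p : M) :
    IsCurvatureLike fun X Y Z W : TangentSpace 𝓘(ℝ, E) p ↦
      ambientMetric M p (curvature (ambientMetric M) p X Y Z) W := by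
  have h := (isMetricOn_metricInChart (E := E) M p).isCurvatureLike (mem_extChartAt_target p)
  have he : (fun X Y Z W : TangentSpace 𝓘(ℝ, E) p ↦
      ambientMetric M p (curvature (ambientMetric M) p X Y Z) W)
      = fun X Y Z W : E ↦ metricInChart (ambientMetric M) p (extChartAt 𝓘(ℝ, E) p p)
        (coordCurvature (metricInChart (ambientMetric M) p) (extChartAt 𝓘(ℝ, E) p p) X Y Z) W := by
    funext X Y Z W
    rw [curvature_eq]
    exact (metricInChart_self (ambientMetric M) p _ W).symm
  rw [he]
  exact h

lemma IsCartanHadamard.inner_curvature_nonpos (hM : IsCartanHadamard (E := E) M) (p : M)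
    (X Y : TangentSpace 𝓘(ℝ, E) p) :
    ambientMetric M p (curvature (ambientMetric M) p X Y Y) X ≤ 0 := by
  have hc := isCurvatureLike_curvature (E := E) p
  by_cases hXY : LinearIndependent ℝ ![X, Y]
  · have h := hM.nonpos p X Y hXY
    have hpos : 0 < ambientMetric M p X X * ambientMetric M p Y Y - ambientMetric M p X Y ^ 2 := by
      have hX : X ≠ 0 := hXY.ne_zero (0 : Fin 2)
      have hX2 := ambientMetric_pos M p X hX
      -- The squared norm of this vector is `g(X, X)` times the Gram determinant.
      have hZ : ambientMetric M p X X • Y - ambientMetric M p X Y • X ≠ 0 := by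
        intro h0
        have h1 := LinearIndependent.pair_iff.1 hXY (-ambientMetric M p X Y)
          (ambientMetric M p X X) (by rw [← h0]; module)
        exact hX2.ne' h1.2
      have h2 := ambientMetric_pos M p _ hZ
      simp only [map_sub, map_smul, sub_apply, smul_apply, smul_eq_mul,
        ambientMetric_symm M p Y X] at h2
      have h3 : 0 < ambientMetric M p X X *
          (ambientMetric M p X X * ambientMetric M p Y Y - ambientMetric M p X Y ^ 2) := by
        linarith
      exact (mul_pos_iff_of_pos_left hX2).1 h3
    rw [sectionalCurvature, div_le_iff₀ hpos, zero_mul] at h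
    exact h
  -- For dependent vectors the sectional curvature says nothing, but the numerator vanishes by
  -- antisymmetry.
  · rw [LinearIndependent.pair_iff] at hXY
    push Not at hXY
    obtain ⟨s, t, hst, h0⟩ := hXY
    have hdiag : ∀ Z W T : TangentSpace 𝓘(ℝ, E) p,
        ambientMetric M p (curvature (ambientMetric M) p Z Z W) T = 0 := fun Z W T ↦ by
      have := hc.anti_left Z Z W T
      exact self_eq_neg.1 this
    have hlin : ∀ (Z : TangentSpace 𝓘(ℝ, E) p), s * ambientMetric M p
        (curvature (ambientMetric M) p X Z Y) X + t * ambientMetric M p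
        (curvature (ambientMetric M) p Y Z Y) X = 0 := by
      intro Z
      have hl := IsLinearMap.mk' _ (hc.linear Z Y X)
      have h1 := (IsLinearMap.mk' _ (hc.linear Z Y X)).map_add (s • X) (t • Y)
      rw [hst, map_zero, map_smul, map_smul] at h1
      simpa using h1.symm
    by_cases hs : s = 0
    · have ht : t ≠ 0 := h0 hs
      have h1 := hlin X
      rw [hdiag, mul_zero, zero_add] at h1
      have h2 := (mul_eq_zero.1 h1).resolve_left ht
      have h3 := hc.anti_left X Y Y X
      have h4 : ambientMetric M p (curvature (ambientMetric M) p Y X Y) X = 0 := h2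
      exact (h3.trans (by rw [h4, neg_zero])).le
    · have h1 := hlin Y
      rw [hdiag, mul_zero, add_zero] at h1
      exact ((mul_eq_zero.1 h1).resolve_left hs).le

lemma isNonposOfRankThree_curvatureForm (hM : IsCartanHadamard (E := E) M)
    (hμ : Module.finrank ℝ E ≤ nullityIndex (ambientMetric (E := E) M) + 3) (p : M) {k : ℕ}
    (e : Fin k → TangentSpace 𝓘(ℝ, E) p) :
    IsNonposOfRankThree fun i j l m ↦ curvatureForm (ambientMetric M) p e i j (e l) (e m) := by
  have : FiniteDimensional ℝ (TangentSpace 𝓘(ℝ, E) p) := inferInstanceAs (FiniteDimensional ℝ E)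
  refine (isCurvatureLike_curvature p).isNonposOfRankThree (hM.inner_curvature_nonpos p)
    (nullitySpace (ambientMetric M) p) (fun Z hZ X Y W ↦ ?_) ?_ e
  · have h : curvature (ambientMetric M) p X Y Z = 0 := hZ X Y
    rw [h, map_zero, zero_apply]
  · have h : nullityIndex (ambientMetric (E := E) M)
        ≤ Module.finrank ℝ (nullitySpace (ambientMetric (E := E) M) p) := ciInf_le' _ p
    have h2 : Module.finrank ℝ (TangentSpace 𝓘(ℝ, E) p) = Module.finrank ℝ E := rfl
    omega

end AmbientCurvature

/-! ### Pfaffian and transgression as double alternations -/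

section PfaffianFormula

lemma pfaffian_eq {E : Type*} [NormedAddCommGroup E] [NormedSpace ℝ E]
    {M : Type*} [TopologicalSpace M] [ChartedSpace E M]
    (g : ∀ x : M, TangentSpace 𝓘(ℝ, E) x →L[ℝ] TangentSpace 𝓘(ℝ, E) x →L[ℝ] ℝ)
    (p : M) {k : ℕ} (hk : Even k) (e : Fin k → TangentSpace 𝓘(ℝ, E) p) :
    pfaffian g p hk e = (1 / (k.factorial : ℝ)) * ((1 / 2 ^ (k / 2)) *
      doubleAlternation (fun σ τ ↦ ∏ b : Fin (k / 2), curvatureForm g p e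
        (σ ⟨2 * b, by have := b.2; omega⟩) (σ ⟨2 * b + 1, by have := b.2; omega⟩)
        (e (τ ⟨2 * b, by have := b.2; omega⟩)) (e (τ ⟨2 * b + 1, by have := b.2; omega⟩)))) := by
  rw [pfaffian, doubleAlternation]
  congr 1
  rw [Finset.mul_sum]
  refine Finset.sum_congr rfl fun σ _ ↦ ?_
  simp only [wedge, Finset.univ_eq_empty, Finset.prod_empty, one_mul, zero_add, Finset.mul_sum]
  refine Finset.sum_congr rfl fun τ _ ↦ ?_
  ring

lemma sphereVolume_pos (j : ℕ) : 0 < sphereVolume j := by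
  have : Nontrivial (EuclideanSpace ℝ (Fin (j + 1))) := inferInstance
  rw [sphereVolume, MeasureTheory.measureReal_def]
  refine ENNReal.toReal_pos ?_ (MeasureTheory.measure_ne_top _ _)
  rw [MeasureTheory.Measure.measure_univ_ne_zero]
  exact MeasureTheory.Measure.toSphere_ne_zero _

lemma transgressionConst_nonneg (k s : ℕ) : 0 ≤ transgressionConst k s := by
  have h1 := sphereVolume_pos (k - 1)
  have h2 := sphereVolume_pos (k - 1 - 2 * s)
  rw [transgressionConst]
  positivity

/-- This constant cancels the factorial in `doubleAlternation_prod`, so the `s = 0` term of the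
transgression is exactly `GK`. -/
lemma transgressionConst_zero (k : ℕ) :
    transgressionConst k 0 = 1 / ((k - 1).factorial : ℝ) := by
  have h1 := (sphereVolume_pos (k - 1)).ne'
  simp only [transgressionConst, pow_zero, one_mul, mul_zero, Nat.sub_zero]
  field_simp

end PfaffianFormula

section TransgressionFormula

variable {E : Type*} [NormedAddCommGroup E] [NormedSpace ℝ E]
  {M : Type*} [MetricSpace M] [ChartedSpace E M]
  [RiemannianBundle (fun x : M ↦ TangentSpace 𝓘(ℝ, E) x)]
  {F : Type*} [NormedAddCommGroup F] [NormedSpace ℝ F]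
  {N : Type*} [TopologicalSpace N] [ChartedSpace F N]

lemma transgression_le {ι : N → M} {ν : ∀ q : N, TangentSpace 𝓘(ℝ, E) (ι q)} {q : N} {k : ℕ}
    (hk : 2 ≤ k) (e : Fin (k - 1) → TangentSpace 𝓘(ℝ, F) q)
    (hR : IsNonposOfRankThree fun i j l m ↦ curvatureForm (ambientMetric (E := E) M) (ι q)
      (fun i ↦ differential ι q (e i)) i j (differential ι q (e l)) (differential ι q (e m)))
    (ha : (Matrix.of fun i j ↦ shapeForm ι ν q e i (e j)).PosSemidef) :
    transgression ι ν q e ≤ gaussKronecker ι ν q e := by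
  have hterm : ∀ s : Fin (k / 2), transgressionConst k s *
      ∑ σ : Equiv.Perm (Fin (k - 1)), ((Equiv.Perm.sign σ : ℤ) : ℝ) *
      wedge (r := k - 1 - 2 * s) (s := s) (by have := s.2; omega)
        (fun a ↦ shapeForm ι ν q e (σ ⟨a, by have := a.2; omega⟩))
        (fun b X Y ↦ curvatureForm (ambientMetric (E := E) M) (ι q) (fun i ↦ differential ι q (e i))
          (σ ⟨k - 1 - 2 * s + 2 * b, by have := s.2; have := b.2; omega⟩)
          (σ ⟨k - 1 - 2 * s + 2 * b + 1, by have := s.2; have := b.2; omega⟩)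
          (differential ι q X) (differential ι q Y)) e
      = transgressionConst k s * ((1 / 2 ^ (s : ℕ)) * doubleAlternation (fun σ τ ↦
        (∏ i : Fin (k - 1 - 2 * s), Matrix.of (fun i j ↦ shapeForm ι ν q e i (e j))
          (σ ⟨i, by have := i.2; omega⟩) (τ ⟨i, by have := i.2; omega⟩)) *
        ∏ b : Fin s, curvatureForm (ambientMetric (E := E) M) (ι q)
          (fun i ↦ differential ι q (e i))
          (σ ⟨k - 1 - 2 * s + 2 * b, by have := s.2; have := b.2; omega⟩)
          (σ ⟨k - 1 - 2 * s + 2 * b + 1, by have := s.2; have := b.2; omega⟩)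
          (differential ι q (e (τ ⟨k - 1 - 2 * s + 2 * b, by have := s.2; have := b.2; omega⟩)))
          (differential ι q (e
            (τ ⟨k - 1 - 2 * s + 2 * b + 1, by have := s.2; have := b.2; omega⟩))))) := by
    intro s
    congr 1
    rw [doubleAlternation, Finset.mul_sum]
    refine Finset.sum_congr rfl fun σ _ ↦ ?_
    simp only [wedge, Finset.mul_sum]
    refine Finset.sum_congr rfl fun τ _ ↦ ?_
    simp only [Matrix.of_apply]
    ring
  rw [transgression, Finset.sum_congr rfl fun s _ ↦ hterm s]
  have h0 : (⟨0, by omega⟩ : Fin (k / 2)) ∈ (Finset.univ : Finset (Fin (k / 2))) :=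
    Finset.mem_univ _
  rw [← Finset.add_sum_erase _ _ h0]
  have hsum : ∀ x y z : ℝ, x = z → y ≤ 0 → x + y ≤ z := fun x y z h h' ↦ by linarith
  refine hsum _ _ _ ?_ (Finset.sum_nonpos fun s hs ↦ ?_)
  · have h := doubleAlternation_prod (Matrix.of fun i j ↦ shapeForm ι ν q e i (e j))
    simp only [Finset.univ_eq_empty, Finset.prod_empty, mul_one, pow_zero, div_one, one_mul]
    rw [transgressionConst_zero]
    -- The index `k - 1 - 2 * 0` is `k - 1` by definition, so the sum is the one in `h`.
    have h' : doubleAlternation (fun σ τ : Equiv.Perm (Fin (k - 1)) ↦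
        ∏ i : Fin (k - 1 - 2 * 0), Matrix.of (fun i j ↦ shapeForm ι ν q e i (e j))
          (σ ⟨i, by have := i.2; omega⟩) (τ ⟨i, by have := i.2; omega⟩)) = _ := h
    rw [h', gaussKronecker]
    have hf : ((k - 1).factorial : ℝ) ≠ 0 := by positivity
    field_simp
  · have hs1 : 1 ≤ (s : ℕ) := by
      have := (Finset.mem_erase.1 hs).1
      rw [ne_eq, Fin.ext_iff] at this
      simp only at this
      omega
    have h := doubleAlternation_transgression_nonpos hR ha (r := k - 1 - 2 * s) (s := s)
      (by have := s.2; omega) hs1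
    exact mul_nonpos_of_nonneg_of_nonpos (transgressionConst_nonneg _ _)
      (mul_nonpos_of_nonneg_of_nonpos (by positivity) h)

end TransgressionFormula

/-! ### The hypersurface and its normal field in charts -/

section LocalExpression

variable {E : Type*} [NormedAddCommGroup E] [NormedSpace ℝ E]
  {M : Type*} [MetricSpace M] [ChartedSpace E M]
  {F : Type*} [NormedAddCommGroup F] [NormedSpace ℝ F]
  {N : Type*} [TopologicalSpace N] [ChartedSpace F N]

/-- The expression of `ι` in the charts centred at `q` and `ι q`. -/
def localExpr (ι : N → M) (q : N) (y : F) : E :=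
  extChartAt 𝓘(ℝ, E) (ι q) (ι ((extChartAt 𝓘(ℝ, F) q).symm y))

/-- The domain of `localExpr ι q`. -/
def localDomain (E : Type*) [NormedAddCommGroup E] [NormedSpace ℝ E] [ChartedSpace E M]
    (ι : N → M) (q : N) : Set F :=
  (extChartAt 𝓘(ℝ, F) q).target ∩
    (extChartAt 𝓘(ℝ, F) q).symm ⁻¹' (ι ⁻¹' (extChartAt 𝓘(ℝ, E) (ι q)).source)

/-- The expression of a vector field `ν` along `ι` in the charts centred at `q` and `ι q`. -/
def localNormal (ι : N → M) (ν : ∀ q : N, TangentSpace 𝓘(ℝ, E) (ι q)) (q : N) (y : F) : E :=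
  chartDeriv (ι q) (ι ((extChartAt 𝓘(ℝ, F) q).symm y)) (ν ((extChartAt 𝓘(ℝ, F) q).symm y))

lemma localExpr_self (ι : N → M) (q : N) :
    localExpr (E := E) ι q (extChartAt 𝓘(ℝ, F) q q) = extChartAt 𝓘(ℝ, E) (ι q) (ι q) := by
  rw [localExpr, extChartAt_to_inv]

lemma mem_localDomain (ι : N → M) (q : N) :
    extChartAt 𝓘(ℝ, F) q q ∈ localDomain E ι q := by
  refine ⟨mem_extChartAt_target q, ?_⟩
  rw [mem_preimage, mem_preimage, extChartAt_to_inv]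
  exact mem_extChartAt_source _

lemma isOpen_localDomain {ι : N → M} (hι : Continuous ι) (q : N) :
    IsOpen (localDomain (F := F) E ι q) :=
  (continuousOn_extChartAt_symm q).isOpen_inter_preimage (isOpen_extChartAt_target q)
    ((isOpen_extChartAt_source _).preimage hι)

lemma mapsTo_localExpr (ι : N → M) (q : N) :
    MapsTo (localExpr (E := E) (F := F) ι q) (localDomain E ι q)
      (extChartAt 𝓘(ℝ, E) (ι q)).target :=
  fun _ hy ↦ (extChartAt 𝓘(ℝ, E) (ι q)).map_source hy.2

lemma mfderiv_eq_fderiv_writtenInExtChartAt {M : Type*} [TopologicalSpace M] [ChartedSpace E M]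
    {f : N → M} {q : N} (hf : MDifferentiableAt 𝓘(ℝ, F) 𝓘(ℝ, E) f q) :
    mfderiv 𝓘(ℝ, F) 𝓘(ℝ, E) f q
      = fderiv ℝ (writtenInExtChartAt 𝓘(ℝ, F) 𝓘(ℝ, E) q f) (extChartAt 𝓘(ℝ, F) q q) := by
  let L : F →L[ℝ] E := mfderiv 𝓘(ℝ, F) 𝓘(ℝ, E) f q
  have h : HasFDerivWithinAt (writtenInExtChartAt 𝓘(ℝ, F) 𝓘(ℝ, E) q f) L (range 𝓘(ℝ, F))
      (extChartAt 𝓘(ℝ, F) q q) := hf.hasMFDerivAt.2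
  rw [ModelWithCorners.range_eq_univ, hasFDerivWithinAt_univ] at h
  exact h.fderiv.symm

lemma fderiv_localExpr_self [RiemannianBundle (fun x : M ↦ TangentSpace 𝓘(ℝ, E) x)]
    {ι : N → M} (hι : ContMDiff 𝓘(ℝ, F) 𝓘(ℝ, E) ∞ ι) (q : N)
    (u : TangentSpace 𝓘(ℝ, F) q) :
    fderiv ℝ (localExpr (E := E) ι q) (extChartAt 𝓘(ℝ, F) q q) u = differential ι q u := by
  exact (DFunLike.congr_fun
    (mfderiv_eq_fderiv_writtenInExtChartAt ((hι q).mdifferentiableAt (by simp))) u).symm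

variable [IsManifold 𝓘(ℝ, E) ∞ M]

lemma localNormal_self (ι : N → M) (ν : ∀ q : N, TangentSpace 𝓘(ℝ, E) (ι q)) (q : N) :
    localNormal ι ν q (extChartAt 𝓘(ℝ, F) q q) = ν q := by
  have h : ∀ q', q' = q → (chartDeriv (ι q) (ι q') (ν q') : E) = ν q := by
    rintro q' rfl
    exact chartDeriv_self_apply _ _
  exact h _ (extChartAt_to_inv q)

lemma inner_localNormal_self [RiemannianBundle (fun x : M ↦ TangentSpace 𝓘(ℝ, E) x)]
    {ι : N → M} {ν : ∀ q : N, TangentSpace 𝓘(ℝ, E) (ι q)}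
    (hν : ∀ q, ambientMetric M (ι q) (ν q) (ν q) = 1) {q : N} {y : F}
    (hy : y ∈ localDomain E ι q) :
    metricInChart (ambientMetric M) (ι q) (localExpr ι q y) (localNormal ι ν q y)
      (localNormal ι ν q y) = 1 := by
  rw [← hν ((extChartAt 𝓘(ℝ, F) q).symm y)]
  exact metricInChart_chartDeriv (ambientMetric M) hy.2 _ _

/-- The function is the second component of the smooth section composed with the tangent map of the
chart. -/
lemma mdifferentiableAt_chartDeriv {ι : N → M} {ν : ∀ q : N, TangentSpace 𝓘(ℝ, E) (ι q)}
    (hν : ContMDiff 𝓘(ℝ, F) 𝓘(ℝ, E).tangent ∞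
      (fun q ↦ (⟨ι q, ν q⟩ : TangentBundle 𝓘(ℝ, E) M))) (q : N) :
    MDifferentiableAt 𝓘(ℝ, F) 𝓘(ℝ, E) (fun q' ↦ chartDeriv (ι q) (ι q') (ν q')) q := by
  have ho : IsOpen (chartAt E (ι q)).source := (chartAt E (ι q)).open_source
  have h1 := (contMDiffOn_extChartAt (I := 𝓘(ℝ, E)) (n := ∞)
    (x := ι q)).contMDiffOn_tangentMapWithin (m := ∞) (by simp) ho.uniqueMDiffOn
  have hq : ι q ∈ (chartAt E (ι q)).source := mem_chart_source E (ι q)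
  have hπ : (TotalSpace.proj : TangentBundle 𝓘(ℝ, E) M → M) ⁻¹' (chartAt E (ι q)).source
      ∈ 𝓝 (⟨ι q, ν q⟩ : TangentBundle 𝓘(ℝ, E) M) :=
    (FiberBundle.continuous_proj E
      (fun x : M ↦ TangentSpace 𝓘(ℝ, E) x)).continuousAt.preimage_mem_nhds
      (ho.mem_nhds hq)
  have h2 := (h1.contMDiffAt hπ).comp q (hν q)
  have h3 := ((contMDiff_snd_tangentBundle_modelSpace (n := ∞) E 𝓘(ℝ, E)).contMDiffAt).comp q h2
  refine (h3.mdifferentiableAt (by simp)).congr_of_eventuallyEq ?_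
  filter_upwards [hν.continuous.continuousAt.preimage_mem_nhds hπ] with q' hq'
  have hq'' : ι q' ∈ (chartAt E (ι q)).source := hq'
  exact (DFunLike.congr_fun (mfderivWithin_of_isOpen (I := 𝓘(ℝ, E)) (I' := 𝓘(ℝ, E))
    (f := extChartAt 𝓘(ℝ, E) (ι q)) ho hq'') (ν q')).symm

lemma differentiableAt_localNormal {ι : N → M} {ν : ∀ q : N, TangentSpace 𝓘(ℝ, E) (ι q)}
    (hν : ContMDiff 𝓘(ℝ, F) 𝓘(ℝ, E).tangent ∞
      (fun q ↦ (⟨ι q, ν q⟩ : TangentBundle 𝓘(ℝ, E) M))) (q : N) :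
    DifferentiableAt ℝ (localNormal ι ν q) (extChartAt 𝓘(ℝ, F) q q) := by
  have h := (mdifferentiableAt_chartDeriv hν q).differentiableWithinAt_writtenInExtChartAt
  rw [ModelWithCorners.range_eq_univ, differentiableWithinAt_univ] at h
  exact h

lemma shapeOperator_eq [RiemannianBundle (fun x : M ↦ TangentSpace 𝓘(ℝ, E) x)]
    {ι : N → M} (hι : ContMDiff 𝓘(ℝ, F) 𝓘(ℝ, E) ∞ ι)
    {ν : ∀ q : N, TangentSpace 𝓘(ℝ, E) (ι q)}
    (hν : ContMDiff 𝓘(ℝ, F) 𝓘(ℝ, E).tangent ∞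
      (fun q ↦ (⟨ι q, ν q⟩ : TangentBundle 𝓘(ℝ, E) M))) (q : N) (X : TangentSpace 𝓘(ℝ, F) q) :
    shapeOperator ι ν q X = covDeriv (metricInChart (ambientMetric M) (ι q)) (localExpr ι q)
      (localNormal ι ν q) (extChartAt 𝓘(ℝ, F) q q) X := by
  have h := DFunLike.congr_fun
    (mfderiv_eq_fderiv_writtenInExtChartAt (mdifferentiableAt_chartDeriv hν q)) X
  let dν : F →L[ℝ] E := mfderiv 𝓘(ℝ, F) 𝓘(ℝ, E) (fun q' ↦ chartDeriv (ι q) (ι q') (ν q')) q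
  have h2 : shapeOperator ι ν q X = dν X
        + christoffel (metricInChart (ambientMetric M) (ι q)) (extChartAt 𝓘(ℝ, E) (ι q) (ι q))
          (differential ι q X) (ν q) := by
    unfold shapeOperator
    rw [chartDeriv_self_inverse_apply, chartDeriv_self_apply, chartDeriv_self_apply]
    rfl
  refine h2.trans (congrArg₂ (fun a b : E ↦ a + b) h ?_)
  have h3 := fderiv_localExpr_self hι q X
  rw [localExpr_self, localNormal_self]
  exact congrArg (fun w : E ↦ christoffel (metricInChart (ambientMetric M) (ι q))
    (extChartAt 𝓘(ℝ, E) (ι q) (ι q)) w (ν q)) h3.symm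

variable [IsManifold 𝓘(ℝ, F) ∞ N]

lemma contDiffOn_localExpr {ι : N → M} (hι : ContMDiff 𝓘(ℝ, F) 𝓘(ℝ, E) ∞ ι) (q : N) :
    ContDiffOn ℝ ∞ (localExpr (E := E) ι q) (localDomain (F := F) E ι q) := by
  rw [← contMDiffOn_iff_contDiffOn]
  exact (contMDiffOn_extChartAt (n := ∞) (x := ι q)).comp
    (hι.comp_contMDiffOn ((contMDiffOn_extChartAt_symm q).mono inter_subset_left))
    fun y hy ↦ by
      have h := hy.2
      rwa [mem_preimage, mem_preimage, extChartAt_source] at h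

lemma fderiv_localExpr [RiemannianBundle (fun x : M ↦ TangentSpace 𝓘(ℝ, E) x)]
    {ι : N → M} (hι : ContMDiff 𝓘(ℝ, F) 𝓘(ℝ, E) ∞ ι) {q : N} {y : F}
    (hy : y ∈ localDomain E ι q) (u : F) :
    fderiv ℝ (localExpr (E := E) ι q) y u = chartDeriv (ι q) (ι ((extChartAt 𝓘(ℝ, F) q).symm y))
      (differential ι ((extChartAt 𝓘(ℝ, F) q).symm y) (chartSymmDeriv q y u)) := by
  have h1 : MDifferentiableAt 𝓘(ℝ, F) 𝓘(ℝ, F) (extChartAt 𝓘(ℝ, F) q).symm y :=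
    ((contMDiffOn_extChartAt_symm (n := ∞) q).contMDiffAt
      ((isOpen_extChartAt_target q).mem_nhds hy.1)).mdifferentiableAt (by simp)
  have h2 : MDifferentiableAt 𝓘(ℝ, F) 𝓘(ℝ, E) ι ((extChartAt 𝓘(ℝ, F) q).symm y) :=
    (hι _).mdifferentiableAt (by simp)
  have h3 : MDifferentiableAt 𝓘(ℝ, E) 𝓘(ℝ, E) (extChartAt 𝓘(ℝ, E) (ι q))
      (ι ((extChartAt 𝓘(ℝ, F) q).symm y)) :=
    mdifferentiableAt_extChartAt (by have h := hy.2; rwa [mem_preimage, mem_preimage,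
      extChartAt_source] at h)
  have h4 : mfderiv 𝓘(ℝ, F) 𝓘(ℝ, E) (localExpr (E := E) ι q) y u = _ :=
    mfderiv_comp_apply y (h3.comp _ h2) h1 u
  rw [mfderiv_comp _ h3 h2] at h4
  rw [← mfderiv_eq_fderiv]
  exact h4

variable [RiemannianBundle (fun x : M ↦ TangentSpace 𝓘(ℝ, E) x)]

lemma metricInChart_inducedMetric {ι : N → M} (hι : ContMDiff 𝓘(ℝ, F) 𝓘(ℝ, E) ∞ ι) {q : N} {y : F}
    (hy : y ∈ localDomain E ι q) (u v : F) :
    metricInChart (inducedMetric (E := E) ι) q y u v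
      = metricInChart (ambientMetric M) (ι q) (localExpr ι q y)
        (fderiv ℝ (localExpr (E := E) ι q) y u) (fderiv ℝ (localExpr (E := E) ι q) y v) := by
  rw [fderiv_localExpr hι hy, fderiv_localExpr hι hy]
  exact (metricInChart_chartDeriv (ambientMetric M) hy.2 _ _).symm

lemma inner_localNormal_fderiv {ι : N → M} (hι : ContMDiff 𝓘(ℝ, F) 𝓘(ℝ, E) ∞ ι)
    {ν : ∀ q : N, TangentSpace 𝓘(ℝ, E) (ι q)}
    (hν : ∀ (q : N) (X : TangentSpace 𝓘(ℝ, F) q),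
      ambientMetric M (ι q) (ν q) (differential ι q X) = 0) {q : N} {y : F}
    (hy : y ∈ localDomain E ι q) (u : F) :
    metricInChart (ambientMetric M) (ι q) (localExpr ι q y) (localNormal ι ν q y)
      (fderiv ℝ (localExpr (E := E) ι q) y u) = 0 := by
  rw [fderiv_localExpr hι hy, ← hν ((extChartAt 𝓘(ℝ, F) q).symm y) (chartSymmDeriv q y u)]
  exact metricInChart_chartDeriv (ambientMetric M) hy.2 _ _

end LocalExpression

/-! ### Orthonormal frames, the induced metric, and transversality of the normal -/

section Frames

/-- A family that is orthonormal for a bilinear form, and as long as the dimension, spans. -/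
lemma exists_eq_sum_of_orthonormal {F : Type*} [NormedAddCommGroup F] [NormedSpace ℝ F]
    [FiniteDimensional ℝ F] (B : F →L[ℝ] F →L[ℝ] ℝ) {k : ℕ} (hk : Module.finrank ℝ F = k)
    {e : Fin k → F} (he : ∀ i j, B (e i) (e j) = if i = j then 1 else 0) (u : F) :
    u = ∑ i, B (u) (e i) • e i := by
  have hli : LinearIndependent ℝ e := by
    rw [Fintype.linearIndependent_iff]
    intro g hg i
    have h := congrArg (fun v ↦ B v (e i)) hg
    simpa [he] using h
  have hspan : u ∈ Submodule.span ℝ (range e) := by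
    rw [hli.span_eq_top_of_card_eq_finrank' (by simp [hk])]
    trivial
  obtain ⟨c, rfl⟩ := (Submodule.mem_span_range_iff_exists_fun ℝ).1 hspan
  simp [he]

end Frames

section Hypersurface

variable {E : Type*} [NormedAddCommGroup E] [NormedSpace ℝ E] [FiniteDimensional ℝ E]
  {M : Type*} [MetricSpace M] [ChartedSpace E M] [IsManifold 𝓘(ℝ, E) ∞ M]
  [RiemannianBundle (fun x : M ↦ TangentSpace 𝓘(ℝ, E) x)]
  {F : Type*} [NormedAddCommGroup F] [NormedSpace ℝ F] [FiniteDimensional ℝ F]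
  {N : Type*} [TopologicalSpace N] [ChartedSpace F N]

omit [FiniteDimensional ℝ E] [FiniteDimensional ℝ F] [IsManifold 𝓘(ℝ, E) ∞ M] in
lemma inducedMetric_apply (ι : N → M) (q : N) (u v : TangentSpace 𝓘(ℝ, F) q) :
    inducedMetric (E := E) ι q u v
      = ambientMetric M (ι q) (differential (E := E) ι q u) (differential (E := E) ι q v) :=
  rfl

omit [FiniteDimensional ℝ E] [IsManifold 𝓘(ℝ, E) ∞ M] in
-- An orthonormal frame of full length makes the induced form nondegenerate, which forces the
-- differential to be injective.
lemma differential_injective {ι : N → M} {q : N} {k : ℕ} (hk : Module.finrank ℝ F = k)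
    {e : Fin k → TangentSpace 𝓘(ℝ, F) q}
    (he : IsOrthonormalFrame (inducedMetric (E := E) ι) q e)
    {u : TangentSpace 𝓘(ℝ, F) q} (hu : differential (E := E) ι q u = 0) : u = 0 := by
  have h := exists_eq_sum_of_orthonormal (F := F) (inducedMetric (E := E) ι q) hk (e := e) he u
  have h0 : ∀ v, inducedMetric (E := E) ι q u v = 0 := by
    intro v
    rw [inducedMetric_apply, hu, map_zero, zero_apply]
  refine h.trans (Finset.sum_eq_zero fun i _ ↦ ?_)
  have h1 := h0 (e i)
  exact (congrArg (fun c : ℝ ↦ c • (e i : F)) h1).trans (zero_smul ℝ _)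

variable {ι : N → M} (hι : ContMDiff 𝓘(ℝ, F) 𝓘(ℝ, E) ∞ ι) {q : N} {k : ℕ}
  (hk : Module.finrank ℝ F = k) {e : Fin k → TangentSpace 𝓘(ℝ, F) q}
  (he : IsOrthonormalFrame (inducedMetric (E := E) ι) q e)
include hι hk he

/-- Nondegeneracy is known at `q` only; as invertibility is an open condition, it persists on a
smaller neighbourhood `W`. -/
lemma exists_isMetricOn_inducedMetric [IsManifold 𝓘(ℝ, F) ∞ N]
    [IsContMDiffRiemannianBundle 𝓘(ℝ, E) ∞ E (fun x : M ↦ TangentSpace 𝓘(ℝ, E) x)] :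
    ∃ W : Set F, extChartAt 𝓘(ℝ, F) q q ∈ W ∧ W ⊆ localDomain E ι q ∧
      IsMetricOn (metricInChart (inducedMetric (E := E) ι) q) W := by
  set y₀ := extChartAt 𝓘(ℝ, F) q q with hy₀
  have hy : y₀ ∈ localDomain E ι q := mem_localDomain ι q
  have hW : IsOpen (localDomain (F := F) E ι q) := isOpen_localDomain hι.continuous q
  have hf := contDiffOn_localExpr (E := E) hι q
  have hG := isMetricOn_metricInChart (E := E) M (ι q)
  have hsm : ContDiffOn ℝ ∞ (metricInChart (inducedMetric (E := E) ι) q)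
      (localDomain (F := F) E ι q) := by
    refine contDiffOn_clm_apply.2 fun u ↦ contDiffOn_clm_apply.2 fun v ↦ ?_
    have hd : ContDiffOn ℝ ∞ (fderiv ℝ (localExpr (E := E) ι q)) (localDomain (F := F) E ι q) :=
      hf.fderiv_of_isOpen hW (by simp)
    exact (((hG.contDiffOn.comp hf (mapsTo_localExpr ι q)).clm_apply
      (hd.clm_apply contDiffOn_const)).clm_apply (hd.clm_apply contDiffOn_const)).congr
      fun y hy ↦ metricInChart_inducedMetric hι hy u v
  have hinv : (metricInChart (inducedMetric (E := E) ι) q y₀).IsInvertible := by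
    refine isInvertible_of_pos fun v hv ↦ ?_
    let v' : TangentSpace 𝓘(ℝ, F) q := v
    have h1 := metricInChart_self (inducedMetric (E := E) ι) q v' v'
    rw [inducedMetric_apply] at h1
    refine lt_of_lt_of_eq ?_ h1.symm
    exact ambientMetric_pos M _ _ fun h ↦ hv (differential_injective hk he (u := v') h)
  obtain ⟨L, hL⟩ := hinv
  have hnhds : metricInChart (inducedMetric (E := E) ι) q ⁻¹' range
      ((↑) : (F ≃L[ℝ] (F →L[ℝ] ℝ)) → F →L[ℝ] F →L[ℝ] ℝ) ∈ 𝓝 y₀ :=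
    ((hsm.continuousOn.continuousAt (hW.mem_nhds hy)).preimage_mem_nhds
      (hL ▸ ContinuousLinearEquiv.nhds L))
  obtain ⟨W, hWs, hWo, hyW⟩ := mem_nhds_iff.1 (inter_mem hnhds (hW.mem_nhds hy))
  refine ⟨W, hyW, fun y hy ↦ (hWs hy).2, hWo, hsm.mono fun y hy ↦ (hWs hy).2, ?_,
    fun y hy ↦ (hWs hy).1⟩
  intro y hy u v
  rw [metricInChart_inducedMetric hι (hWs hy).2, metricInChart_inducedMetric hι (hWs hy).2,
    hG.symm _ (mapsTo_localExpr ι q (hWs hy).2)]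

variable {ν : ∀ q : N, TangentSpace 𝓘(ℝ, E) (ι q)}
  (hν1 : ∀ q, ambientMetric M (ι q) (ν q) (ν q) = 1)
  (hνι : ∀ (q : N) (X : TangentSpace 𝓘(ℝ, F) q),
      ambientMetric M (ι q) (ν q) (differential ι q X) = 0)
include hν1 hνι

omit [FiniteDimensional ℝ E] in
lemma eq_zero_of_fderiv_add_smul_eq_zero (u : F) (c : ℝ)
    (h : fderiv ℝ (localExpr (E := E) ι q) (extChartAt 𝓘(ℝ, F) q q) u
      + c • localNormal ι ν q (extChartAt 𝓘(ℝ, F) q q) = 0) : u = 0 ∧ c = 0 := by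
  let u' : TangentSpace 𝓘(ℝ, F) q := u
  have h1 : differential ι q u' + c • ν q = 0 := by
    rw [localNormal_self] at h
    exact (congrArg (fun x : E ↦ x + (HSMul.hSMul (β := E) c (ν q) : E))
      (fderiv_localExpr_self hι q u')).symm.trans h
  have hc : c = 0 := by
    have h2 := congrArg (ambientMetric M (ι q) (ν q)) h1
    rwa [map_add, map_smul, hνι q u', hν1, map_zero, zero_add, smul_eq_mul, mul_one] at h2
  refine ⟨differential_injective hk he (u := u') ?_, hc⟩
  rwa [hc, zero_smul, add_zero] at h1

lemma exists_eq_fderiv_add_smul (hE : Module.finrank ℝ E = k + 1) (x : E) :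
    ∃ (u : F) (c : ℝ), x = fderiv ℝ (localExpr (E := E) ι q) (extChartAt 𝓘(ℝ, F) q q) u
      + c • localNormal ι ν q (extChartAt 𝓘(ℝ, F) q q) := by
  let A : F × ℝ →ₗ[ℝ] E :=
    (fderiv ℝ (localExpr (E := E) ι q) (extChartAt 𝓘(ℝ, F) q q)).toLinearMap ∘ₗ
      LinearMap.fst ℝ F ℝ
    + (LinearMap.snd ℝ F ℝ).smulRight (localNormal ι ν q (extChartAt 𝓘(ℝ, F) q q))
  have hinj : Function.Injective A := (injective_iff_map_eq_zero A).2 fun z hz ↦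
    Prod.ext_iff.2 (eq_zero_of_fderiv_add_smul_eq_zero hι hk he hν1 hνι z.1 z.2 hz)
  have hfr : Module.finrank ℝ (F × ℝ) = Module.finrank ℝ E := by
    rw [Module.finrank_prod, hk, hE, Module.finrank_self]
  obtain ⟨z, rfl⟩ := (LinearMap.injective_iff_surjective_of_finrank_eq_finrank hfr).1 hinj x
  exact ⟨z.1, z.2, rfl⟩

end Hypersurface

/-! ### Gauss equation and positivity of the shape operator for the convex hypersurface -/

section ConvexHypersurface

variable {E : Type*} [NormedAddCommGroup E] [NormedSpace ℝ E] [FiniteDimensional ℝ E]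
  {M : Type*} [MetricSpace M] [ChartedSpace E M] [IsManifold 𝓘(ℝ, E) ∞ M]
  [RiemannianBundle (fun x : M ↦ TangentSpace 𝓘(ℝ, E) x)]
  [IsContMDiffRiemannianBundle 𝓘(ℝ, E) ∞ E (fun x : M ↦ TangentSpace 𝓘(ℝ, E) x)]
  {F : Type*} [NormedAddCommGroup F] [NormedSpace ℝ F] [FiniteDimensional ℝ F]
  {N : Type*} [TopologicalSpace N] [ChartedSpace F N] [IsManifold 𝓘(ℝ, F) ∞ N]
  {ι : N → M} {C : Set M} {ν : ∀ q : N, TangentSpace 𝓘(ℝ, E) (ι q)}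
  (hι : ContMDiff 𝓘(ℝ, F) 𝓘(ℝ, E) ∞ ι) (hν : IsOutwardUnitNormal (F := F) ι C ν)
  {q : N} {k : ℕ} (e : Fin k → TangentSpace 𝓘(ℝ, F) q)

/-- The second fundamental form `⟨ν, D²ι(u, v)⟩` at `q`. -/
def secondForm (ι : N → M) (ν : ∀ q : N, TangentSpace 𝓘(ℝ, E) (ι q)) (q : N)
    (u v : TangentSpace 𝓘(ℝ, F) q) : ℝ :=
  metricInChart (ambientMetric M) (ι q) (localExpr ι q (extChartAt 𝓘(ℝ, F) q q))
    (localNormal ι ν q (extChartAt 𝓘(ℝ, F) q q))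
    (covHessian (F := F) (metricInChart (ambientMetric M) (ι q)) (localExpr ι q)
      (extChartAt 𝓘(ℝ, F) q q) u v)

omit [FiniteDimensional ℝ F] in
include hι in
lemma secondForm_symm (u v : TangentSpace 𝓘(ℝ, F) q) :
    secondForm ι ν q u v = secondForm ι ν q v u :=
  congrArg _ (covHessian_symm (isOpen_localDomain hι.continuous q)
    (contDiffOn_localExpr (E := E) hι q) (isMetricOn_metricInChart (E := E) M (ι q))
    (mapsTo_localExpr ι q) (mem_localDomain ι q) u v)

omit [FiniteDimensional ℝ F] in
include hι hν in
-- The Weingarten equation. For the outward normal it makes convexity read `secondForm ≤ 0`, that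
-- is, `A ≥ 0`.
lemma shapeForm_eq (i j : Fin k) : shapeForm ι ν q e i (e j) = -secondForm ι ν q (e j) (e i) := by
  have hw := weingarten_equation (isOpen_localDomain hι.continuous q)
    (contDiffOn_localExpr (E := E) hι q) (isMetricOn_metricInChart (E := E) M (ι q))
    (mapsTo_localExpr ι q) (mem_localDomain ι q) (differentiableAt_localNormal hν.contMDiff q)
    (fun x hx u ↦ inner_localNormal_fderiv hι hν.normal hx u) (e j) (e i)
  refine Eq.trans ?_ hw
  have h1 := metricInChart_self (ambientMetric (E := E) M) (ι q) (shapeOperator ι ν q (e j))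
    (differential ι q (e i))
  refine h1.symm.trans ?_
  rw [shapeOperator_eq hι hν.contMDiff q (e j), localExpr_self]
  exact congrArg _ (fderiv_localExpr_self hι q (e i)).symm

include hι hν in
lemma curvatureForm_inducedMetric (hk : Module.finrank ℝ F = k) (hE : Module.finrank ℝ E = k + 1)
    (he : IsOrthonormalFrame (inducedMetric (E := E) ι) q e) (i j l m : Fin k) :
    curvatureForm (inducedMetric (E := E) ι) q e i j (e l) (e m)
      = curvatureForm (ambientMetric (E := E) M) (ι q) (fun i ↦ differential ι q (e i)) i j
          (differential ι q (e l)) (differential ι q (e m))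
        + wedgeSq (Matrix.of fun i j ↦ shapeForm ι ν q e i (e j)) i j l m := by
  obtain ⟨W, hqW, hWs, hH⟩ := exists_isMetricOn_inducedMetric hι hk he
  have hg := gauss_equation hH.isOpen ((contDiffOn_localExpr (E := E) hι q).mono hWs)
    (isMetricOn_metricInChart (E := E) M (ι q)) ((mapsTo_localExpr ι q).mono_left hWs) hH
    (fun y hy u v ↦ metricInChart_inducedMetric hι (hWs hy) u v) hqW
    (exists_eq_fderiv_add_smul hι hk he hν.unit hν.normal hE)
    (inner_localNormal_self hν.unit (mem_localDomain ι q))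
    (fun u ↦ inner_localNormal_fderiv hι hν.normal (mem_localDomain ι q) u)
    (e l) (e m) (e j) (e i)
  have h1 := metricInChart_self (inducedMetric (E := E) ι) q
    (curvature (inducedMetric (E := E) ι) q (e l) (e m) (e j)) (e i)
  conv_lhs at h1 => rw [curvature_eq]
  have h2 := metricInChart_self (ambientMetric (E := E) M) (ι q)
      (curvature (ambientMetric M) (ι q) (differential ι q (e l)) (differential ι q (e m))
        (differential ι q (e j))) (differential ι q (e i))
  conv_lhs at h2 => rw [curvature_eq, ← localExpr_self (F := F) ι q]
  have hd : ∀ i, fderiv ℝ (localExpr (E := E) ι q) (extChartAt 𝓘(ℝ, F) q q) (e i)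
      = differential ι q (e i) := fun i ↦ fderiv_localExpr_self hι q (e i)
  rw [hd, hd, hd, hd] at hg
  have h3 : curvatureForm (inducedMetric (E := E) ι) q e i j (e l) (e m)
      = curvatureForm (ambientMetric (E := E) M) (ι q) (fun i ↦ differential ι q (e i)) i j
          (differential ι q (e l)) (differential ι q (e m))
        + secondForm ι ν q (e m) (e j) * secondForm ι ν q (e l) (e i)
        - secondForm ι ν q (e l) (e j) * secondForm ι ν q (e m) (e i) :=
    h1.symm.trans (hg.trans (congrArg₂ _ (congrArg₂ _ h2 rfl) rfl))
  rw [h3, wedgeSq]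
  simp only [Matrix.of_apply, shapeForm_eq hι hν]
  ring

include hν in
lemma secondForm_nonpos (hΓ : IsSmoothConvexHypersurface (E := E) (F := F) ι C)
    (hk : Module.finrank ℝ F = k) (hE : Module.finrank ℝ E = k + 1)
    (he : IsOrthonormalFrame (inducedMetric (E := E) ι) q e) (u : TangentSpace 𝓘(ℝ, F) q) :
    secondForm ι ν q u u ≤ 0 := by
  have hι : ContMDiff 𝓘(ℝ, F) 𝓘(ℝ, E) ∞ ι := hΓ.isSmoothEmbedding.contMDiff
  set φ := extChartAt 𝓘(ℝ, E) (ι q) with hφ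
  set y₀ := extChartAt 𝓘(ℝ, F) q q with hy₀
  have hf : ContDiffAt ℝ ∞ (localExpr (E := E) ι q) y₀ :=
    (contDiffOn_localExpr (E := E) hι q).contDiffAt
    ((isOpen_localDomain hι.continuous q).mem_nhds (mem_localDomain ι q))
  have hG := isMetricOn_metricInChart (E := E) M (ι q)
  have hx₀ : localExpr ι q y₀ ∈ φ.target := mapsTo_localExpr ι q (mem_localDomain ι q)
  have hT : φ.target ∈ 𝓝 (localExpr ι q y₀) := hG.isOpen.mem_nhds hx₀
  have hcont : ContinuousOn φ.symm φ.target := continuousOn_extChartAt_symm (ι q)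
  have hspan := exists_eq_fderiv_add_smul hι hk he hν.unit hν.normal hE
  have hφx₀ : φ.symm (localExpr ι q y₀) = ι q := by
    rw [localExpr_self]; exact extChartAt_to_inv (ι q)
  obtain ⟨ρ, hρ, hρf, hρn, hρS⟩ := exists_defining_function (Γ := φ.symm ⁻¹' frontier C)
    (S := φ.symm ⁻¹' C) hf hspan
    (eq_zero_of_fderiv_add_smul_eq_zero hι hk he hν.unit hν.normal) hT
    (fun B hB hBc hBd ⟨x, hxB, hxS⟩ ↦ image_subset_iff.1
      (IsPreconnected.subset_of_disjoint_frontier (hBc.image _ (hcont.mono hB))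
        (disjoint_left.2 (by rintro _ ⟨z, hz, rfl⟩ h; exact disjoint_left.1 hBd hz h))
        ⟨φ.symm x, mem_image_of_mem _ hxB, hxS⟩))
    -- Since `ι` is a topological embedding, no other sheet of the boundary comes close to `ι q`.
    (fun V hV ↦ by
      have h1 : extChartAt 𝓘(ℝ, F) q ⁻¹' V ∩ (extChartAt 𝓘(ℝ, F) q).source ∈ 𝓝 q :=
        inter_mem ((continuousAt_extChartAt q).preimage_mem_nhds hV) (extChartAt_source_mem_nhds q)
      rw [hΓ.isSmoothEmbedding.isEmbedding.nhds_eq_comap, mem_comap] at h1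
      obtain ⟨O, hO, hOs⟩ := h1
      refine ⟨φ.target ∩ φ.symm ⁻¹' O, inter_mem hT
        ((hcont.continuousAt hT).preimage_mem_nhds (hφx₀ ▸ hO)), ?_⟩
      rintro x ⟨⟨hxT, hxO⟩, hxΓ⟩
      rw [mem_preimage, ← hΓ.range_eq] at hxΓ
      obtain ⟨q', hq'⟩ := hxΓ
      have hq'2 := hOs (show ι q' ∈ O from hq' ▸ hxO)
      refine ⟨extChartAt 𝓘(ℝ, F) q q', hq'2.1, ?_⟩
      rw [localExpr, (extChartAt 𝓘(ℝ, F) q).left_inv hq'2.2, hq']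
      exact φ.right_inv hxT)
    (by
      filter_upwards [hν.before q] with t ht
      rw [localExpr_self, localNormal_self]
      rwa [chartDeriv_self_apply] at ht)
    (by
      filter_upwards [hν.after q] with t ht
      rw [localExpr_self, localNormal_self]
      rwa [chartDeriv_self_apply] at ht)
  refine inner_covHessian_nonpos hG hf hx₀ hspan
    (inner_localNormal_self hν.unit (mem_localDomain ι q))
    (fun u ↦ inner_localNormal_fderiv hι hν.normal (mem_localDomain ι q) u) hT
    (fun c w δ hδ hc h1 h2 ↦ ?_) hρ hρf hρn hρS u
  -- Geodesics of the chart metric become geodesics of `M`, the chart centred at `ι q` serving at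
  -- all times.
  refine hΓ.convex (fun t ↦ φ.symm (c t)) (-δ) δ (by linarith) (fun t ht ↦ ⟨ι q, w, ?_⟩) h1 h2 0
    ⟨by linarith, hδ.le⟩
  filter_upwards [(hc t ht).eventually_nhds] with τ hτ
  obtain ⟨hτT, hcw, hw⟩ := hτ.self_of_nhds
  refine ⟨φ.map_target hτT, hcw.congr_of_eventuallyEq ?_, ?_⟩
  · filter_upwards [hτ] with r hr using φ.right_inv hr.1
  · rw [show extChartAt 𝓘(ℝ, E) (ι q) (φ.symm (c τ)) = c τ from φ.right_inv hτT]
    exact hw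

include hν in
lemma posSemidef_shapeForm (hΓ : IsSmoothConvexHypersurface (E := E) (F := F) ι C)
    (hk : Module.finrank ℝ F = k) (hE : Module.finrank ℝ E = k + 1)
    (he : IsOrthonormalFrame (inducedMetric (E := E) ι) q e) :
    (Matrix.of fun i j ↦ shapeForm ι ν q e i (e j)).PosSemidef := by
  have hι : ContMDiff 𝓘(ℝ, F) 𝓘(ℝ, E) ∞ ι := hΓ.isSmoothEmbedding.contMDiff
  refine posSemidef_of_sum_nonneg (fun i j ↦ ?_) fun c ↦ ?_
  · simp only [Matrix.of_apply, shapeForm_eq hι hν, secondForm_symm hι (e i)]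
  · have h := secondForm_nonpos hν e hΓ hk hE he (∑ i, c i • e i)
    have h2 : secondForm ι ν q (∑ i, c i • e i) (∑ i, c i • e i)
        = ∑ i, ∑ j, c i * c j * secondForm ι ν q (e j) (e i) := by
      have hB : ∀ (B : F →L[ℝ] F →L[ℝ] ℝ) (v : Fin k → F), B (∑ i, c i • v i) (∑ i, c i • v i)
          = ∑ i, ∑ j, c i * c j * B (v j) (v i) := fun B v ↦ by
        simp only [map_sum, map_smul, sum_apply, smul_apply, smul_eq_mul, Finset.mul_sum, mul_assoc]
      -- These maps exhibit `secondForm` as a continuous bilinear form, so that `hB` expands it.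
      let D := fderiv ℝ (localExpr (E := E) ι q) (extChartAt 𝓘(ℝ, F) q q)
      let G := metricInChart (ambientMetric (E := E) M) (ι q)
        (localExpr ι q (extChartAt 𝓘(ℝ, F) q q)) (localNormal ι ν q (extChartAt 𝓘(ℝ, F) q q))
      let B : F →L[ℝ] F →L[ℝ] E :=
        fderiv ℝ (fderiv ℝ (localExpr (E := E) ι q)) (extChartAt 𝓘(ℝ, F) q q)
        + (christoffel (metricInChart (ambientMetric M) (ι q))
          (localExpr ι q (extChartAt 𝓘(ℝ, F) q q))).bilinearComp D D
      exact hB ((ContinuousLinearMap.compL ℝ F E ℝ G).comp B) e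
    rw [h2] at h
    simp only [Matrix.of_apply, shapeForm_eq hι hν, mul_neg, Finset.sum_neg_distrib]
    linarith

/-- The algebraic inequality with `R` the ambient curvature on the pushed-forward frame; the Gauss
equation identifies `R + A ∧ A` with the intrinsic curvature. -/
lemma pfaffian_inducedMetric_le (hM : IsCartanHadamard (E := E) M)
    (hμ : Module.finrank ℝ E ≤ nullityIndex (ambientMetric (E := E) M) + 3)
    (hΓ : IsSmoothConvexHypersurface (E := E) (F := F) ι C)
    (hν : IsOutwardUnitNormal (F := F) ι C ν)
    (hk : Module.finrank ℝ F = k) (hE : Module.finrank ℝ E = k + 1) (hk2 : Even k)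
    (he : IsOrthonormalFrame (inducedMetric (E := E) ι) q e) :
    pfaffian (inducedMetric (E := E) ι) q hk2 e ≤ gaussKronecker ι ν q e := by
  have h := doubleAlternation_pfaffian_le hk2
    (isNonposOfRankThree_curvatureForm hM hμ (ι q) fun i ↦ differential ι q (e i))
    (posSemidef_shapeForm hν e hΓ hk hE he)
  simp only [← curvatureForm_inducedMetric hΓ.isSmoothEmbedding.contMDiff hν e hk hE he] at h
  rw [pfaffian_eq, gaussKronecker, ← mul_assoc, one_div_mul_one_div, one_div_mul_eq_div,
    div_le_iff₀ (by positivity)]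
  linarith

end ConvexHypersurface

end Riem

end

/-! ### The main theorem -/

theorem mainTheorem3 (n : ℕ)
    {M : Type*} [MetricSpace M] [ChartedSpace (EuclideanSpace ℝ (Fin n)) M]
    [IsManifold (𝓡 n) ∞ M]
    [RiemannianBundle (fun x : M ↦ TangentSpace (𝓡 n) x)]
    [IsContMDiffRiemannianBundle (𝓡 n) ∞ (EuclideanSpace ℝ (Fin n))
      (fun x : M ↦ TangentSpace (𝓡 n) x)]
    [IsRiemannianManifold (𝓡 n) M]
    (hM : Riem.IsCartanHadamard (E := EuclideanSpace ℝ (Fin n)) M)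
    (hμ : (n : ℤ) - 3 ≤
      (Riem.nullityIndex (Riem.ambientMetric (E := EuclideanSpace ℝ (Fin n)) M) : ℤ))
    {N : Type*} [TopologicalSpace N] [ChartedSpace (EuclideanSpace ℝ (Fin (n - 1))) N]
    [IsManifold (𝓡 (n - 1)) ∞ N]
    (ι : N → M) (C : Set M)
    (hΓ : Riem.IsSmoothConvexHypersurface (E := EuclideanSpace ℝ (Fin n))
      (F := EuclideanSpace ℝ (Fin (n - 1))) ι C)
    (ν : ∀ q : N, TangentSpace (𝓡 n) (ι q))
    (hν : Riem.IsOutwardUnitNormal (F := EuclideanSpace ℝ (Fin (n - 1))) ι C ν) :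
    (∀ hn : Odd n, ∀ (q : N) (e : Fin (n - 1) → TangentSpace (𝓡 (n - 1)) q),
      Riem.IsOrthonormalFrame
        (Riem.inducedMetric (E := EuclideanSpace ℝ (Fin n)) ι) q e →
      Riem.pfaffian (Riem.inducedMetric (E := EuclideanSpace ℝ (Fin n)) ι) q
          (Nat.Odd.sub_odd hn odd_one) e
        ≤ Riem.gaussKronecker ι ν q e) ∧
    (∀ hn : Even n, 4 ≤ n →
      (∀ p ∈ C, ∀ e : Fin n → TangentSpace (𝓡 n) p,
        Riem.IsOrthonormalFrame (Riem.ambientMetric M) p e →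
        Riem.pfaffian (Riem.ambientMetric M) p hn e = 0) ∧
      (∀ (q : N) (e : Fin (n - 1) → TangentSpace (𝓡 (n - 1)) q),
        Riem.IsOrthonormalFrame
          (Riem.inducedMetric (E := EuclideanSpace ℝ (Fin n)) ι) q e →
        Riem.transgression ι ν q e ≤ Riem.gaussKronecker ι ν q e)) := by
  have hE : Module.finrank ℝ (EuclideanSpace ℝ (Fin n)) = n := finrank_euclideanSpace_fin
  have hF : Module.finrank ℝ (EuclideanSpace ℝ (Fin (n - 1))) = n - 1 := finrank_euclideanSpace_fin
  have hμ' : Module.finrank ℝ (EuclideanSpace ℝ (Fin n))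
      ≤ Riem.nullityIndex (Riem.ambientMetric (E := EuclideanSpace ℝ (Fin n)) M) + 3 := by
    omega
  refine ⟨fun hn q e he ↦ ?_, fun hn hn4 ↦ ⟨fun p _ e _ ↦ ?_, fun q e he ↦ ?_⟩⟩
  -- Positivity gives `n = (n - 1) + 1` despite the truncated subtraction.
  · have hn0 := hn.pos
    exact Riem.pfaffian_inducedMetric_le e hM hμ' hΓ hν hF (by omega) _ he
  · rw [Riem.pfaffian_eq, Riem.doubleAlternation_pfaffian_eq_zero hn4
      (Riem.isNonposOfRankThree_curvatureForm hM hμ' p e), mul_zero, mul_zero]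
  · exact Riem.transgression_le (by omega) e
      (Riem.isNonposOfRankThree_curvatureForm hM hμ' (ι q) fun i ↦ Riem.differential ι q (e i))
      (Riem.posSemidef_shapeForm hν e hΓ hF (by omega) he)
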